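/- Let $\mathbb T=\mathbb R/\mathbb Z$ with its quotient metric $d$ and Haar probability measure $\mathrm{Leb}$, let $0<\alpha<1$, and let $f:\mathbb T\to\mathbb T$ be an orientation preserving covering map for which there are a finite set $P\subset\mathbb T$ and an integer $N\ge 0$ such that, writing $P_0=f^N(P)$: (1) every point of $P_0$ is a fixed point of $f$, and $f$ is $C^{1+\alpha}$ on each component of $\mathbb T\setminus P$ (i.e. $f$ is differentiable there with $\alpha$-Hölder derivative on each component); (2) the limits $Df(x^{+})=\lim_{y\downarrow x}Df(y)$ and $Df(x^{-})=\lim_{y\uparrow x}Df(y)$ exist for all $x\in\mathbb T$, with $Df(p^-)\ge Df(p^+)\ge 1$ for $p\in P_0$ and $Df(x^-)\ge Df(x^+)>1$ for $x\in\mathbb T\setminus P_0$; (3) for each $p\in P_0$, if $Df(p^+)=1$ (resp. $Df(p^-)=1$), then $(Df(x)-1)/d(x,p)^\alpha$ converges to a positive number as $x\downarrow p$ (resp. $x\uparrow p$). For $t\in\mathbb R$ let $f_t(x)=f(x)+t \pmod 1$, and for $\mathbf t=(t_0,t_1,\dots)$ let $f^n_{\mathbf t}=f_{t_{n-1}}\circ\dots\circ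 f_{t_0}$ and $\sigma(\mathbf t)=(t_1,t_2,\dots)$. For $\varepsilon>0$ let $\theta_\varepsilon$ be the normalized Lebesgue measure on $[-\varepsilon,\varepsilon]$ and $\mathbb P_\varepsilon=\mathrm{Leb}\times\theta_\varepsilon^{\mathbb N}$ on $\mathbb T\times[-\varepsilon,\varepsilon]^{\mathbb N}$. Let $I$ be a neighbourhood of $P_0$, each component of which contains a unique point of $P_0$, such that for every $g=f_t$ with $|t|$ sufficiently small (in particular for $g=f$): (i) $g(I)$ compactly contains $I$; (ii) $g|_I$ is injective; (iii) if $x\in I$ and $g(x)\notin I$ then $g^2(x)\notin I$; (iv) if $x,g(x)\in I$ then $x$ and $g(x)$ lie in the same component of $I$. Let $\tau_*\in(0,1/2)$ be smaller than the distance from $f^{-1}(I)\cap I$ to $\mathbb T\setminus I$. Put $E(x,\mathbf t)=\inf\{m\ge 0: f^m_{\mathbf t}(x)\notin I\}$, let $U^{(n)}(x,\mathbf t)$ be the component containing $x$ of $(f^n_{\mathbf t})^{-1}(B_{\tau_*}(f^n_{\mathbf t}(x)))$, where $B_r(z)$ is the open ball of radius $r$ about $z$, and let $$\mathcal L^{(n)}(x,\mathbf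 t)=\sup_{y\in U^{(n)}(x,\mathbf t)}\ \sum_{j=0}^{n-1}\left(\frac{1}{Df^{\,n-j}_{\sigma^j(\mathbf t)}(f^j_{\mathbf t}(y)^+)}\right)^{\alpha}.$$ For $K>0$, an integer $m\ge 1$ is called a $K$-scale expansion time of $(x,\mathbf t)$ if $\mathcal L^{(m)}(x,\mathbf t)\le K$ and $m\ge E(x,\mathbf t)$; let $m_K(x,\mathbf t)\in\mathbb N\cup\{\infty\}$ be the infimum of all $K$-scale expansion times of $(x,\mathbf t)$. **Theorem.** For every $\tilde\alpha\in(\alpha,1)$ there exist constants $K_0>0$, $C_0>0$ and $\varepsilon_0>0$ such that for every $\varepsilon\in(0,\varepsilon_0)$ and every integer $m\ge 1$, $$\mathbb P_\varepsilon\big(\{(x,\mathbf t): m_{K_0}(x,\mathbf t)\ge m\}\big)\le C_0\,m^{-1/\tilde\alpha}.$$ -/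

import Mathlib

open Set Filter Topology MeasureTheory
open scoped ENNReal

noncomputable section

namespace CircleNoise

/-- The circle `ℝ / ℤ`, with its quotient metric and its normalized Haar measure. -/
abbrev Circ : Type := UnitAddCircle

/-- The signed representative in `(-1/2, 1/2]` of a point of the circle. -/
def signedRep (z : Circ) : ℝ := (AddCircle.equivIoc (1 : ℝ) (-(1 / 2)) z : ℝ)

/-- The expression of `g` near `x` in the coordinates `h ↦ x + h` and `h ↦ g x + h`. -/
def localExpr (g : Circ → Circ) (x : Circ) (h : ℝ) : ℝ :=
  signedRep (g (x + (h : Circ)) - g x)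

/-- The derivative `Dg(x)` of a circle map. -/
def circDeriv (g : Circ → Circ) (x : Circ) : ℝ := deriv (localExpr g x) 0

/-- `Dg(x⁺)`, the limit of `Dg(y)` as `y ↓ x`. -/
def derivRight (g : Circ → Circ) (x : Circ) : ℝ :=
  limUnder (𝓝[>] (0 : ℝ)) (fun h : ℝ => circDeriv g (x + (h : Circ)))

/-- `Dg(x⁻)`, the limit of `Dg(y)` as `y ↑ x`. -/
def derivLeft (g : Circ → Circ) (x : Circ) : ℝ :=
  limUnder (𝓝[<] (0 : ℝ)) (fun h : ℝ => circDeriv g (x + (h : Circ)))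

/-- Orientation preserving covering maps of the circle. -/
def IsOrientedCovering (f : Circ → Circ) : Prop :=
  IsCoveringMap f ∧
    ∃ F : ℝ → ℝ, Continuous F ∧ StrictMono F ∧ ∀ x : ℝ, f (x : Circ) = (F x : Circ)

/-- The set `P₀ = f^N(P)`. -/
def fixedSet (f : Circ → Circ) (P : Finset Circ) (N : ℕ) : Set Circ := (f^[N]) '' (P : Set Circ)

/-- `f` is a (topologically) expanding circle map with neutral fixed points of order `α`, i.e. `f`
belongs to the class `𝓔_α`, as witnessed by the finite set `P` and the integer `N`. -/
structure IsNeutralExpanding (α : ℝ) (f : Circ → Circ) (P : Finset Circ) (N : ℕ) : Prop where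
  covering : IsOrientedCovering f
  fixed : ∀ p ∈ fixedSet f P N, f p = p
  /-- `f` is differentiable on the complement of `P` ... -/
  differentiable : ∀ x ∉ P, DifferentiableAt ℝ (localExpr f x) 0
  /-- ... and its derivative is `α`-Hölder on each component of this complement: two points of
  one component are the endpoints `x`, `x + ℓ` of an arc that misses `P`. -/
  holder : ∃ C : ℝ, ∀ (x : Circ) (l : ℝ), 0 ≤ l →
    (∀ s ∈ Icc (0 : ℝ) l, x + (s : Circ) ∉ P) →
      |circDeriv f (x + (l : Circ)) - circDeriv f x| ≤ C * l ^ α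
  /-- the one-sided limits `Df(x⁺)`, `Df(x⁻)` exist -/
  right_lim : ∀ x, Tendsto (fun h : ℝ => circDeriv f (x + (h : Circ))) (𝓝[>] 0)
    (𝓝 (derivRight f x))
  left_lim : ∀ x, Tendsto (fun h : ℝ => circDeriv f (x + (h : Circ))) (𝓝[<] 0)
    (𝓝 (derivLeft f x))
  deriv_jump : ∀ x, derivRight f x ≤ derivLeft f x
  one_le_deriv : ∀ p ∈ fixedSet f P N, 1 ≤ derivRight f p
  one_lt_deriv : ∀ x ∉ fixedSet f P N, 1 < derivRight f x
  neutral_right : ∀ p ∈ fixedSet f P N, derivRight f p = 1 →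
    ∃ A : ℝ, 0 < A ∧
      Tendsto (fun h : ℝ => (circDeriv f (p + (h : Circ)) - 1) / |h| ^ α) (𝓝[>] 0) (𝓝 A)
  neutral_left : ∀ p ∈ fixedSet f P N, derivLeft f p = 1 →
    ∃ A : ℝ, 0 < A ∧
      Tendsto (fun h : ℝ => (circDeriv f (p + (h : Circ)) - 1) / |h| ^ α) (𝓝[<] 0) (𝓝 A)

/-- The perturbed map `f_t(x) = f(x) + t`. -/
def perturb (f : Circ → Circ) (t : ℝ) (x : Circ) : Circ := f x + (t : Circ)

/-- The random iterate `f_𝐭^n = f_{t_{n-1}} ∘ ⋯ ∘ f_{t_0}`. -/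
def randIter (f : Circ → Circ) (t : ℕ → ℝ) : ℕ → Circ → Circ
  | 0 => id
  | n + 1 => fun x => perturb f (t n) (randIter f t n x)

/-- The iterated shift `σ^j`. -/
def shift (j : ℕ) (t : ℕ → ℝ) : ℕ → ℝ := fun i => t (i + j)

/-- The uniform distribution `θ_ε` on `[-ε, ε]`. -/
def noise (ε : ℝ) : Measure ℝ := ProbabilityTheory.cond volume (Icc (-ε) ε)

theorem isProbabilityMeasure_noise {ε : ℝ} (hε : 0 < ε) : IsProbabilityMeasure (noise ε) := by
  apply ProbabilityTheory.cond_isProbabilityMeasure_of_finite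
  · rw [Real.volume_Icc]
    simp only [ne_eq, ENNReal.ofReal_eq_zero, not_le]
    linarith
  · rw [Real.volume_Icc]
    exact ENNReal.ofReal_ne_top

/-- The measure `ℙ_ε = Leb × θ_ε^ℕ`; it is carried by the noise sequences in `[-ε, ε]^ℕ`. -/
def noiseProd (ε : ℝ) (hε : 0 < ε) : Measure (Circ × (ℕ → ℝ)) :=
  haveI := isProbabilityMeasure_noise hε
  (volume : Measure Circ).prod (Measure.infinitePi (fun _ : ℕ => noise ε))

/-- `U_τ^{(n)}(x, 𝐭)`. -/
def pullback (f : Circ → Circ) (τ : ℝ) (n : ℕ) (x : Circ) (t : ℕ → ℝ) : Set Circ :=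
  connectedComponentIn (randIter f t n ⁻¹' Metric.ball (randIter f t n x) τ) x

/-- The distortion sum `𝓛_τ^{(n)}(x, 𝐭)`. -/
def distortionSum (α : ℝ) (f : Circ → Circ) (τ : ℝ) (n : ℕ) (x : Circ) (t : ℕ → ℝ) : ℝ≥0∞ :=
  ⨆ y ∈ pullback f τ n x t, ENNReal.ofReal
    (∑ j ∈ Finset.range n,
      (1 / derivRight (randIter f (shift j t) (n - j)) (randIter f t j y)) ^ α)

/-- The properties (i)-(iv) of the neighbourhood `I` with respect to the map `g`. -/
structure IsEscapeDomain (g : Circ → Circ) (I : Set Circ) : Prop where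
  compactly_contained : closure I ⊆ interior (g '' I)
  injOn : InjOn g I
  no_return : ∀ x ∈ I, g x ∉ I → g (g x) ∉ I
  same_component : ∀ x ∈ I, g x ∈ I → connectedComponentIn I x = connectedComponentIn I (g x)

/-- `I` is a neighbourhood of `P₀` each component of which contains a unique point of `P₀`, and
which has the properties (i)-(iv) with respect to all `f_t` with `|t|` small (including `f`). -/
structure IsEscapeNhd (f : Circ → Circ) (P₀ I : Set Circ) : Prop where
  mem_nhdsSet : I ∈ 𝓝ˢ P₀
  unique_fixed : ∀ x ∈ I, ∃! p, p ∈ P₀ ∩ connectedComponentIn I x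
  escape : ∃ δ : ℝ, 0 < δ ∧ ∀ t : ℝ, |t| ≤ δ → IsEscapeDomain (perturb f t) I

/-- `τ` is an admissible scale `τ_*`: it lies in `(0, 1/2)` and is smaller than the distance from
`f⁻¹(I) ∩ I` to the complement of `I`. -/
def IsScale (f : Circ → Circ) (I : Set Circ) (τ : ℝ) : Prop :=
  0 < τ ∧ τ < 1 / 2 ∧ ENNReal.ofReal τ < ⨅ x ∈ f ⁻¹' I ∩ I, ⨅ y ∈ Iᶜ, edist x y

/-- The first escaping time `E(x, 𝐭)` (`⊤` if the orbit never leaves `I`). -/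
def escapeTime (f : Circ → Circ) (I : Set Circ) (x : Circ) (t : ℕ → ℝ) : ℕ∞ :=
  ⨅ (m : ℕ) (_ : randIter f t m x ∉ I), (m : ℕ∞)

/-- `m` is a `K`-scale expansion time of `(x, 𝐭)`. -/
def IsExpansionTime (α : ℝ) (f : Circ → Circ) (I : Set Circ) (τ K : ℝ) (x : Circ) (t : ℕ → ℝ)
    (m : ℕ) : Prop :=
  1 ≤ m ∧ distortionSum α f τ m x t ≤ ENNReal.ofReal K ∧ escapeTime f I x t ≤ (m : ℕ∞)

/-- `m_K(x, 𝐭)`, the first `K`-scale expansion time (`⊤` if there is none). -/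
def firstExpansionTime (α : ℝ) (f : Circ → Circ) (I : Set Circ) (τ K : ℝ) (x : Circ)
    (t : ℕ → ℝ) : ℕ∞ :=
  ⨅ (m : ℕ) (_ : IsExpansionTime α f I τ K x t m), (m : ℕ∞)

end CircleNoise

end

noncomputable section

namespace CircleNoise

/-! ### Truncated zeta sums -/

section

/-! Write `p = 1/α`. The argument gives the rate `m^{-p}`, which is better than the rate asked for.

Deterministic part. Attach to the orbit of `x` a weight that starts at `0`, grows by `ε^α` at each
time spent in `I` and is divided by a constant `μ > 1` at each time spent outside. Whenever the
orbit is outside `I`, the distortion sum is at most a constant plus a multiple of the weight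
(`GoodConstant.exists_distortion_bound`), so such a time `n ≥ 1` is a scale expansion time once the
weight is at most `K`. Indeed the sums obey `S_{n+1} = (S_n + 1) Df^{-α}`. Away from `P₀` the map is
uniformly expanding and contracts `S`; a passage of length `n` near `P₀` adds at most `A (1 + n
ε^α)` (`GoodConstant.exists_passage_bound`). This last bound is the heart of the matter, the trivial
one being `n`. For the drift `g(u) = G(u) - u` one has `g(u_{i+1}) ≈ Df(u_i) g(u_i)` without noise,
so `g^α` compensates the factors `Df^{-α}`. A corrected `g^α` does so under noise wherever `g ≥ 2ε`
(`ExpandingSide.exists_potential`); on entry to that region `g` is of order `ε`, so every earlier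
step counts only `ε^α`. By the choice of `τ_*`, a point of `U^{(n)}` is near `P₀` only at times when
the orbit of `x` is in `I` (`mem_of_dist_lt`), so one weight controls the whole supremum.

Probabilistic part. The distance of two orbits under the same noise near a neutral point grows at
least like `ℓ ↦ ℓ + c ℓ^{1+α}`, so if both stay for a time `k` they start within `O(k^{-p})`
(`NeutralPoint.sub_le_rpow`). Orbits away from `P₀` leave `I` in bounded time
(`GoodConstant.exists_escape_time`). Hence, for any fixed later noise, a stay of length `k` in `I`
has probability `O(k^{-p})` for a Lebesgue random point, and `O(k^{-p}/ε)` after a fresh noise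
(`GoodConstant.exists_stay_bound`). The mean gain of weight in a sojourn is of order `ε^α ∑ₖ min(1,
k^{-p}/ε) = O(1)`, so above a large `K` a visit outside `I` and the sojourn after it multiply the
weight in mean by at most some `ρ < 1`.

The tail estimate `measure_weight_lt_le` combines these facts. If the weight is above `K` at all
visits outside `I` before time `m`, then either the first sojourn lasts about `m/2`, or the `i`-th
of these visits, for some `i`, is followed by a sojourn of order `q^i m`. The latter has probability
`O(m^{-p} q^{-ip}/ε)` at that moment, while reaching it costs `ρ^i` times the mean initial weight
above `K`, which is `O(ε)`. The powers of `ε` cancel, and for `q^{-p} = ρ^{-1/2}` the sum over `i`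
converges. -/

theorem rpow_neg_le_telescope {p : ℝ} (hp : 1 < p) {n : ℕ} (hn : 1 ≤ n) :
    ((n + 1 : ℕ) : ℝ) ^ (-p) ≤ ((n : ℝ) ^ (1 - p) - ((n + 1 : ℕ) : ℝ) ^ (1 - p)) / (p - 1) := by
  have hn0 : (0 : ℝ) < n := by exact_mod_cast hn
  have hn1 : (0 : ℝ) < ((n + 1 : ℕ) : ℝ) := by positivity
  rw [le_div_iff₀ (by linarith)]
  set y : ℝ := 1 / ((n + 1 : ℕ) : ℝ) with hy
  have hxy : (n : ℝ) = ((n + 1 : ℕ) : ℝ) * (1 - y) := by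
    rw [hy]; field_simp; push_cast; ring
  have h1y : 0 < 1 - y := by
    by_contra h
    have := mul_nonpos_of_nonneg_of_nonpos hn1.le (not_lt.1 h)
    linarith
  -- Dividing by `(n + 1)^{1-p}` reduces the claim to this Bernoulli inequality, a consequence of
  -- `log (1 - y) ≤ -y` and `1 + x ≤ exp x`.
  have key : 1 + (p - 1) * y ≤ (1 - y) ^ (1 - p) := by
    rw [Real.rpow_def_of_pos h1y]
    have h1 := Real.log_le_sub_one_of_pos h1y
    have h2 := Real.add_one_le_exp (Real.log (1 - y) * (1 - p))
    nlinarith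
  have e1 : ((n + 1 : ℕ) : ℝ) ^ (-p) = ((n + 1 : ℕ) : ℝ) ^ (1 - p) * y := by
    rw [hy, sub_eq_add_neg, Real.rpow_add hn1, Real.rpow_one]; field_simp
  have e2 : (n : ℝ) ^ (1 - p) = ((n + 1 : ℕ) : ℝ) ^ (1 - p) * (1 - y) ^ (1 - p) := by
    conv_lhs => rw [hxy]
    rw [Real.mul_rpow hn1.le h1y.le]
  rw [e1, e2]
  have := Real.rpow_pos_of_pos hn1 (1 - p)
  nlinarith

/-- The truncated zeta sums `∑ₖ max(k, κ)^{-p}` are of order `κ^{1-p}`. -/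
theorem tsum_max_rpow_le {p : ℝ} (hp : 1 < p) {κ : ℕ} (hκ : 1 ≤ κ) :
    ∑' k : ℕ, ENNReal.ofReal (((max (k + 1) κ : ℕ) : ℝ) ^ (-p)) ≤
      ENNReal.ofReal ((1 + 1 / (p - 1)) * (κ : ℝ) ^ (1 - p)) := by
  have hκ0 : (0 : ℝ) < κ := by exact_mod_cast hκ
  have hp1 : 0 < p - 1 := by linarith
  -- The first `κ` terms all equal `κ^{-p}`; the later ones telescope.
  have main : ∀ n : ℕ, ∑ k ∈ Finset.range n, ((max (k + 1) κ : ℕ) : ℝ) ^ (-p) ≤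
      ((min n κ : ℕ) : ℝ) * (κ : ℝ) ^ (-p) +
        ((κ : ℝ) ^ (1 - p) - ((max n κ : ℕ) : ℝ) ^ (1 - p)) / (p - 1) := by
    intro n
    induction n with
    | zero => simp
    | succ n ih =>
      rw [Finset.sum_range_succ]
      rcases Nat.lt_or_ge n κ with h | h
      · rw [max_eq_right (show n + 1 ≤ κ from h), min_eq_left (show n + 1 ≤ κ from h)]
        rw [max_eq_right h.le, min_eq_left h.le] at ih
        push_cast at ih ⊢
        linarith
      · rw [max_eq_left (show κ ≤ n + 1 by omega), min_eq_right (show κ ≤ n + 1 by omega)]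
        rw [max_eq_left h, min_eq_right h] at ih
        have := rpow_neg_le_telescope hp (hκ.trans h)
        rw [sub_div] at this ih ⊢
        linarith
  refine ENNReal.tsum_le_of_sum_range_le fun n => ?_
  rw [← ENNReal.ofReal_sum_of_nonneg (fun k _ => by positivity)]
  refine ENNReal.ofReal_le_ofReal ((main n).trans ?_)
  have h1 : ((min n κ : ℕ) : ℝ) * (κ : ℝ) ^ (-p) ≤ (κ : ℝ) ^ (1 - p) := by
    rw [sub_eq_add_neg, Real.rpow_add hκ0, Real.rpow_one]
    gcongr
    exact min_le_right _ _
  have h2 : ((κ : ℝ) ^ (1 - p) - ((max n κ : ℕ) : ℝ) ^ (1 - p)) / (p - 1) ≤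
      (κ : ℝ) ^ (1 - p) / (p - 1) := by
    gcongr
    linarith [Real.rpow_nonneg (Nat.cast_nonneg (α := ℝ) (max n κ)) (1 - p)]
  calc _ ≤ (κ : ℝ) ^ (1 - p) + (κ : ℝ) ^ (1 - p) / (p - 1) := add_le_add h1 h2
    _ = _ := by ring

/-! ### Random orbits, sojourns and weights -/

section Chain

variable {X : Type*}

/-- The sequence `s, t₀, t₁, …`. -/
def consNoise (s : ℝ) (t : ℕ → ℝ) : ℕ → ℝ
  | 0 => s
  | n + 1 => t n

/-- The random orbit of `x` under the maps `φ (·) tᵢ`. -/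
def chain (φ : X → ℝ → X) (x : X) (t : ℕ → ℝ) : ℕ → X
  | 0 => x
  | n + 1 => φ (chain φ x t n) (t n)

theorem chain_cons (φ : X → ℝ → X) (x : X) (s : ℝ) (t : ℕ → ℝ) (n : ℕ) :
    chain φ x (consNoise s t) (n + 1) = chain φ (φ x s) t n := by
  induction n with
  | zero => rfl
  | succ n ih => rw [chain, ih]; rfl

/-- The random orbit of `x` stays in `I` at the times `0, …, k - 1`. -/
def Stays (φ : X → ℝ → X) (I : Set X) (k : ℕ) (x : X) (t : ℕ → ℝ) : Prop :=
  ∀ j < k, chain φ x t j ∈ I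

theorem stays_cons (φ : X → ℝ → X) (I : Set X) (k : ℕ) (x : X) (s : ℝ) (t : ℕ → ℝ) :
    Stays φ I (k + 1) x (consNoise s t) ↔ x ∈ I ∧ Stays φ I k (φ x s) t := by
  constructor
  · intro h
    exact ⟨h 0 (Nat.succ_pos k), fun j hj => by
      rw [← chain_cons]; exact h (j + 1) (Nat.succ_lt_succ hj)⟩
  · rintro ⟨h0, h⟩ j hj
    rcases j with _ | j
    · exact h0
    · rw [chain_cons]; exact h j (Nat.lt_of_succ_lt_succ hj)

/-- The set of pairs (initial point, noise) that stay in `I` at the times `0, …, k - 1`. -/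
def staySet (φ : X → ℝ → X) (I : Set X) (k : ℕ) : Set (X × (ℕ → ℝ)) :=
  {q | Stays φ I k q.1 q.2}

/-- The time that a random orbit spends in `I` before it leaves `I`. -/
def sojourn (φ : X → ℝ → X) (I : Set X) (q : X × (ℕ → ℝ)) : ℝ≥0∞ :=
  ∑' k : ℕ, (staySet φ I (k + 1)).indicator 1 q

theorem sojourn_of_notMem (φ : X → ℝ → X) {I : Set X} {x : X} (hx : x ∉ I) (t : ℕ → ℝ) :
    sojourn φ I (x, t) = 0 := by
  refine ENNReal.tsum_eq_zero.2 fun k => indicator_of_notMem (fun h => hx ?_) _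
  exact h 0 (Nat.succ_pos k)

theorem sojourn_cons (φ : X → ℝ → X) {I : Set X} {x : X} (hx : x ∈ I) (s : ℝ) (t : ℕ → ℝ) :
    sojourn φ I (x, consNoise s t) = 1 + sojourn φ I (φ x s, t) := by
  have h : ∀ k, (staySet φ I (k + 1)).indicator (1 : X × (ℕ → ℝ) → ℝ≥0∞) (x, consNoise s t) =
      (staySet φ I k).indicator 1 (φ x s, t) := by
    intro k
    have : (x, consNoise s t) ∈ staySet φ I (k + 1) ↔ (φ x s, t) ∈ staySet φ I k := by
      simp only [staySet, mem_ofPred_eq, stays_cons, hx, true_and]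
    by_cases hk : (φ x s, t) ∈ staySet φ I k
    · rw [indicator_of_mem hk, indicator_of_mem (this.2 hk)]; rfl
    · rw [indicator_of_notMem hk, indicator_of_notMem (fun h => hk (this.1 h))]
  simp only [sojourn, h]
  rw [tsum_eq_zero_add' ENNReal.summable]
  congr 1
  rw [indicator_of_mem]
  · rfl
  · intro j hj; omega

/-- A long sojourn forces the orbit to stay. -/
theorem stays_of_lt_sojourn {φ : X → ℝ → X} {I : Set X} {q : X × (ℕ → ℝ)} {k : ℕ}
    (h : (k : ℝ≥0∞) < sojourn φ I q) : q ∈ staySet φ I (k + 1) := by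
  by_contra hq
  refine absurd h (not_lt.2 ?_)
  have : ∀ j ∉ Finset.range k, (staySet φ I (j + 1)).indicator (1 : X × (ℕ → ℝ) → ℝ≥0∞) q = 0 := by
    intro j hj
    have := Finset.mem_range.not.1 hj
    exact indicator_of_notMem (fun h => hq fun i hi => (show Stays φ I _ _ _ from h) i (by omega)) _
  rw [sojourn, tsum_eq_sum this]
  calc ∑ j ∈ Finset.range k, (staySet φ I (j + 1)).indicator (1 : X × (ℕ → ℝ) → ℝ≥0∞) q
      ≤ ∑ j ∈ Finset.range k, (1 : ℝ≥0∞) :=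
        Finset.sum_le_sum fun j _ => indicator_le_self' (fun _ _ => zero_le) _
    _ = k := by simp

/-- One step of the weight carried along a random orbit: it increases by `δ` inside `I` and is
divided by `μ` outside `I`. -/
def weightStep (I : Set X) (δ μ : ℝ≥0∞) (x : X) (z : ℝ≥0∞) : ℝ≥0∞ :=
  open Classical in if x ∈ I then z + δ else z / μ

/-- The weight carried along the random orbit of `x`, started at `z`. -/
def weight (φ : X → ℝ → X) (I : Set X) (δ μ : ℝ≥0∞) (x : X) (z : ℝ≥0∞) (t : ℕ → ℝ) : ℕ → ℝ≥0∞
  | 0 => z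
  | n + 1 => weightStep I δ μ (chain φ x t n) (weight φ I δ μ x z t n)

theorem weight_cons (φ : X → ℝ → X) (I : Set X) (δ μ : ℝ≥0∞) (x : X) (z : ℝ≥0∞) (s : ℝ)
    (t : ℕ → ℝ) (n : ℕ) :
    weight φ I δ μ x z (consNoise s t) (n + 1) =
      weight φ I δ μ (φ x s) (weightStep I δ μ x z) t n := by
  induction n with
  | zero => rfl
  | succ n ih => rw [weight, ih, chain_cons]; rfl

/-- Within `n` steps, the weight stays above `K` at the visits outside `I` until one of these
visits, the `j`-th one say, is followed by a sojourn of length at least `L (i + j)`. -/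
def Runaway (φ : X → ℝ → X) (I : Set X) (K δ μ : ℝ≥0∞) (L : ℕ → ℕ) :
    ℕ → X → ℝ≥0∞ → ℕ → (ℕ → ℝ) → Prop
  | 0, _, _, _, _ => False
  | n + 1, x, z, i, t =>
    (x ∉ I ∧ K < z ∧ (Stays φ I (L i) (φ x (t 0)) (fun k => t (k + 1)) ∨
      Runaway φ I K δ μ L n (φ x (t 0)) (z / μ) (i + 1) (fun k => t (k + 1)))) ∨
    (x ∈ I ∧ Runaway φ I K δ μ L n (φ x (t 0)) (z + δ) i (fun k => t (k + 1)))

theorem consNoise_tail (t : ℕ → ℝ) : consNoise (t 0) (fun k => t (k + 1)) = t := by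
  funext n; cases n <;> rfl

/-- If the sojourn lengths `L` have a total below the horizon, an orbit whose weight stays above
`K` runs away. -/
theorem runaway_of_lt_weight {φ : X → ℝ → X} {I : Set X} {K δ μ : ℝ≥0∞} {L : ℕ → ℕ} {A : ℕ → ℝ}
    (hA : ∀ i, 0 < A i) (hL : ∀ i, (L i : ℝ) + A (i + 1) ≤ A i) :
    ∀ (n : ℕ) (x : X) (z : ℝ≥0∞) (i : ℕ) (t : ℕ → ℝ) (r : ℕ), ¬ Stays φ I (r + 1) x t →
      (r : ℝ) + A i ≤ n →
      (∀ k < n, chain φ x t k ∉ I → K < weight φ I δ μ x z t k) →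
      Runaway φ I K δ μ L n x z i t := by
  -- `A i` is the time reserved for the sojourns with limits `L i, L (i + 1), …`, and `r` bounds the
  -- rest of the current sojourn. Since `A i > 0`, the horizon `n` cannot run out before one of the
  -- limits is exceeded.
  intro n
  induction n with
  | zero =>
    intro x z i t r _ h _
    have := hA i
    have : (0 : ℝ) ≤ r := Nat.cast_nonneg r
    simp only [Nat.cast_zero] at h
    linarith
  | succ n ih =>
    intro x z i t r hr hrn hK
    obtain ⟨s, t', rfl⟩ : ∃ s t', t = consNoise s t' := ⟨_, _, (consNoise_tail t).symm⟩
    have hK' : ∀ k < n, chain φ (φ x s) t' k ∉ I →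
        K < weight φ I δ μ (φ x s) (weightStep I δ μ x z) t' k := by
      intro k hk hk'
      rw [← weight_cons]
      exact hK (k + 1) (Nat.succ_lt_succ hk) (by rwa [chain_cons])
    push_cast at hrn
    by_cases hx : x ∈ I
    · right
      refine ⟨hx, ?_⟩
      rw [weightStep, if_pos hx] at hK'
      rw [stays_cons] at hr
      rcases r with _ | r
      · exact absurd ⟨hx, fun j hj => absurd hj (Nat.not_lt_zero j)⟩ hr
      · refine ih _ _ _ _ r (fun h => hr ⟨hx, h⟩) ?_ hK'
        push_cast at hrn
        linarith
    · left
      refine ⟨hx, hK 0 (Nat.succ_pos n) hx, ?_⟩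
      rw [weightStep, if_neg hx] at hK'
      by_cases hs : Stays φ I (L i) (φ x s) t'
      · exact Or.inl hs
      · right
        -- If the sojourn is shorter than `L i = l + 1`, then it and the step outside `I` before it
        -- together take at most `L i` steps.
        rcases hLi : L i with _ | l
        · exact absurd (fun j hj => absurd hj (by omega)) hs
        · refine ih _ _ _ _ l (by rwa [← hLi]) ?_ hK'
          have := hL i
          rw [hLi] at this
          push_cast at this
          have : (0 : ℝ) ≤ r := Nat.cast_nonneg r
          linarith

end Chain

/-! ### The law of the noise and the probability of running away -/

section Prob

variable {X : Type*} [MeasurableSpace X]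

theorem measurable_consNoise : Measurable (fun q : ℝ × (ℕ → ℝ) => consNoise q.1 q.2) := by
  refine measurable_pi_lambda _ fun n => ?_
  cases n with
  | zero => exact measurable_fst
  | succ n => exact (measurable_pi_apply n).comp measurable_snd

/-- The law of an i.i.d. sequence is the law of its first term followed by an independent copy of
the sequence. -/
theorem measurePreserving_consNoise (θ : Measure ℝ) [IsProbabilityMeasure θ] :
    MeasurePreserving (fun q : ℝ × (ℕ → ℝ) => consNoise q.1 q.2)
      (θ.prod (Measure.infinitePi fun _ : ℕ => θ)) (Measure.infinitePi fun _ : ℕ => θ) := by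
  refine ⟨measurable_consNoise, Measure.eq_infinitePi _ fun s u hu => ?_⟩
  classical
  rw [Measure.map_apply measurable_consNoise (.pi s.countable_toSet fun i _ => hu i)]
  set s' : Finset ℕ := (Finset.range (s.sup id)).filter fun n => n + 1 ∈ s with hs'
  have hmem : ∀ n, n ∈ s' ↔ n + 1 ∈ s := by
    intro n
    rw [hs', Finset.mem_filter, Finset.mem_range]
    refine ⟨fun h => h.2, fun h => ⟨?_, h⟩⟩
    exact Nat.lt_of_succ_le (Finset.le_sup (f := id) h)
  have hpre : (fun q : ℝ × (ℕ → ℝ) => consNoise q.1 q.2) ⁻¹' (Set.pi s u) =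
      (if 0 ∈ s then u 0 else univ) ×ˢ (Set.pi s' fun n => u (n + 1)) := by
    ext ⟨a, t⟩
    simp only [mem_preimage, Set.mem_pi, mem_prod, SetLike.mem_coe, hmem]
    constructor
    · intro h
      refine ⟨?_, fun n hn => h (n + 1) hn⟩
      split_ifs with h0
      · exact h 0 h0
      · trivial
    · rintro ⟨h0, h⟩ n hn
      cases n with
      | zero => rw [if_pos hn] at h0; exact h0
      | succ n => exact h n hn
  rw [hpre, Measure.prod_prod, Measure.infinitePi_pi _ (fun i _ => hu (i + 1))]
  have himg : ∏ i ∈ s', θ (u (i + 1)) = ∏ i ∈ s.erase 0, θ (u i) := by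
    refine Finset.prod_bij (fun n _ => n + 1) ?_ ?_ ?_ ?_
    · intro n hn; exact Finset.mem_erase.2 ⟨Nat.succ_ne_zero n, (hmem n).1 hn⟩
    · intro a _ b _ h; exact Nat.succ_injective h
    · intro b hb
      obtain ⟨h0, hb⟩ := Finset.mem_erase.1 hb
      obtain ⟨n, rfl⟩ := Nat.exists_eq_succ_of_ne_zero h0
      exact ⟨n, (hmem n).2 hb, rfl⟩
    · intro n _; rfl
  rw [himg]
  split_ifs with h0
  · rw [Finset.mul_prod_erase s (fun i => θ (u i)) h0]
  · rw [measure_univ, one_mul, Finset.erase_eq_of_notMem h0]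

theorem lintegral_consNoise (θ : Measure ℝ) [IsProbabilityMeasure θ] {F : (ℕ → ℝ) → ℝ≥0∞}
    (hF : Measurable F) :
    ∫⁻ t, F t ∂(Measure.infinitePi fun _ : ℕ => θ) =
      ∫⁻ s, ∫⁻ t, F (consNoise s t) ∂(Measure.infinitePi fun _ : ℕ => θ) ∂θ := by
  rw [← (measurePreserving_consNoise θ).lintegral_comp hF, lintegral_prod]
  exact (hF.comp measurable_consNoise).aemeasurable

variable {φ : X → ℝ → X} {I : Set X}

theorem measurable_chain (hφ : Measurable fun q : X × ℝ => φ q.1 q.2) (n : ℕ) :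
    Measurable fun q : X × (ℕ → ℝ) => chain φ q.1 q.2 n := by
  induction n with
  | zero => exact measurable_fst
  | succ n ih => exact hφ.comp (ih.prodMk ((measurable_pi_apply n).comp measurable_snd))

theorem measurableSet_staySet (hφ : Measurable fun q : X × ℝ => φ q.1 q.2) (hI : MeasurableSet I)
    (k : ℕ) : MeasurableSet (staySet φ I k) := by
  have : staySet φ I k = ⋂ j ∈ Finset.range k, (fun q : X × (ℕ → ℝ) => chain φ q.1 q.2 j) ⁻¹' I := by
    ext q; simp [staySet, Stays]
  rw [this]
  exact Finset.measurableSet_biInter _ fun j _ => measurable_chain hφ j hI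

theorem measurable_sojourn (hφ : Measurable fun q : X × ℝ => φ q.1 q.2) (hI : MeasurableSet I) :
    Measurable (sojourn φ I) :=
  Measurable.tsum fun k => measurable_one.indicator (measurableSet_staySet hφ hI (k + 1))

theorem measurable_step (hφ : Measurable fun q : X × ℝ => φ q.1 q.2) :
    Measurable fun q : X × (ℕ → ℝ) => (φ q.1 (q.2 0), fun k => q.2 (k + 1)) := by
  refine Measurable.prodMk ?_ ?_
  · exact hφ.comp (measurable_fst.prodMk ((measurable_pi_apply 0).comp measurable_snd))
  · exact measurable_pi_lambda _ fun k => (measurable_pi_apply (k + 1)).comp measurable_snd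

theorem measurableSet_runaway (hφ : Measurable fun q : X × ℝ => φ q.1 q.2) (hI : MeasurableSet I)
    (K δ μ : ℝ≥0∞) (L : ℕ → ℕ) (n : ℕ) : ∀ (z : ℝ≥0∞) (i : ℕ),
    MeasurableSet {q : X × (ℕ → ℝ) | Runaway φ I K δ μ L n q.1 z i q.2} := by
  induction n with
  | zero => intro z i; simp [Runaway]
  | succ n ih =>
    intro z i
    have hI' : MeasurableSet {q : X × (ℕ → ℝ) | q.1 ∈ I} := measurable_fst hI
    have hS := measurable_step hφ (measurableSet_staySet hφ hI (L i))
    have h1 := measurable_step hφ (ih (z / μ) (i + 1))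
    have h2 := measurable_step hφ (ih (z + δ) i)
    exact (hI'.compl.inter ((MeasurableSet.const (K < z)).inter (hS.union h1))).union
      (hI'.inter h2)

theorem measure_consNoise (θ : Measure ℝ) [IsProbabilityMeasure θ] {S : Set (ℕ → ℝ)}
    (hS : MeasurableSet S) :
    (Measure.infinitePi fun _ : ℕ => θ) S =
      ∫⁻ s, (Measure.infinitePi fun _ : ℕ => θ) {t | consNoise s t ∈ S} ∂θ := by
  rw [← (measurePreserving_consNoise θ).measure_preimage hS.nullMeasurableSet,
    Measure.prod_apply (measurable_consNoise hS)]
  rfl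

/-- The values of `z` above the threshold `K`. -/
def truncAbove (K z : ℝ≥0∞) : ℝ≥0∞ := (Ioi K).indicator id z

theorem truncAbove_le (K z : ℝ≥0∞) : truncAbove K z ≤ z :=
  indicator_le_self' (fun _ _ => zero_le) z

theorem measurable_truncAbove (K : ℝ≥0∞) : Measurable (truncAbove K) :=
  measurable_id.indicator measurableSet_Ioi

/-- The expected weight above the threshold `K` at the exit from `I`. -/
def exitWeight (φ : X → ℝ → X) (I : Set X) (θ : Measure ℝ) (K δ : ℝ≥0∞) (x : X) (z : ℝ≥0∞) :
    ℝ≥0∞ :=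
  ∫⁻ t, truncAbove K (z + δ * sojourn φ I (x, t)) ∂(Measure.infinitePi fun _ : ℕ => θ)

variable (θ : Measure ℝ) [IsProbabilityMeasure θ]

theorem exitWeight_of_notMem {x : X} (hx : x ∉ I) (K δ z : ℝ≥0∞) :
    exitWeight φ I θ K δ x z = truncAbove K z := by
  simp [exitWeight, sojourn_of_notMem φ hx]

/-- The expected exit weight is harmonic inside `I`: one step there moves one unit of time from the
remaining sojourn into the weight. -/
theorem exitWeight_of_mem (hφ : Measurable fun q : X × ℝ => φ q.1 q.2) (hI : MeasurableSet I)
    {x : X} (hx : x ∈ I) (K δ z : ℝ≥0∞) :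
    exitWeight φ I θ K δ x z = ∫⁻ s, exitWeight φ I θ K δ (φ x s) (z + δ) ∂θ := by
  rw [exitWeight, lintegral_consNoise θ]
  · simp only [sojourn_cons φ hx, exitWeight, mul_add, mul_one, add_assoc]
  · exact (measurable_truncAbove K).comp (measurable_const.add (measurable_const.mul
      ((measurable_sojourn hφ hI).comp (measurable_const.prodMk measurable_id))))

theorem exitWeight_le (hφ : Measurable fun q : X × ℝ => φ q.1 q.2) (hI : MeasurableSet I)
    (x : X) (K δ z : ℝ≥0∞) :
    exitWeight φ I θ K δ x z ≤
      z + δ * ∫⁻ t, sojourn φ I (x, t) ∂(Measure.infinitePi fun _ : ℕ => θ) := by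
  have hm : Measurable fun t => sojourn φ I (x, t) :=
    (measurable_sojourn hφ hI).comp (measurable_const.prodMk measurable_id)
  calc exitWeight φ I θ K δ x z
      ≤ ∫⁻ t, (z + δ * sojourn φ I (x, t)) ∂(Measure.infinitePi fun _ : ℕ => θ) :=
        lintegral_mono fun t => truncAbove_le K _
    _ = _ := by
      rw [lintegral_add_left measurable_const, lintegral_const_mul _ hm]
      simp

/-- If a set of pairs has small sections over every later noise, then it has small probability. -/
theorem lintegral_measure_le_of_section {S : Set (ℝ × (ℕ → ℝ))} (hS : MeasurableSet S)
    {b : ℝ≥0∞} (hb : ∀ t, θ {s | (s, t) ∈ S} ≤ b) :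
    ∫⁻ s, (Measure.infinitePi fun _ : ℕ => θ) {t | (s, t) ∈ S} ∂θ ≤ b := by
  have h1 : ∫⁻ s, (Measure.infinitePi fun _ : ℕ => θ) {t | (s, t) ∈ S} ∂θ =
      (θ.prod (Measure.infinitePi fun _ : ℕ => θ)) S := by
    rw [Measure.prod_apply hS]; rfl
  rw [h1, Measure.prod_apply_symm hS]
  calc _ ≤ ∫⁻ _, b ∂(Measure.infinitePi fun _ : ℕ => θ) := lintegral_mono fun t => hb t
    _ = b := by simp

/-- The probability of running away is controlled by the expected weight at the exit from `I`. -/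
theorem measure_runaway_le (hφ : Measurable fun q : X × ℝ => φ q.1 q.2) (hI : MeasurableSet I)
    {K δ μ c ρ : ℝ≥0∞} {L : ℕ → ℕ} {b B : ℕ → ℝ≥0∞} (hK : 1 ≤ K)
    (hstay : ∀ i x t, θ {s | Stays φ I (L i) (φ x s) t} ≤ b i)
    (hc : ∀ x, δ * ∫⁻ s, ∫⁻ t, sojourn φ I (φ x s, t) ∂(Measure.infinitePi fun _ : ℕ => θ) ∂θ ≤ c)
    (hρ : ∀ z, K < z → z / μ + c ≤ ρ * z) (hB : ∀ i, b i + ρ * B (i + 1) ≤ B i) :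
    ∀ (n : ℕ) (x : X) (z : ℝ≥0∞) (i : ℕ),
      (Measure.infinitePi fun _ : ℕ => θ) {t | Runaway φ I K δ μ L n x z i t} ≤
        B i * exitWeight φ I θ K δ x z := by
  intro n
  induction n with
  | zero => intro x z i; simp [Runaway]
  | succ n ih =>
    intro x z i
    have hm : MeasurableSet {t | Runaway φ I K δ μ L (n + 1) x z i t} :=
      (measurable_const.prodMk measurable_id) (measurableSet_runaway hφ hI K δ μ L (n + 1) z i)
    rw [measure_consNoise θ hm]
    -- Inside `I` the induction hypothesis is averaged over the first noise, by harmonicity.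
    -- Outside, the exit weight is `z` itself, and only `z > K ≥ 1` matters: the long sojourn costs
    -- `b i ≤ b i * z`, the continuation costs at most `B (i + 1) * ρ * z`, and `hB` closes the
    -- recursion.
    by_cases hx : x ∈ I
    · have h1 : ∀ s t, consNoise s t ∈ {t | Runaway φ I K δ μ L (n + 1) x z i t} ↔
          Runaway φ I K δ μ L n (φ x s) (z + δ) i t := by
        intro s t
        simp only [Runaway, mem_ofPred_eq, hx, not_true_eq_false, false_and, true_and, false_or]
        rfl
      simp only [h1]
      rw [exitWeight_of_mem θ hφ hI hx]
      calc _ ≤ ∫⁻ s, B i * exitWeight φ I θ K δ (φ x s) (z + δ) ∂θ :=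
            lintegral_mono fun s => ih _ _ _
        _ = _ := by
          rw [lintegral_const_mul]
          have h2 : Measurable fun q : ℝ × (ℕ → ℝ) =>
              truncAbove K (z + δ + δ * sojourn φ I (φ x q.1, q.2)) :=
            (measurable_truncAbove K).comp (measurable_const.add (measurable_const.mul
              ((measurable_sojourn hφ hI).comp ((hφ.comp (measurable_const.prodMk
                measurable_fst)).prodMk measurable_snd))))
          exact h2.lintegral_prod_right'
    · by_cases hz : K < z
      swap
      · have h1 : ∀ s t, consNoise s t ∉ {t | Runaway φ I K δ μ L (n + 1) x z i t} := by
          intro s t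
          simp [Runaway, hx, hz]
        simp [h1]
      have h1 : ∀ s, {t | consNoise s t ∈ {t | Runaway φ I K δ μ L (n + 1) x z i t}} ⊆
          {t | Stays φ I (L i) (φ x s) t} ∪ {t | Runaway φ I K δ μ L n (φ x s) (z / μ) (i + 1) t} := by
        intro s t ht
        simp only [Runaway, mem_ofPred_eq, hx, not_false_eq_true, hz, false_and, true_and,
          or_false] at ht
        exact ht
      have hS : MeasurableSet {q : ℝ × (ℕ → ℝ) | Stays φ I (L i) (φ x q.1) q.2} :=
        ((hφ.comp (measurable_const.prodMk measurable_fst)).prodMk measurable_snd)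
          (measurableSet_staySet hφ hI (L i))
      have hSm : Measurable fun s =>
          (Measure.infinitePi fun _ : ℕ => θ) {t | Stays φ I (L i) (φ x s) t} :=
        measurable_measure_prodMk_left hS
      rw [exitWeight_of_notMem θ hx, truncAbove, indicator_of_mem (show z ∈ Ioi K from hz)]
      have hs1 := lintegral_measure_le_of_section θ hS (hstay i x)
      have hs2 : ∫⁻ s, B (i + 1) * exitWeight φ I θ K δ (φ x s) (z / μ) ∂θ ≤
          B (i + 1) * (ρ * z) := by
        calc _ ≤ ∫⁻ s, B (i + 1) * (z / μ + δ * ∫⁻ t, sojourn φ I (φ x s, t)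
                ∂(Measure.infinitePi fun _ : ℕ => θ)) ∂θ := by
              gcongr with s
              exact exitWeight_le θ hφ hI _ _ _ _
          _ = B (i + 1) * (z / μ + δ * ∫⁻ s, ∫⁻ t, sojourn φ I (φ x s, t)
                ∂(Measure.infinitePi fun _ : ℕ => θ) ∂θ) := by
              have h2 : Measurable fun q : ℝ × (ℕ → ℝ) => sojourn φ I (φ x q.1, q.2) :=
                (measurable_sojourn hφ hI).comp ((hφ.comp (measurable_const.prodMk
                  measurable_fst)).prodMk measurable_snd)
              have h3 : Measurable fun s => ∫⁻ t, sojourn φ I (φ x s, t)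
                  ∂(Measure.infinitePi fun _ : ℕ => θ) := h2.lintegral_prod_right'
              have h4 : Measurable fun s => z / μ + δ * ∫⁻ t, sojourn φ I (φ x s, t)
                  ∂(Measure.infinitePi fun _ : ℕ => θ) := measurable_const.add (h3.const_mul δ)
              rw [lintegral_const_mul _ h4,
                lintegral_add_left measurable_const, lintegral_const_mul _ h3]
              simp
          _ ≤ _ := by
              gcongr
              exact (add_le_add_right (hc x) _).trans (hρ z hz)
      calc _ ≤ ∫⁻ s, ((Measure.infinitePi fun _ : ℕ => θ) {t | Stays φ I (L i) (φ x s) t} +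
              B (i + 1) * exitWeight φ I θ K δ (φ x s) (z / μ)) ∂θ := by
            refine lintegral_mono fun s => (measure_mono (h1 s)).trans ?_
            exact (measure_union_le _ _).trans (add_le_add_right (ih _ _ _) _)
        _ ≤ b i + B (i + 1) * (ρ * z) := by
            rw [lintegral_add_left hSm]
            exact add_le_add hs1 hs2
        _ ≤ b i * z + ρ * B (i + 1) * z := by
            refine add_le_add (le_mul_of_one_le_right (zero_le) (hK.trans hz.le)) (le_of_eq ?_)
            ring
        _ ≤ B i * z := by
            rw [← add_mul]
            gcongr
            exact hB i

end Prob

end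

/-! ### The tail estimate -/

section

theorem ofReal_mul_tsum_max_le {p : ℝ} (hp : 1 < p) {κ : ℕ} (hκ : 1 ≤ κ) {a : ℝ} (ha : 0 ≤ a)
    {f : ℕ → ℝ≥0∞}
    (hf : ∀ k, f k ≤ ENNReal.ofReal (a * ((max (k + 1) κ : ℕ) : ℝ) ^ (-p))) :
    ∑' k, f k ≤ ENNReal.ofReal (a * ((1 + 1 / (p - 1)) * (κ : ℝ) ^ (1 - p))) := by
  rw [ENNReal.ofReal_mul ha]
  refine (ENNReal.tsum_le_tsum hf).trans ?_
  simp only [ENNReal.ofReal_mul ha]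
  rw [ENNReal.tsum_mul_left]
  gcongr
  exact tsum_max_rpow_le hp hκ

/-- Above `c / (ρ - 1/μ)` the gap between the rates `1/μ` and `ρ` absorbs the bounded mean gain `c`.
This fixes the threshold `K`. -/
theorem div_add_le_mul_of_lt {μ ρ c K : ℝ} (hμ : 0 < μ) (hρ : 1 / μ < ρ) (hc : 0 ≤ c)
    (hK : c / (ρ - 1 / μ) ≤ K) {z : ℝ≥0∞} (hz : ENNReal.ofReal K < z) :
    z / ENNReal.ofReal μ + ENNReal.ofReal c ≤ ENNReal.ofReal ρ * z := by
  have hρ0 : 0 < ρ := (by positivity : (0 : ℝ) < 1 / μ).trans hρ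
  rcases eq_or_ne z ⊤ with rfl | hz'
  · rw [ENNReal.mul_top (by simpa using hρ0)]
    exact le_top
  · lift z to NNReal using hz'
    have h1 : K < z := by
      by_contra h
      refine hz.not_ge ?_
      rw [← ENNReal.ofReal_coe_nnreal]
      exact ENNReal.ofReal_le_ofReal (not_lt.1 h)
    have h2 : c ≤ (ρ - 1 / μ) * z := by
      rw [div_le_iff₀ (by linarith)] at hK
      nlinarith
    rw [← ENNReal.ofReal_coe_nnreal, ← ENNReal.ofReal_div_of_pos hμ,
      ← ENNReal.ofReal_add (by positivity) hc, ← ENNReal.ofReal_mul hρ0.le]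
    refine ENNReal.ofReal_le_ofReal ?_
    have : (z : ℝ) / μ = 1 / μ * z := by ring
    rw [this]
    linarith

section

variable {X : Type*} [MeasurableSpace X]

/-- The bound for the expected sojourn time after a fresh noise. -/
theorem lintegral_sojourn_le {φ : X → ℝ → X} {I : Set X}
    (hφ : Measurable fun q : X × ℝ => φ q.1 q.2) (hI : MeasurableSet I) (θ : Measure ℝ)
    [IsProbabilityMeasure θ] {p a : ℝ} (hp : 1 < p) (ha : 0 ≤ a) {κ : ℕ} (hκ : 1 ≤ κ)
    (hstay : ∀ x t k, θ {s | Stays φ I (k + 1) (φ x s) t} ≤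
      ENNReal.ofReal (a * ((max (k + 1) κ : ℕ) : ℝ) ^ (-p))) (x : X) :
    ∫⁻ s, ∫⁻ t, sojourn φ I (φ x s, t) ∂(Measure.infinitePi fun _ : ℕ => θ) ∂θ ≤
      ENNReal.ofReal (a * ((1 + 1 / (p - 1)) * (κ : ℝ) ^ (1 - p))) := by
  have hS : ∀ k, MeasurableSet {q : ℝ × (ℕ → ℝ) | Stays φ I (k + 1) (φ x q.1) q.2} := fun k =>
    ((hφ.comp (measurable_const.prodMk measurable_fst)).prodMk measurable_snd)
      (measurableSet_staySet hφ hI (k + 1))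
  have h1 : ∀ s, ∫⁻ t, sojourn φ I (φ x s, t) ∂(Measure.infinitePi fun _ : ℕ => θ) =
      ∑' k, (Measure.infinitePi fun _ : ℕ => θ) {t | Stays φ I (k + 1) (φ x s) t} := by
    intro s
    have hm : ∀ k, MeasurableSet {t | Stays φ I (k + 1) (φ x s) t} := fun k =>
      (measurable_const.prodMk measurable_id) (hS k)
    simp only [sojourn]
    rw [lintegral_tsum]
    · congr 1
      funext k
      rw [← lintegral_indicator_one (hm k)]
      rfl
    · intro k
      exact ((measurable_one.indicator (hm k) : Measurable _)).aemeasurable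
  simp only [h1]
  have hSm : ∀ k, Measurable fun s =>
      (Measure.infinitePi fun _ : ℕ => θ) {t | Stays φ I (k + 1) (φ x s) t} := fun k =>
    measurable_measure_prodMk_left (hS k)
  rw [lintegral_tsum fun k => (hSm k).aemeasurable]
  exact ofReal_mul_tsum_max_le hp hκ ha fun k =>
    lintegral_measure_le_of_section θ (hS k) fun t => hstay x t k

/-- The bound for the expected weight at the exit from `I`, for a random initial point. -/
theorem lintegral_exitWeight_le {φ : X → ℝ → X} {I : Set X}
    (hφ : Measurable fun q : X × ℝ => φ q.1 q.2) (hI : MeasurableSet I) (θ : Measure ℝ)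
    [IsProbabilityMeasure θ] (ν : Measure X) [IsProbabilityMeasure ν] {p a : ℝ} (hp : 1 < p)
    (ha : 0 ≤ a) {κ : ℕ} {K δ : ℝ≥0∞} (hK : 1 ≤ K) (hδ : δ * κ ≤ 1)
    (hstay : ∀ t k, 1 ≤ k → ν {x | Stays φ I k x t} ≤ ENNReal.ofReal (a * (k : ℝ) ^ (-p))) :
    ∫⁻ x, exitWeight φ I θ K δ x 0 ∂ν ≤
      δ * ENNReal.ofReal (a * ((1 + 1 / (p - 1)) * ((κ + 1 : ℕ) : ℝ) ^ (1 - p))) := by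
  -- As `δ κ ≤ 1 ≤ K`, a weight above `K` requires a sojourn longer than `κ`, so the indicators of
  -- shorter stays may be replaced by that of a stay of length `κ + 1`. This saving makes the
  -- initial weight small.
  have hle : ∀ q, truncAbove K (0 + δ * sojourn φ I q) ≤
      δ * ∑' k, (staySet φ I (max (k + 1) (κ + 1))).indicator 1 q := by
    intro q
    rw [zero_add]
    by_cases h : K < δ * sojourn φ I q
    · refine (truncAbove_le _ _).trans ?_
      gcongr
      have h1 : (κ : ℝ≥0∞) < sojourn φ I q := by
        by_contra h2
        refine absurd (hK.trans_lt h) (not_lt.2 ?_)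
        exact le_trans (by gcongr; exact not_lt.1 h2) hδ
      have h3 := stays_of_lt_sojourn h1
      refine ENNReal.tsum_le_tsum fun k => ?_
      by_cases hk : q ∈ staySet φ I (k + 1)
      · rw [indicator_of_mem hk, indicator_of_mem]
        rcases max_cases (k + 1) (κ + 1) with h | h <;> rw [h.1] <;> assumption
      · rw [indicator_of_notMem hk]
        exact zero_le
    · rw [truncAbove, indicator_of_notMem (by simpa using h)]
      exact zero_le
  have hm : ∀ k, Measurable ((staySet φ I k).indicator (1 : X × (ℕ → ℝ) → ℝ≥0∞)) := fun k =>
    measurable_one.indicator (measurableSet_staySet hφ hI k)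
  calc ∫⁻ x, exitWeight φ I θ K δ x 0 ∂ν
      ≤ ∫⁻ x, ∫⁻ t, δ * ∑' k, (staySet φ I (max (k + 1) (κ + 1))).indicator 1 (x, t)
          ∂(Measure.infinitePi fun _ : ℕ => θ) ∂ν :=
        lintegral_mono fun x => lintegral_mono fun t => hle (x, t)
    _ = ∫⁻ t, ∫⁻ x, δ * ∑' k, (staySet φ I (max (k + 1) (κ + 1))).indicator 1 (x, t)
          ∂ν ∂(Measure.infinitePi fun _ : ℕ => θ) := by
        rw [lintegral_lintegral_swap]
        exact ((Measurable.tsum fun k => hm _).const_mul δ).aemeasurable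
    _ ≤ ∫⁻ t, δ * ENNReal.ofReal (a * ((1 + 1 / (p - 1)) * ((κ + 1 : ℕ) : ℝ) ^ (1 - p)))
          ∂(Measure.infinitePi fun _ : ℕ => θ) := by
        refine lintegral_mono fun t => ?_
        have hm' : ∀ k, Measurable fun x =>
            (staySet φ I k).indicator (1 : X × (ℕ → ℝ) → ℝ≥0∞) (x, t) := fun k =>
          (hm k).comp (measurable_id.prodMk measurable_const)
        rw [lintegral_const_mul _ (Measurable.tsum fun k => hm' _),
          lintegral_tsum fun k => (hm' _).aemeasurable]
        gcongr
        refine ofReal_mul_tsum_max_le hp (Nat.le_add_left 1 κ) ha fun k => ?_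
        have h1 : ∫⁻ x, (staySet φ I (max (k + 1) (κ + 1))).indicator
            (1 : X × (ℕ → ℝ) → ℝ≥0∞) (x, t) ∂ν =
            ν {x | Stays φ I (max (k + 1) (κ + 1)) x t} := by
          rw [← lintegral_indicator_one]
          · rfl
          · exact (measurable_id.prodMk measurable_const) (measurableSet_staySet hφ hI _)
        rw [h1]
        exact hstay t _ (le_max_of_le_left (Nat.le_add_left 1 k))
    _ = _ := by simp

end

/-- **Tail estimate.** Suppose that a random orbit stays in `I` for a time `k` with probability at
most `A k^{-1/α}`, and with probability at most `A k^{-1/α} / ε` after a fresh noise. Then the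
weight of the orbit drops below `K` outside `I` before the time `m` except with probability
`O(m^{-1/α})`, uniformly in `ε`. -/
theorem measure_weight_lt_le {α μ A : ℝ} (hα₀ : 0 < α) (hα₁ : α < 1) (hμ : 1 < μ) (hA : 0 < A) :
    ∃ K : ℝ, 1 ≤ K ∧ ∃ C : ℝ, 0 < C ∧ ∀ (ε : ℝ), 0 < ε → ε ≤ 1 →
      ∀ {X : Type} [MeasurableSpace X] (φ : X → ℝ → X) (I : Set X) (θ : Measure ℝ)
        [IsProbabilityMeasure θ] (ν : Measure X) [IsProbabilityMeasure ν],
        (Measurable fun q : X × ℝ => φ q.1 q.2) → MeasurableSet I →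
        (∀ y t k, 1 ≤ k → θ {s | Stays φ I k (φ y s) t} ≤
          ENNReal.ofReal (A * (k : ℝ) ^ (-(1 / α)) / ε)) →
        (∀ t k, 1 ≤ k → ν {x | Stays φ I k x t} ≤ ENNReal.ofReal (A * (k : ℝ) ^ (-(1 / α)))) →
        ∀ m : ℕ, 1 ≤ m →
          (ν.prod (Measure.infinitePi fun _ : ℕ => θ)) {q | q.1 ∈ I ∧ ∀ n, 1 ≤ n → n < m →
            chain φ q.1 q.2 n ∉ I → ENNReal.ofReal K <
              weight φ I (ENNReal.ofReal (ε ^ α)) (ENNReal.ofReal μ) q.1 0 q.2 n} ≤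
          ENNReal.ofReal (C * (m : ℝ) ^ (-(1 / α))) := by
  set p : ℝ := 1 / α with hpdef
  have hp : 1 < p := by rw [hpdef, lt_div_iff₀ hα₀]; linarith
  have hαp : α * p = 1 := by rw [hpdef]; field_simp
  set C₁ : ℝ := 1 + 1 / (p - 1) with hC₁
  have hC₁0 : 0 < C₁ := by
    have : 0 < p - 1 := by linarith
    positivity
  -- The value `2 ^ p` makes the bound for fresh stays at least `1` up to time `κ`, where only the
  -- trivial estimate is available.
  set A' : ℝ := max A (2 ^ p) with hA'
  have hA'0 : 0 < A' := lt_max_of_lt_left hA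
  set c : ℝ := A' * C₁ with hc
  set ρ : ℝ := (1 + 1 / μ) / 2 with hρ
  have hμ0 : 0 < μ := by linarith
  have hμ1 : 1 / μ < 1 := by rw [div_lt_one hμ0]; exact hμ
  have hρ0 : 0 < ρ := by positivity
  have hρ1 : ρ < 1 := by rw [hρ]; linarith
  have hμρ : 1 / μ < ρ := by rw [hρ]; linarith
  -- One of the two factors of `ρ = w * w` pays for the shrinking sojourn lengths `q^i`, since
  -- `(q^i)^{-p} = w^{-i}`; the other one leaves a convergent geometric series.
  set w : ℝ := Real.sqrt ρ with hw
  have hw0 : 0 < w := Real.sqrt_pos.2 hρ0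
  have hww : w * w = ρ := Real.mul_self_sqrt hρ0.le
  have hw1 : w < 1 := by nlinarith
  set q : ℝ := w ^ α with hq
  have hq0 : 0 < q := Real.rpow_pos_of_pos hw0 _
  have hq1 : q < 1 := Real.rpow_lt_one hw0.le hw1 hα₀
  have hqp : ∀ i : ℕ, (q ^ i) ^ (-p) = (w ^ i)⁻¹ := by
    intro i
    rw [Real.rpow_neg (by positivity), hq, ← Real.rpow_natCast, ← Real.rpow_mul hw0.le,
      ← Real.rpow_mul hw0.le]
    rw [show α * (i : ℝ) * p = i by rw [mul_right_comm, hαp, one_mul], Real.rpow_natCast]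
  set K : ℝ := max 1 (c / (ρ - 1 / μ)) with hK
  have hKpos : 0 < K := lt_max_of_lt_left one_pos
  -- `max A 1` covers the trivial bound used when the rounded length is `0`, `2 ^ p` covers the
  -- rounding down otherwise, and `(1 - q) / 2` is the share of `m` given to the sojourn of index
  -- `0`.
  set D : ℝ := max A 1 * 2 ^ p * ((1 - q) / 2) ^ (-p) with hD
  have hD0 : 0 < D := by
    have : 0 < (1 - q) / 2 := by linarith
    positivity
  have h1w : 0 < 1 - w := by linarith
  refine ⟨K, le_max_left _ _, A * 2 ^ p + D / (1 - w) * (A * C₁), by positivity, ?_⟩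
  intro ε hε hε1 X _ φ I θ _ ν _ hφ hI H1 H2 m hm
  have hm0 : (0 : ℝ) < m := by exact_mod_cast hm
  -- `ε^{-α}` is the time `k` at which `k^{-p} / ε` reaches `1`, and also the sojourn that produces
  -- weight `1`.
  set κ : ℕ := ⌊ε ^ (-α)⌋₊ with hκ
  have hεα : 0 < ε ^ α := Real.rpow_pos_of_pos hε _
  have hε1' : 1 ≤ ε ^ (-α) := Real.one_le_rpow_of_pos_of_le_one_of_nonpos hε hε1 (by linarith)
  have hκle : (κ : ℝ) ≤ ε ^ (-α) := Nat.floor_le (by positivity)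
  have hκlt : ε ^ (-α) < ((κ + 1 : ℕ) : ℝ) := by push_cast; exact Nat.lt_floor_add_one _
  have hκ2 : ((κ + 1 : ℕ) : ℝ) ≤ 2 * ε ^ (-α) := by push_cast; linarith
  have hpow : ((κ + 1 : ℕ) : ℝ) ^ (1 - p) ≤ ε ^ (1 - α) := by
    calc ((κ + 1 : ℕ) : ℝ) ^ (1 - p) ≤ (ε ^ (-α)) ^ (1 - p) :=
          Real.rpow_le_rpow_of_nonpos (by positivity) hκlt.le (by linarith)
      _ = ε ^ (1 - α) := by
          rw [← Real.rpow_mul hε.le]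
          congr 1
          linarith
  have hεε : ε ^ α * ε ^ (1 - α) = ε := by
    rw [← Real.rpow_add hε, add_sub_cancel, Real.rpow_one]
  have hδκ : ENNReal.ofReal (ε ^ α) * (κ : ℝ≥0∞) ≤ 1 := by
    rw [← ENNReal.ofReal_natCast, ← ENNReal.ofReal_mul hεα.le, ← ENNReal.ofReal_one]
    refine ENNReal.ofReal_le_ofReal ?_
    calc ε ^ α * κ ≤ ε ^ α * ε ^ (-α) := by gcongr
      _ = 1 := by rw [← Real.rpow_add hε]; simp
  have hfresh : ∀ x t k, θ {s | Stays φ I (k + 1) (φ x s) t} ≤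
      ENNReal.ofReal (A' / ε * ((max (k + 1) (κ + 1) : ℕ) : ℝ) ^ (-p)) := by
    intro x t k
    rcases Nat.lt_or_ge k κ with h | h
    · rw [max_eq_right (by omega)]
      refine prob_le_one.trans ?_
      rw [← ENNReal.ofReal_one]
      refine ENNReal.ofReal_le_ofReal ?_
      have h1 : (2 : ℝ) ^ (-p) * ε ≤ ((κ + 1 : ℕ) : ℝ) ^ (-p) := by
        calc (2 : ℝ) ^ (-p) * ε = (2 * ε ^ (-α)) ^ (-p) := by
              rw [Real.mul_rpow (by norm_num) (by positivity), ← Real.rpow_mul hε.le, neg_mul_neg,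
                hαp, Real.rpow_one]
          _ ≤ _ := Real.rpow_le_rpow_of_nonpos (by positivity) hκ2 (by linarith)
      calc (1 : ℝ) = 2 ^ p / ε * ((2 : ℝ) ^ (-p) * ε) := by
            rw [Real.rpow_neg (by norm_num)]; field_simp
        _ ≤ A' / ε * ((κ + 1 : ℕ) : ℝ) ^ (-p) := by
            gcongr
            exact le_max_right _ _
    · rw [max_eq_left (by omega)]
      refine (H1 x t (k + 1) (by omega)).trans (ENNReal.ofReal_le_ofReal ?_)
      rw [div_mul_eq_mul_div]
      gcongr
      exact le_max_left _ _
  -- The powers `ε^α`, `ε^{-1}` and `κ^{1-p} ≈ ε^{1-α}` cancel: the mean gain of a fresh sojourn is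
  -- bounded independently of `ε`.
  have hcc : ∀ x, ENNReal.ofReal (ε ^ α) * ∫⁻ s, ∫⁻ t, sojourn φ I (φ x s, t)
      ∂(Measure.infinitePi fun _ : ℕ => θ) ∂θ ≤ ENNReal.ofReal c := by
    intro x
    calc _ ≤ ENNReal.ofReal (ε ^ α) * ENNReal.ofReal (A' / ε * (C₁ * ((κ + 1 : ℕ) : ℝ) ^ (1 - p))) := by
          gcongr
          exact lintegral_sojourn_le hφ hI θ hp (by positivity) (by omega) hfresh x
      _ ≤ ENNReal.ofReal c := by
          rw [← ENNReal.ofReal_mul hεα.le]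
          refine ENNReal.ofReal_le_ofReal ?_
          calc ε ^ α * (A' / ε * (C₁ * ((κ + 1 : ℕ) : ℝ) ^ (1 - p)))
              ≤ ε ^ α * (A' / ε * (C₁ * ε ^ (1 - α))) := by gcongr
            _ = A' / ε * C₁ * (ε ^ α * ε ^ (1 - α)) := by ring
            _ = c := by rw [hεε, hc]; field_simp
  -- Half of the horizon is left to the initial sojourn. The other half is divided among the later
  -- ones in the shares `(1 - q) q^i`, which add up to `1`.
  set H : ℝ := m / 2 with hH
  have hH0 : 0 < H := by positivity
  set L : ℕ → ℕ := fun i => ⌊(1 - q) * q ^ i * H⌋₊ with hL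
  set b₀ : ℝ := D * (m : ℝ) ^ (-p) / ε with hb₀
  have hb₀0 : 0 < b₀ := by positivity
  have h1q : 0 < 1 - q := by linarith
  have hDi : ∀ i : ℕ, max A 1 * 2 ^ p * ((1 - q) * q ^ i * H) ^ (-p) / ε = b₀ * (w ^ i)⁻¹ := by
    intro i
    rw [show (1 - q) * q ^ i * H = ((1 - q) / 2) * m * q ^ i by rw [hH]; ring,
      Real.mul_rpow (by positivity) (by positivity), Real.mul_rpow (by positivity) (by positivity),
      hqp, hb₀, hD]
    ring
  have hb : ∀ i x t, θ {s | Stays φ I (L i) (φ x s) t} ≤ ENNReal.ofReal (b₀ * (w ^ i)⁻¹) := by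
    intro i x t
    set y : ℝ := (1 - q) * q ^ i * H with hy
    have hy0 : 0 < y := by positivity
    rw [← hDi]
    have hA1 : 1 ≤ max A 1 := le_max_right _ _
    have h2p : 1 ≤ (2 : ℝ) ^ p := Real.one_le_rpow (by norm_num) (by linarith)
    have hmax : 1 ≤ max A 1 * 2 ^ p := one_le_mul_of_one_le_of_one_le hA1 h2p
    rcases Nat.eq_zero_or_pos (L i) with h | h
    · refine prob_le_one.trans ?_
      rw [← ENNReal.ofReal_one]
      refine ENNReal.ofReal_le_ofReal ?_
      have hy1 : y < 1 := Nat.floor_eq_zero.1 h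
      have hy2 : 1 ≤ y ^ (-p) :=
        Real.one_le_rpow_of_pos_of_le_one_of_nonpos hy0 hy1.le (by linarith)
      rw [le_div_iff₀ hε, one_mul]
      exact hε1.trans (one_le_mul_of_one_le_of_one_le hmax hy2)
    · refine (H1 x t _ h).trans (ENNReal.ofReal_le_ofReal ?_)
      have hy1 : 1 ≤ (L i : ℝ) := by exact_mod_cast h
      have hy2 : y < L i + 1 := Nat.lt_floor_add_one _
      refine div_le_div_of_nonneg_right ?_ hε.le
      calc A * (L i : ℝ) ^ (-p) ≤ max A 1 * (y / 2) ^ (-p) := by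
            refine mul_le_mul (le_max_left _ _) ?_ (by positivity) (by positivity)
            exact Real.rpow_le_rpow_of_nonpos (by positivity) (by linarith) (by linarith)
        _ = max A 1 * 2 ^ p * y ^ (-p) := by
            rw [div_eq_mul_inv, Real.mul_rpow hy0.le (by norm_num),
              Real.inv_rpow (by norm_num), Real.rpow_neg (by norm_num : (0:ℝ) ≤ 2), inv_inv]
            ring
  -- Because `ρ = w * w`, the sequence `b₀ w^{-i} / (1 - w)` solves the recursion for `B` with
  -- equality.
  have hB : ∀ i : ℕ, ENNReal.ofReal (b₀ * (w ^ i)⁻¹) + ENNReal.ofReal ρ *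
      ENNReal.ofReal (b₀ / (1 - w) * (w ^ (i + 1))⁻¹) ≤
      ENNReal.ofReal (b₀ / (1 - w) * (w ^ i)⁻¹) := by
    intro i
    rw [← ENNReal.ofReal_mul hρ0.le, ← ENNReal.ofReal_add (by positivity) (by positivity)]
    refine ENNReal.ofReal_le_ofReal (le_of_eq ?_)
    rw [← hww, pow_succ]
    field_simp
    ring
  have hrun := measure_runaway_le θ hφ hI (K := ENNReal.ofReal K) (δ := ENNReal.ofReal (ε ^ α))
    (μ := ENNReal.ofReal μ) (c := ENNReal.ofReal c) (ρ := ENNReal.ofReal ρ) (L := L)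
    (by rw [← ENNReal.ofReal_one]; exact ENNReal.ofReal_le_ofReal (le_max_left _ _)) hb hcc
    (fun z hz => div_add_le_mul_of_lt hμ0 hμρ (by positivity) (le_max_right _ _) hz) hB
  have hsub : {q : X × (ℕ → ℝ) | q.1 ∈ I ∧ ∀ n, 1 ≤ n → n < m → chain φ q.1 q.2 n ∉ I →
      ENNReal.ofReal K < weight φ I (ENNReal.ofReal (ε ^ α)) (ENNReal.ofReal μ) q.1 0 q.2 n} ⊆
      staySet φ I (m / 2 + 1) ∪ {q | Runaway φ I (ENNReal.ofReal K) (ENNReal.ofReal (ε ^ α))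
        (ENNReal.ofReal μ) L m q.1 0 0 q.2} := by
    rintro ⟨x, t⟩ ⟨hx, h⟩
    by_cases hs : (x, t) ∈ staySet φ I (m / 2 + 1)
    · exact Or.inl hs
    · right
      refine runaway_of_lt_weight (A := fun i => q ^ i * H) (fun i => by positivity) (fun i => ?_)
        m x 0 0 t (m / 2) hs ?_ ?_
      · have : (L i : ℝ) ≤ (1 - q) * q ^ i * H := Nat.floor_le (by positivity)
        rw [pow_succ]
        linarith
      · have : ((m / 2 : ℕ) : ℝ) ≤ (m : ℝ) / 2 := Nat.cast_div_le
        simp only [pow_zero, one_mul, hH]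
        linarith
      · intro k hk hkI
        rcases Nat.eq_zero_or_pos k with rfl | hk0
        · exact absurd hx hkI
        · exact h k hk0 hk hkI
  have hstay : (ν.prod (Measure.infinitePi fun _ : ℕ => θ)) (staySet φ I (m / 2 + 1)) ≤
      ENNReal.ofReal (A * 2 ^ p * (m : ℝ) ^ (-p)) := by
    rw [Measure.prod_apply_symm (measurableSet_staySet hφ hI _)]
    calc _ ≤ ∫⁻ t, ENNReal.ofReal (A * ((m / 2 + 1 : ℕ) : ℝ) ^ (-p))
            ∂(Measure.infinitePi fun _ : ℕ => θ) :=
          lintegral_mono fun t => H2 t (m / 2 + 1) (by omega)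
      _ = ENNReal.ofReal (A * ((m / 2 + 1 : ℕ) : ℝ) ^ (-p)) := by simp
      _ ≤ _ := by
          refine ENNReal.ofReal_le_ofReal ?_
          have h2 : (m : ℝ) / 2 ≤ ((m / 2 + 1 : ℕ) : ℝ) := by
            rw [div_le_iff₀ (by norm_num)]
            exact_mod_cast (by omega : m ≤ (m / 2 + 1) * 2)
          calc A * ((m / 2 + 1 : ℕ) : ℝ) ^ (-p) ≤ A * ((m : ℝ) / 2) ^ (-p) := by
                refine mul_le_mul_of_nonneg_left ?_ hA.le
                exact Real.rpow_le_rpow_of_nonpos (by positivity) h2 (by linarith)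
            _ = _ := by
              rw [div_eq_mul_inv, Real.mul_rpow hm0.le (by norm_num),
                Real.inv_rpow (by norm_num), Real.rpow_neg (by norm_num : (0:ℝ) ≤ 2), inv_inv]
              ring
  -- The mean initial weight above `K` is at most a multiple of `ε^α * ε^{1-α} = ε`, which cancels
  -- the `1/ε` in `b₀`.
  have hrun' : (ν.prod (Measure.infinitePi fun _ : ℕ => θ))
      {q | Runaway φ I (ENNReal.ofReal K) (ENNReal.ofReal (ε ^ α))
        (ENNReal.ofReal μ) L m q.1 0 0 q.2} ≤
      ENNReal.ofReal (D / (1 - w) * (A * C₁) * (m : ℝ) ^ (-p)) := by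
    rw [Measure.prod_apply (measurableSet_runaway hφ hI _ _ _ _ _ _ _)]
    calc _ ≤ ∫⁻ x, ENNReal.ofReal (b₀ / (1 - w) * (w ^ 0)⁻¹) *
            exitWeight φ I θ (ENNReal.ofReal K) (ENNReal.ofReal (ε ^ α)) x 0 ∂ν :=
          lintegral_mono fun x => hrun m x 0 0
      _ = ENNReal.ofReal (b₀ / (1 - w) * (w ^ 0)⁻¹) *
            ∫⁻ x, exitWeight φ I θ (ENNReal.ofReal K) (ENNReal.ofReal (ε ^ α)) x 0 ∂ν := by
          refine lintegral_const_mul' _ _ ENNReal.ofReal_ne_top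
      _ ≤ ENNReal.ofReal (b₀ / (1 - w) * (w ^ 0)⁻¹) * (ENNReal.ofReal (ε ^ α) *
            ENNReal.ofReal (A * (C₁ * ((κ + 1 : ℕ) : ℝ) ^ (1 - p)))) := by
          gcongr
          refine lintegral_exitWeight_le hφ hI θ ν hp hA.le ?_ hδκ H2
          rw [← ENNReal.ofReal_one]; exact ENNReal.ofReal_le_ofReal (le_max_left _ _)
      _ ≤ _ := by
          rw [← ENNReal.ofReal_mul hεα.le, ← ENNReal.ofReal_mul (by positivity)]
          refine ENNReal.ofReal_le_ofReal ?_
          calc b₀ / (1 - w) * (w ^ 0)⁻¹ * (ε ^ α * (A * (C₁ * ((κ + 1 : ℕ) : ℝ) ^ (1 - p))))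
              ≤ b₀ / (1 - w) * (w ^ 0)⁻¹ * (ε ^ α * (A * (C₁ * ε ^ (1 - α)))) := by gcongr
            _ = b₀ / (1 - w) * (A * C₁) * (ε ^ α * ε ^ (1 - α)) := by simp; ring
            _ = _ := by rw [hεε, hb₀]; field_simp
  calc _ ≤ _ := measure_mono hsub
    _ ≤ _ := measure_union_le _ _
    _ ≤ ENNReal.ofReal (A * 2 ^ p * (m : ℝ) ^ (-p)) +
        ENNReal.ofReal (D / (1 - w) * (A * C₁) * (m : ℝ) ^ (-p)) := add_le_add hstay hrun'
    _ = _ := by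
      rw [← ENNReal.ofReal_add (by positivity) (by positivity)]
      congr 1
      ring

end

/-! ### Lifts to the line and one-sided derivatives -/

section

theorem coe_eq_coe_iff {x y : ℝ} : (x : Circ) = (y : Circ) ↔ ∃ n : ℤ, y = x + n := by
  rw [eq_comm, ← sub_eq_zero, ← AddCircle.coe_sub, AddCircle.coe_eq_zero_iff]
  simp only [zsmul_eq_mul, mul_one]
  constructor
  · rintro ⟨n, hn⟩; exact ⟨n, by linarith⟩
  · rintro ⟨n, hn⟩; exact ⟨n, by linarith⟩

theorem coe_add_intCast (x : ℝ) (n : ℤ) : ((x + n : ℝ) : Circ) = (x : Circ) :=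
  (coe_eq_coe_iff.2 ⟨n, rfl⟩).symm

theorem coe_sub_one (x : ℝ) : ((x - 1 : ℝ) : Circ) = (x : Circ) := by
  have := coe_add_intCast x (-1)
  push_cast at this
  rwa [← sub_eq_add_neg] at this

theorem eq_of_coe_eq_of_abs_lt {x y : ℝ} (h : (x : Circ) = (y : Circ)) (hxy : |x - y| < 1) :
    x = y := by
  obtain ⟨n, rfl⟩ := coe_eq_coe_iff.1 h
  have h1 : |(n : ℝ)| < 1 := by simpa using hxy
  have h2 : n = 0 := by
    rw [← Int.abs_lt_one_iff]
    exact_mod_cast h1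
  simp [h2]

theorem norm_coe_of_abs_le {x : ℝ} (hx : |x| ≤ 1 / 2) : ‖(x : Circ)‖ = |x| :=
  (AddCircle.norm_coe_eq_abs_iff (p := (1 : ℝ)) one_ne_zero).2 (by simpa using hx)

theorem norm_coe_le_abs (x : ℝ) : ‖(x : Circ)‖ ≤ |x| := by
  rcases le_total |x| (1 / 2) with h | h
  · exact (norm_coe_of_abs_le h).le
  · refine le_trans ?_ h
    simpa using AddCircle.norm_le_half_period (p := (1 : ℝ)) (x := (x : Circ)) one_ne_zero

/-- Every point of the circle has a lift within the circle distance of a given lift. -/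
theorem exists_lift_near (x : ℝ) (y : Circ) : ∃ u : ℝ, |u| = dist y x ∧ y = ((x + u : ℝ) : Circ) := by
  obtain ⟨v, rfl⟩ := QuotientAddGroup.mk_surjective y
  refine ⟨(v - x) - round (v - x), ?_, ?_⟩
  · rw [dist_eq_norm]
    exact (UnitAddCircle.norm_eq (x := v - x)).symm
  · rw [show x + (v - x - round (v - x)) = v + ((-round (v - x) : ℤ) : ℝ) by push_cast; ring,
      coe_add_intCast]

theorem dist_coe_add (x u : ℝ) : dist ((x + u : ℝ) : Circ) (x : Circ) = ‖(u : Circ)‖ := by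
  rw [dist_eq_norm, ← AddCircle.coe_sub, add_sub_cancel_left]

theorem signedRep_coe {h : ℝ} (hh : |h| < 1 / 2) : signedRep (h : Circ) = h := by
  rw [abs_lt] at hh
  rw [signedRep, AddCircle.equivIoc_coe_eq (p := (1 : ℝ)) (x := h) ⟨by linarith, by linarith⟩]

/-- By continuity the increment of the lift is below `1/2` in absolute value near `x`, where
`signedRep` inverts the projection. Circle derivatives thus become derivatives of the lift. -/
theorem localExpr_eventuallyEq {g : Circ → Circ} {G : ℝ → ℝ} {x : ℝ} (hG : ContinuousAt G x)
    (h : ∀ y : ℝ, g y = G y) : localExpr g x =ᶠ[𝓝 0] fun u => G (x + u) - G x := by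
  have h1 : Tendsto (fun u : ℝ => |G (x + u) - G x|) (𝓝 0) (𝓝 0) := by
    have h2 : Tendsto (fun u : ℝ => x + u) (𝓝 0) (𝓝 x) := by
      have : Continuous fun u : ℝ => x + u := by fun_prop
      simpa using this.tendsto 0
    have h3 := ((hG.tendsto.comp h2).sub_const (G x)).abs
    simpa using h3
  filter_upwards [h1.eventually (gt_mem_nhds (show (0 : ℝ) < 1 / 2 by norm_num))] with u hu
  rw [localExpr, ← AddCircle.coe_add, h, h, ← AddCircle.coe_sub, signedRep_coe hu]

theorem circDeriv_coe {g : Circ → Circ} {G : ℝ → ℝ} {x : ℝ} (hG : ContinuousAt G x)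
    (h : ∀ y : ℝ, g y = G y) : circDeriv g x = deriv G x := by
  rw [circDeriv, (localExpr_eventuallyEq hG h).deriv_eq, deriv_sub_const, deriv_comp_const_add,
    add_zero]

theorem differentiableAt_of_localExpr {g : Circ → Circ} {G : ℝ → ℝ} {x : ℝ}
    (hG : ContinuousAt G x) (h : ∀ y : ℝ, g y = G y)
    (hd : DifferentiableAt ℝ (localExpr g x) 0) : DifferentiableAt ℝ G x := by
  have h1 : DifferentiableAt ℝ (fun u => G (x + u) - G x) 0 :=
    hd.congr_of_eventuallyEq (localExpr_eventuallyEq hG h).symm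
  have h2 : DifferentiableAt ℝ (fun u => G (x + u)) 0 := by
    simpa using h1.add_const (G x)
  have h3 : DifferentiableAt ℝ (fun v => G (x + (v - x))) x := by
    have : DifferentiableAt ℝ (fun u => G (x + u)) (x - x) := by simpa using h2
    exact DifferentiableAt.comp (f := fun v => v - x) x this (by fun_prop)
  simpa using h3

/-- `F` is an increasing lift of the circle map `f` to the line. -/
structure IsCircLift (F : ℝ → ℝ) (f : Circ → Circ) : Prop where
  continuous : Continuous F
  strictMono : StrictMono F
  coe : ∀ x : ℝ, f x = F x

theorem eventually_coe_notMem (P : Finset Circ) (x : ℝ) : ∀ᶠ y : ℝ in 𝓝[≠] x, (y : Circ) ∉ P := by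
  have h : ∀ q ∈ P, ∀ᶠ y : ℝ in 𝓝[≠] x, (y : Circ) ≠ q := by
    intro q _
    by_cases hq : (x : Circ) = q
    · have h1 : ∀ᶠ y : ℝ in 𝓝[≠] x, |y - x| < 1 := by
        refine nhdsWithin_le_nhds ?_
        exact Metric.ball_mem_nhds x one_pos
      filter_upwards [h1, self_mem_nhdsWithin] with y hy1 hy2 hyq
      exact hy2 (eq_of_coe_eq_of_abs_lt (hyq.trans hq.symm) hy1)
    · have hc : ContinuousAt (fun y : ℝ => (y : Circ)) x := (AddCircle.continuous_mk' 1).continuousAt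
      exact nhdsWithin_le_nhds (hc.eventually_ne hq)
  have := (Finset.eventually_all P).2 h
  filter_upwards [this] with y hy hyP
  exact hy _ hyP rfl

variable {α : ℝ} {f : Circ → Circ} {P : Finset Circ} {N : ℕ} {F : ℝ → ℝ}

theorem IsNeutralExpanding.exists_lift (hf : IsNeutralExpanding α f P N) :
    ∃ F, IsCircLift F f := by
  obtain ⟨-, F, h1, h2, h3⟩ := hf.covering
  exact ⟨F, h1, h2, h3⟩

theorem IsNeutralExpanding.continuous (hf : IsNeutralExpanding α f P N) : Continuous f :=
  hf.covering.1.continuous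

section

variable (hf : IsNeutralExpanding α f P N) (hF : IsCircLift F f)
include hf hF

theorem differentiableAt_lift {x : ℝ} (hx : (x : Circ) ∉ P) : DifferentiableAt ℝ F x :=
  differentiableAt_of_localExpr hF.continuous.continuousAt hF.coe (hf.differentiable _ hx)

theorem tendsto_deriv_right (x : ℝ) :
    Tendsto (deriv F) (𝓝[>] x) (𝓝 (derivRight f x)) := by
  have h := hf.right_lim x
  have h1 : Tendsto (fun y : ℝ => y - x) (𝓝[>] x) (𝓝[>] 0) := by
    refine tendsto_nhdsWithin_iff.2 ⟨?_, ?_⟩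
    · refine tendsto_nhdsWithin_of_tendsto_nhds ?_
      have : Continuous fun y : ℝ => y - x := by fun_prop
      simpa using this.tendsto x
    · filter_upwards [self_mem_nhdsWithin] with y hy
      simpa using hy
  refine (h.comp h1).congr fun y => ?_
  simp only [Function.comp_apply, ← AddCircle.coe_add, add_sub_cancel]
  exact circDeriv_coe hF.continuous.continuousAt hF.coe

theorem tendsto_deriv_left (x : ℝ) :
    Tendsto (deriv F) (𝓝[<] x) (𝓝 (derivLeft f x)) := by
  have h := hf.left_lim x
  have h1 : Tendsto (fun y : ℝ => y - x) (𝓝[<] x) (𝓝[<] 0) := by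
    refine tendsto_nhdsWithin_iff.2 ⟨?_, ?_⟩
    · refine tendsto_nhdsWithin_of_tendsto_nhds ?_
      have : Continuous fun y : ℝ => y - x := by fun_prop
      simpa using this.tendsto x
    · filter_upwards [self_mem_nhdsWithin] with y hy
      simpa using hy
  refine (h.comp h1).congr fun y => ?_
  simp only [Function.comp_apply, ← AddCircle.coe_add, add_sub_cancel]
  exact circDeriv_coe hF.continuous.continuousAt hF.coe

theorem eventually_differentiableAt_right (x : ℝ) :
    ∀ᶠ y in 𝓝[>] x, DifferentiableAt ℝ F y := by
  have h := (eventually_coe_notMem P x).filter_mono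
    (nhdsWithin_mono x fun y (hy : x < y) => (ne_of_gt hy : y ≠ x))
  filter_upwards [h] with y hy
  exact differentiableAt_lift hf hF hy

/-- `derivRight` is only a limit of derivatives, but for a continuous function such a limit is a
genuine right derivative. Mean value estimates therefore hold across the points of `P` as well. -/
theorem hasDerivWithinAt_lift (x : ℝ) : HasDerivWithinAt F (derivRight f x) (Ici x) x := by
  refine hasDerivWithinAt_Ici_of_tendsto_deriv (s := {y | DifferentiableAt ℝ F y})
    (fun y hy => DifferentiableAt.differentiableWithinAt hy)
    hF.continuous.continuousAt.continuousWithinAt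
    (eventually_differentiableAt_right hf hF x) (tendsto_deriv_right hf hF x)

theorem hasDerivAt_lift {x : ℝ} (hx : (x : Circ) ∉ P) : HasDerivAt F (derivRight f x) x := by
  have h1 := (differentiableAt_lift hf hF hx).hasDerivAt
  have h2 := (uniqueDiffOn_Ici x x self_mem_Ici).eq_deriv _ h1.hasDerivWithinAt
    (hasDerivWithinAt_lift hf hF x)
  rwa [h2] at h1

theorem circDeriv_eq_derivRight {x : ℝ} (hx : (x : Circ) ∉ P) :
    circDeriv f x = derivRight f x := by
  rw [circDeriv_coe hF.continuous.continuousAt hF.coe]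
  exact (hasDerivAt_lift hf hF hx).deriv

omit hF in
theorem one_le_derivRight (x : Circ) : 1 ≤ derivRight f x := by
  by_cases hx : x ∈ fixedSet f P N
  · exact hf.one_le_deriv x hx
  · exact (hf.one_lt_deriv x hx).le

theorem mul_sub_le_lift {c a b : ℝ} (hab : a ≤ b)
    (hc : ∀ x ∈ Ico a b, c ≤ derivRight f (x : Circ)) : c * (b - a) ≤ F b - F a := by
  have h := image_le_of_deriv_right_le_deriv_boundary (f := fun x => c * (x - a))
    (f' := fun _ => c) (a := a) (b := b) (by fun_prop)
    (fun x _ => by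
      simpa using (((hasDerivWithinAt_id x (Ici x)).sub_const a).const_mul c))
    (B := fun x => F x - F a) (B' := fun x => derivRight f (x : Circ)) (by simp)
    (hF.continuous.sub continuous_const).continuousOn
    (fun x _ => (hasDerivWithinAt_lift hf hF x).sub_const _) hc
  exact h (right_mem_Icc.2 hab)

theorem sub_le_lift {a b : ℝ} (hab : a ≤ b) : b - a ≤ F b - F a := by
  simpa using mul_sub_le_lift hf hF hab (c := 1) fun x _ => one_le_derivRight hf x

end

/-- The lift of a random iterate. -/
def liftIter (F : ℝ → ℝ) (t : ℕ → ℝ) (n : ℕ) (x : ℝ) : ℝ := chain (fun y s => F y + s) x t n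

theorem randIter_coe (hF : IsCircLift F f) (t : ℕ → ℝ) (n : ℕ) (x : ℝ) :
    randIter f t n x = liftIter F t n x := by
  induction n with
  | zero => rfl
  | succ n ih =>
    change f (randIter f t n x) + (t n : Circ) = ((F (liftIter F t n x) + t n : ℝ) : Circ)
    rw [ih, hF.coe, AddCircle.coe_add]

theorem liftIter_succ (F : ℝ → ℝ) (t : ℕ → ℝ) (n : ℕ) (x : ℝ) :
    liftIter F t (n + 1) x = F (liftIter F t n x) + t n := rfl

theorem continuous_liftIter (hF : IsCircLift F f) (t : ℕ → ℝ) (n : ℕ) :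
    Continuous (liftIter F t n) := by
  induction n with
  | zero => exact continuous_id
  | succ n ih => exact (hF.continuous.comp ih).add continuous_const

theorem strictMono_liftIter (hF : IsCircLift F f) (t : ℕ → ℝ) (n : ℕ) :
    StrictMono (liftIter F t n) := by
  induction n with
  | zero => exact strictMono_id
  | succ n ih => exact (hF.strictMono.comp ih).add_const _

theorem sub_liftIter_le_succ (hf : IsNeutralExpanding α f P N) (hF : IsCircLift F f)
    (t : ℕ → ℝ) (n : ℕ) {a b : ℝ} (hab : a ≤ b) :
    liftIter F t n b - liftIter F t n a ≤ liftIter F t (n + 1) b - liftIter F t (n + 1) a := by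
  have := sub_le_lift hf hF ((strictMono_liftIter hF t n).monotone hab)
  rw [liftIter_succ, liftIter_succ]
  linarith

theorem sub_liftIter_mono (hf : IsNeutralExpanding α f P N) (hF : IsCircLift F f)
    (t : ℕ → ℝ) {a b : ℝ} (hab : a ≤ b) :
    Monotone fun n => liftIter F t n b - liftIter F t n a :=
  monotone_nat_of_le_succ fun n => sub_liftIter_le_succ hf hF t n hab

theorem tendsto_nhdsGT_of_strictMono {G : ℝ → ℝ} (hG : Continuous G) (hG' : StrictMono G) (x : ℝ) :
    Tendsto G (𝓝[>] x) (𝓝[>] (G x)) := by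
  refine tendsto_nhdsWithin_iff.2 ⟨(hG.tendsto x).mono_left nhdsWithin_le_nhds, ?_⟩
  filter_upwards [self_mem_nhdsWithin] with y hy
  exact hG' hy

/-- The chain rule survives for right limits because the lifts increase strictly: `y ↓ x` implies
that the images approach from the right too, through points of differentiability. -/
theorem tendsto_deriv_liftIter (hf : IsNeutralExpanding α f P N) (hF : IsCircLift F f)
    (t : ℕ → ℝ) (n : ℕ) (x : ℝ) :
    (∀ᶠ y in 𝓝[>] x, DifferentiableAt ℝ (liftIter F t n) y) ∧
      Tendsto (deriv (liftIter F t n)) (𝓝[>] x)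
        (𝓝 (∏ i ∈ Finset.range n, derivRight f (liftIter F t i x : Circ))) := by
  induction n with
  | zero =>
    have h0 : liftIter F t 0 = id := rfl
    rw [h0, Finset.range_zero, Finset.prod_empty]
    refine ⟨Eventually.of_forall fun y => differentiableAt_id, ?_⟩
    simp only [deriv_id']
    exact tendsto_const_nhds
  | succ n ih =>
    have hG := tendsto_nhdsGT_of_strictMono (continuous_liftIter hF t n)
      (strictMono_liftIter hF t n) x
    have h1 : ∀ᶠ y in 𝓝[>] x, HasDerivAt (liftIter F t (n + 1))
        (deriv F (liftIter F t n y) * deriv (liftIter F t n) y) y := by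
      filter_upwards [ih.1, hG.eventually (eventually_differentiableAt_right hf hF _)] with y h1 h2
      exact (HasDerivAt.comp y h2.hasDerivAt h1.hasDerivAt).add_const (t n)
    refine ⟨h1.mono fun y hy => hy.differentiableAt, ?_⟩
    have h2 := ((tendsto_deriv_right hf hF (liftIter F t n x)).comp hG).mul ih.2
    rw [Finset.prod_range_succ, mul_comm]
    refine h2.congr' ?_
    filter_upwards [h1] with y hy
    exact hy.deriv.symm

theorem derivRight_randIter (hf : IsNeutralExpanding α f P N) (t : ℕ → ℝ) (n : ℕ) (x : Circ) :
    derivRight (randIter f t n) x = ∏ i ∈ Finset.range n, derivRight f (randIter f t i x) := by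
  obtain ⟨F, hF⟩ := hf.exists_lift
  obtain ⟨x, rfl⟩ := QuotientAddGroup.mk_surjective x
  simp only [randIter_coe hF]
  refine Tendsto.limUnder_eq ?_
  have h1 : Tendsto (fun h : ℝ => x + h) (𝓝[>] 0) (𝓝[>] x) := by
    have := tendsto_nhdsGT_of_strictMono (G := fun h : ℝ => x + h) (by fun_prop)
      (strictMono_id.const_add x) 0
    simpa using this
  refine ((tendsto_deriv_liftIter hf hF t n x).2.comp h1).congr fun h => ?_
  rw [← AddCircle.coe_add]
  exact (circDeriv_coe (continuous_liftIter hF t n).continuousAt (randIter_coe hF t n)).symm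

theorem randIter_shift (f : Circ → Circ) (t : ℕ → ℝ) (j i : ℕ) (y : Circ) :
    randIter f (shift j t) i (randIter f t j y) = randIter f t (i + j) y := by
  induction i with
  | zero => rw [Nat.zero_add]; rfl
  | succ i ih =>
    rw [Nat.succ_add]
    change perturb f _ _ = perturb f _ _
    rw [ih]
    rfl

/-- The sum whose supremum is the distortion sum. -/
def orbitSum (α : ℝ) (f : Circ → Circ) (t : ℕ → ℝ) (n : ℕ) (y : Circ) : ℝ :=
  ∑ j ∈ Finset.range n, (1 / derivRight (randIter f (shift j t) (n - j)) (randIter f t j y)) ^ α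

/-- The derivative at the last point enters every term, the new term `j = n` included. The
distortion is studied through this recursion only. -/
theorem orbitSum_succ (hf : IsNeutralExpanding α f P N) (t : ℕ → ℝ) (n : ℕ) (y : Circ) :
    orbitSum α f t (n + 1) y =
      (orbitSum α f t n y + 1) * (derivRight f (randIter f t n y)) ^ (-α) := by
  have hpos : ∀ x, 0 ≤ derivRight f x := fun x => zero_le_one.trans (one_le_derivRight hf x)
  have h : ∀ j ≤ n, (1 / derivRight (randIter f (shift j t) (n + 1 - j)) (randIter f t j y)) ^ α =
      (1 / derivRight (randIter f (shift j t) (n - j)) (randIter f t j y)) ^ α *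
        (derivRight f (randIter f t n y)) ^ (-α) := by
    intro j hj
    rw [derivRight_randIter hf, derivRight_randIter hf, Nat.succ_sub hj, Finset.prod_range_succ,
      randIter_shift, Nat.sub_add_cancel hj, one_div, one_div, mul_inv,
      Real.mul_rpow (inv_nonneg.2 (Finset.prod_nonneg fun i _ => hpos _)) (inv_nonneg.2 (hpos _)),
      Real.inv_rpow (hpos (randIter f t n y)), Real.rpow_neg (hpos _)]
  rw [orbitSum, Finset.sum_range_succ, h n le_rfl,
    Finset.sum_congr rfl fun j hj => h j (Finset.mem_range.1 hj).le, ← Finset.sum_mul, orbitSum,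
    Nat.sub_self, derivRight_randIter hf]
  simp [add_mul]

theorem orbitSum_zero (α : ℝ) (f : Circ → Circ) (t : ℕ → ℝ) (y : Circ) :
    orbitSum α f t 0 y = 0 := by simp [orbitSum]

end

/-! ### A Lyapunov function near a neutral fixed point -/

section

/-- One side of a fixed point with drift `g` and derivative `D = g' + 1`, which is at least
`1 + u^α / M` and `α`-Hölder, on the interval `(0, 1/M)`. -/
structure ExpandingSide (α M : ℝ) (g D : ℝ → ℝ) : Prop where
  zero : g 0 = 0
  continuousOn : ContinuousOn g (Ico 0 (1 / M))
  hasDerivAt : ∀ u ∈ Ioo 0 (1 / M), HasDerivAt g (D u - 1) u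
  lower : ∀ u ∈ Ioo 0 (1 / M), u ^ α / M ≤ D u - 1
  upper : ∀ u ∈ Ioo 0 (1 / M), D u ≤ M
  holder : ∀ u ∈ Ioo 0 (1 / M), ∀ v ∈ Ioo 0 (1 / M), |D u - D v| ≤ M * |u - v| ^ α

namespace ExpandingSide

variable {α M : ℝ} {g D : ℝ → ℝ}

theorem exists_slope (h : ExpandingSide α M g D) {u v : ℝ} (hu : 0 ≤ u) (huv : u < v)
    (hv : v < 1 / M) : ∃ ξ ∈ Ioo u v, g v - g u = (D ξ - 1) * (v - u) := by
  obtain ⟨ξ, hξ, h1⟩ := exists_hasDerivAt_eq_slope g (fun x => D x - 1) huv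
    (h.continuousOn.mono fun x hx => ⟨hu.trans hx.1, hx.2.trans_lt hv⟩)
    (fun x hx => h.hasDerivAt x ⟨hu.trans_lt hx.1, hx.2.trans hv⟩)
  refine ⟨ξ, hξ, ?_⟩
  rw [h1, div_mul_cancel₀]
  linarith

theorem nonneg_slope (h : ExpandingSide α M g D) (hM : 0 < M) {ξ : ℝ} (hξ : ξ ∈ Ioo 0 (1 / M)) :
    0 ≤ D ξ - 1 :=
  (div_nonneg (Real.rpow_nonneg hξ.1.le α) hM.le).trans (h.lower ξ hξ)

theorem mono (h : ExpandingSide α M g D) (hM : 0 < M) {u v : ℝ} (hu : 0 ≤ u) (huv : u ≤ v)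
    (hv : v < 1 / M) : g u ≤ g v := by
  rcases huv.eq_or_lt with rfl | huv
  · exact le_rfl
  obtain ⟨ξ, hξ, h1⟩ := h.exists_slope hu huv hv
  have := mul_nonneg (h.nonneg_slope hM ⟨hu.trans_lt hξ.1, hξ.2.trans hv⟩) (sub_nonneg.2 huv.le)
  linarith

theorem increment_lower (h : ExpandingSide α M g D) (hα : 0 ≤ α) (hM : 0 < M) {u v : ℝ}
    (hu : 0 ≤ u) (huv : u ≤ v) (hv : v < 1 / M) : u ^ α / M * (v - u) ≤ g v - g u := by
  rcases huv.eq_or_lt with rfl | huv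
  · simp
  obtain ⟨ξ, hξ, h1⟩ := h.exists_slope hu huv hv
  rw [h1]
  have h2 := h.lower ξ ⟨hu.trans_lt hξ.1, hξ.2.trans hv⟩
  have h3 : u ^ α ≤ ξ ^ α := Real.rpow_le_rpow hu hξ.1.le hα
  have h4 : u ^ α / M ≤ ξ ^ α / M := by gcongr
  exact mul_le_mul_of_nonneg_right (h4.trans h2) (by linarith)

theorem increment_upper (h : ExpandingSide α M g D) {u v : ℝ}
    (hu : 0 ≤ u) (huv : u ≤ v) (hv : v < 1 / M) : g v - g u ≤ (M - 1) * (v - u) := by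
  rcases huv.eq_or_lt with rfl | huv
  · simp
  obtain ⟨ξ, hξ, h1⟩ := h.exists_slope hu huv hv
  rw [h1]
  have h2 := h.upper ξ ⟨hu.trans_lt hξ.1, hξ.2.trans hv⟩
  exact mul_le_mul_of_nonneg_right (by linarith) (by linarith)

theorem abs_increment_sub_le (h : ExpandingSide α M g D) (hα : 0 ≤ α) (hM : 0 < M) {u v : ℝ}
    (hu : 0 < u) (huv : u ≤ v) (hv : v < 1 / M) :
    |g v - g u - (D u - 1) * (v - u)| ≤ M * (v - u) ^ α * (v - u) := by
  rcases huv.eq_or_lt with rfl | huv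
  · simp
  obtain ⟨ξ, hξ, h1⟩ := h.exists_slope hu.le huv hv
  have h2 := h.holder ξ ⟨hu.trans hξ.1, hξ.2.trans hv⟩ u ⟨hu, huv.trans hv⟩
  rw [h1, show (D ξ - 1) * (v - u) - (D u - 1) * (v - u) = (D ξ - D u) * (v - u) by ring, abs_mul,
    abs_of_pos (sub_pos.2 huv)]
  refine mul_le_mul_of_nonneg_right (h2.trans ?_) (sub_pos.2 huv).le
  rw [abs_of_pos (sub_pos.2 hξ.1)]
  have : (ξ - u) ^ α ≤ (v - u) ^ α :=
    Real.rpow_le_rpow (sub_pos.2 hξ.1).le (by linarith [hξ.2]) hα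
  gcongr

/-- On `[u/2, u]` the slope of `g` is at least `(u/2)^α / M`, and `g ≥ 0` at `u/2`. -/
theorem le_drift (h : ExpandingSide α M g D) (hα : 0 ≤ α) (hM : 0 < M) {u : ℝ}
    (hu : 0 < u) (hu' : u < 1 / M) : (u / 2) ^ (1 + α) / M ≤ g u := by
  have h1 := h.increment_lower hα hM (half_pos hu).le (half_le_self hu.le) hu'
  have h2 := h.mono hM le_rfl (half_pos hu).le (by linarith)
  rw [h.zero] at h2
  have h3 : (u / 2) ^ (1 + α) / M = (u / 2) ^ α / M * (u - u / 2) := by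
    rw [Real.rpow_add (half_pos hu), Real.rpow_one]; ring
  linarith

theorem drift_le (h : ExpandingSide α M g D) {u : ℝ}
    (hu : 0 ≤ u) (hu' : u < 1 / M) : g u ≤ (M - 1) * u := by
  have := h.increment_upper le_rfl hu hu'
  rwa [h.zero, sub_zero, sub_zero] at this

end ExpandingSide

/-- Concavity of `x ↦ x^s`, with the tangent taken at the larger point; this is Bernoulli's
inequality for `u / v`. -/
theorem rpow_sub_rpow_ge {s u v : ℝ} (hs0 : 0 < s) (hs1 : s ≤ 1) (hu : 0 < u) (huv : u ≤ v) :
    s * v ^ (s - 1) * (v - u) ≤ v ^ s - u ^ s := by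
  have hv : 0 < v := hu.trans_le huv
  have h1 := rpow_one_add_le_one_add_mul_self (s := u / v - 1) (p := s)
    (by linarith [div_pos hu hv]) hs0.le hs1
  rw [add_sub_cancel, Real.div_rpow hu.le hv.le, div_le_iff₀ (Real.rpow_pos_of_pos hv s)] at h1
  have h2 : v ^ s = v ^ (s - 1) * v := by
    rw [← Real.rpow_add_one hv.ne', sub_add_cancel]
  have h3 : s * (u / v - 1) * v ^ s = - (s * v ^ (s - 1) * (v - u)) := by
    rw [h2]; field_simp; ring
  nlinarith

set_option maxHeartbeats 1000000 in
/-- A Lyapunov function for the escape from a neutral fixed point under noise of size `ε`,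
in the region where the drift dominates the noise. -/
theorem ExpandingSide.exists_potential {α M r : ℝ} (hα₀ : 0 < α) (hα₁ : α < 1) (hM : 1 ≤ M)
    (hr : 0 < r) :
    ∃ A : ℝ, 0 < A ∧ ∀ g D : ℝ → ℝ, ExpandingSide α M g D → ∀ ε : ℝ, 0 < ε →
      ∃ Q : ℝ → ℝ, (∀ u, 0 < u → u < 1 / M → 2 * ε ≤ g u → 0 ≤ Q u) ∧
        (∀ u t, 0 < u → 2 * ε ≤ g u → |t| ≤ ε → u + g u + t < 1 / M → u < u + g u + t ∧
          Q (u + g u + t) ≤ D u ^ α * Q u ∧ Q u ≤ A * ((u + g u + t) ^ (α ^ 2) - u ^ (α ^ 2))) ∧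
        (∀ v, 0 < v → v < 1 / M → 2 * ε ≤ g v → g v ≤ 5 * M * ε → Q v ≤ A * ε ^ α) ∧
        (∀ v, r ≤ v → v < 1 / M → 2 * ε ≤ g v → 1 ≤ A * Q v) := by
  have hM0 : 0 < M := by linarith
  -- From `g ≥ c₀ u^{1+α}` one gets `g^{α-1} ≤ C u^{(1+α)(α-1)} = C u^{α²-1}`. Hence `g^α`, the size
  -- of the Hölder error in a step of length about `g`, is bounded by the increment of `u^{α²}`.
  set s : ℝ := α ^ 2 with hs
  have hs0 : 0 < s := by positivity
  have hs1 : s < 1 := by rw [hs]; nlinarith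
  set Λ : ℝ := 1 + 2 * M with hΛ
  have hΛ0 : 0 < Λ := by positivity
  set c₀ : ℝ := (1 / 2 : ℝ) ^ (1 + α) / M with hc₀
  have hc₀0 : 0 < c₀ := by positivity
  set C₃ : ℝ := 2 * c₀ ^ (α - 1) * Λ ^ (1 - s) / s with hC₃
  have hC₃0 : 0 < C₃ := by positivity
  set E : ℝ := 12 * M * C₃ with hE
  have hE0 : 0 < E := by positivity
  set q₀ : ℝ := (c₀ * r ^ (1 + α) * Real.exp (-E)) ^ α with hq₀
  have hq₀0 : 0 < q₀ := by positivity
  -- The three summands serve, in this order, the increment bound, the entry bound and the lower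
  -- bound at distance `r`.
  refine ⟨Real.exp (α * Λ) * C₃ + (5 * M) ^ α * Real.exp (α * Λ) + 1 / q₀, by positivity, ?_⟩
  intro g D h ε hε
  have hgpos : ∀ u, 2 * ε ≤ g u → 0 < g u := fun u hu => by linarith
  have hgc : ∀ u, 0 < u → u < 1 / M → c₀ * u ^ (1 + α) ≤ g u := by
    intro u hu hu'
    have := h.le_drift hα₀.le hM0 hu hu'
    rw [div_eq_mul_one_div u, Real.mul_rpow hu.le (by norm_num)] at this
    calc c₀ * u ^ (1 + α) = u ^ (1 + α) * (1 / 2) ^ (1 + α) / M := by rw [hc₀]; ring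
      _ ≤ _ := this
  -- Without errors, `g (u + g u) = D u * g u`. The term with `ε / g` absorbs the effect of the
  -- noise and the term with `u ^ s` the Hölder error; both errors are bounded by telescoping
  -- differences, so the correction `exp Ξ` stays bounded above and below.
  set Ξ : ℝ → ℝ := fun u => 2 * Λ * (ε / g u) - E * u ^ s with hΞ
  have hΞle : ∀ u, 0 < u → 2 * ε ≤ g u → Ξ u ≤ Λ := by
    intro u hu hg
    have h1 : ε / g u ≤ 1 / 2 := by
      rw [div_le_iff₀ (hgpos u hg)]; linarith
    have h2 : 0 ≤ E * u ^ s := by positivity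
    have h3 : 2 * Λ * (ε / g u) ≤ 2 * Λ * (1 / 2) := by gcongr
    simp only [hΞ]
    linarith
  have hQmul : ∀ u, 2 * ε ≤ g u → (g u * Real.exp (Ξ u)) ^ α = g u ^ α * Real.exp (α * Ξ u) := by
    intro u hg
    rw [Real.mul_rpow (hgpos u hg).le (Real.exp_pos _).le, ← Real.exp_mul, mul_comm (Ξ u)]
  have hQle : ∀ u, 0 < u → 2 * ε ≤ g u →
      (g u * Real.exp (Ξ u)) ^ α ≤ g u ^ α * Real.exp (α * Λ) := by
    intro u hu hg
    rw [hQmul u hg]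
    exact mul_le_mul_of_nonneg_left (Real.exp_le_exp.2
      (mul_le_mul_of_nonneg_left (hΞle u hu hg) hα₀.le)) (Real.rpow_nonneg (hgpos u hg).le α)
  refine ⟨fun u => (g u * Real.exp (Ξ u)) ^ α, ?_, ?_, ?_, ?_⟩
  · intro u _ _ hg
    have := hgpos u hg
    positivity
  · intro u t hu hg ht hvR
    obtain ⟨ht1, ht2⟩ := abs_le.1 ht
    have hgu := hgpos u hg
    set v : ℝ := u + g u + t with hv
    have hvu1 : g u / 2 ≤ v - u := by rw [hv]; linarith
    have hvu2 : v - u ≤ g u + ε := by rw [hv]; linarith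
    have hvu3 : v - u ≤ 2 * g u := by linarith
    have huv : u < v := by linarith
    have huR : u < 1 / M := huv.trans hvR
    have hv0 : 0 < v := hu.trans huv
    have hgM := h.drift_le hu.le huR
    have hvΛ : v ≤ Λ * u := by
      rw [hΛ]; nlinarith
    have hgv := h.mono hM0 hu.le huv.le hvR
    have hgv0 : 0 < g v := hgu.trans_le hgv
    have hgvΛ : g v ≤ Λ * g u := by
      have := h.increment_upper hu.le huv.le hvR
      rw [hΛ]; nlinarith
    have hDu := h.nonneg_slope hM0 ⟨hu, huR⟩
    have hab := abs_le.1 (h.abs_increment_sub_le hα₀.le hM0 hu huv.le hvR)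
    have hpow : (v - u) ^ α ≤ 2 * g u ^ α := by
      calc (v - u) ^ α ≤ (2 * g u) ^ α := Real.rpow_le_rpow (by linarith) hvu3 hα₀.le
        _ = 2 ^ α * g u ^ α := Real.mul_rpow (by norm_num) hgu.le
        _ ≤ 2 * g u ^ α := by
          gcongr
          calc (2 : ℝ) ^ α ≤ 2 ^ (1 : ℝ) := Real.rpow_le_rpow_of_exponent_le (by norm_num) hα₁.le
            _ = 2 := Real.rpow_one 2
    have hgα : 0 < g u ^ α := by positivity
    have herr : M * (v - u) ^ α * (v - u) ≤ 4 * M * g u ^ α * g u := by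
      calc M * (v - u) ^ α * (v - u) ≤ M * (2 * g u ^ α) * (2 * g u) := by
            gcongr
        _ = _ := by ring
    -- the sum of the errors is controlled by a telescoping sum
    have hC₃v : g u ^ α ≤ C₃ * (v ^ s - u ^ s) := by
      have h1 := rpow_sub_rpow_ge hs0 hs1.le hu huv.le
      have h2 : (Λ * u) ^ (s - 1) ≤ v ^ (s - 1) :=
        Real.rpow_le_rpow_of_nonpos hv0 hvΛ (by linarith)
      have h3 : s * (Λ * u) ^ (s - 1) * (g u / 2) ≤ v ^ s - u ^ s := by
        refine le_trans ?_ h1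
        gcongr
      have h4 : g u ^ (α - 1) ≤ c₀ ^ (α - 1) * u ^ (s - 1) := by
        calc g u ^ (α - 1) ≤ (c₀ * u ^ (1 + α)) ^ (α - 1) :=
              Real.rpow_le_rpow_of_nonpos (by positivity) (hgc u hu huR) (by linarith)
          _ = _ := by
              rw [Real.mul_rpow hc₀0.le (by positivity), ← Real.rpow_mul hu.le,
                show (1 + α) * (α - 1) = s - 1 by rw [hs]; ring]
      calc g u ^ α = g u ^ (α - 1) * g u := by
            rw [← Real.rpow_add_one hgu.ne', sub_add_cancel]
        _ ≤ c₀ ^ (α - 1) * u ^ (s - 1) * g u := by gcongr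
        _ = C₃ * (s * (Λ * u) ^ (s - 1) * (g u / 2)) := by
            rw [Real.mul_rpow hΛ0.le hu.le, hC₃,
              show Λ ^ (1 - s) = (Λ ^ (s - 1))⁻¹ by rw [← Real.rpow_neg hΛ0.le]; ring_nf]
            field_simp
        _ ≤ _ := by gcongr
    have hεg : ε / g u ≤ 1 := by rw [div_le_one hgu]; linarith
    -- The Hölder expansion is solved for the slope, using `v - u ≥ g u / 2`, in order to express
    -- the slope by the increment of `g`.
    have he1 : D u - 1 ≤ 2 * ((g v - g u) / g u) + 8 * M * g u ^ α := by
      have h1 : (D u - 1) * (g u / 2) ≤ (D u - 1) * (v - u) := by gcongr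
      have h2 : (D u - 1) * (g u / 2) ≤ (g v - g u) + 4 * M * g u ^ α * g u := by linarith [hab.1]
      have h3 : 2 * ((g v - g u) / g u) + 8 * M * g u ^ α =
          (2 * (g v - g u) + 8 * M * g u ^ α * g u) / g u := by field_simp
      rw [h3, le_div_iff₀ hgu]
      linarith
    -- The relative noise error telescopes: `(ε / g u) * (g v - g u) / g u` is `ε / g u - ε / g v`
    -- times the bounded ratio `g v / g u`.
    have he2 : ε / g u * (D u - 1) ≤ 2 * Λ * (ε / g u - ε / g v) + 8 * M * g u ^ α := by
      have h1 : ε / g u * ((g v - g u) / g u) = (g v / g u) * (ε / g u - ε / g v) := by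
        field_simp
      have h2 : 0 ≤ ε / g u - ε / g v := by
        have : ε / g v ≤ ε / g u := by gcongr
        linarith
      have h3 : g v / g u ≤ Λ := by rw [div_le_iff₀ hgu]; exact hgvΛ
      calc ε / g u * (D u - 1) ≤ ε / g u * (2 * ((g v - g u) / g u) + 8 * M * g u ^ α) := by
            gcongr
        _ = 2 * (g v / g u * (ε / g u - ε / g v)) + ε / g u * (8 * M * g u ^ α) := by
            rw [← h1]; ring
        _ ≤ 2 * (Λ * (ε / g u - ε / g v)) + 1 * (8 * M * g u ^ α) := by gcongr
        _ = _ := by ring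
    have hstep : g v ≤ g u * (D u * Real.exp (Ξ u - Ξ v)) := by
      have h1 : g v ≤ g u + (D u - 1) * (g u + ε) + 4 * M * g u ^ α * g u := by
        have : (D u - 1) * (v - u) ≤ (D u - 1) * (g u + ε) := by gcongr
        linarith [hab.2]
      have h2 : g u + (D u - 1) * (g u + ε) + 4 * M * g u ^ α * g u =
          g u * (D u + (ε / g u * (D u - 1) + 4 * M * g u ^ α)) := by
        field_simp
        ring
      have h3 : ε / g u * (D u - 1) + 4 * M * g u ^ α ≤ Ξ u - Ξ v := by
        have : 12 * M * g u ^ α ≤ E * (v ^ s - u ^ s) := by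
          rw [hE, mul_assoc (12 * M)]
          gcongr
        simp only [hΞ]
        linarith
      have h4 : 0 ≤ ε / g u * (D u - 1) + 4 * M * g u ^ α := by positivity
      have h5 := Real.add_one_le_exp (Ξ u - Ξ v)
      rw [h2] at h1
      refine h1.trans (mul_le_mul_of_nonneg_left ?_ hgu.le)
      have h6 : D u * (1 + (Ξ u - Ξ v)) ≤ D u * Real.exp (Ξ u - Ξ v) :=
        mul_le_mul_of_nonneg_left (by linarith) (by linarith)
      have h7 : Ξ u - Ξ v ≤ D u * (Ξ u - Ξ v) :=
        le_mul_of_one_le_left (h4.trans h3) (by linarith)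
      rw [mul_add, mul_one] at h6
      linarith
    refine ⟨huv, ?_, ?_⟩
    · have hD0 : 0 ≤ D u := by linarith
      rw [← Real.mul_rpow hD0 (by positivity)]
      refine Real.rpow_le_rpow (by positivity) ?_ hα₀.le
      calc g v * Real.exp (Ξ v) ≤ g u * (D u * Real.exp (Ξ u - Ξ v)) * Real.exp (Ξ v) := by gcongr
        _ = D u * (g u * (Real.exp (Ξ u - Ξ v) * Real.exp (Ξ v))) := by ring
        _ = D u * (g u * Real.exp (Ξ u)) := by rw [← Real.exp_add, sub_add_cancel]
    · refine (hQle u hu hg).trans ?_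
      have h0 : 0 ≤ v ^ s - u ^ s := by
        have := Real.rpow_le_rpow hu.le huv.le hs0.le
        linarith
      calc g u ^ α * Real.exp (α * Λ) ≤ C₃ * (v ^ s - u ^ s) * Real.exp (α * Λ) := by gcongr
        _ = Real.exp (α * Λ) * C₃ * (v ^ s - u ^ s) := by ring
        _ ≤ _ := by
          gcongr
          have : 0 ≤ (5 * M) ^ α * Real.exp (α * Λ) := by positivity
          have : 0 ≤ 1 / q₀ := by positivity
          linarith
  · intro v hv hv' hg hgle
    refine (hQle v hv hg).trans ?_
    have hgv := hgpos v hg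
    calc g v ^ α * Real.exp (α * Λ) ≤ (5 * M * ε) ^ α * Real.exp (α * Λ) := by gcongr
      _ = (5 * M) ^ α * Real.exp (α * Λ) * ε ^ α := by
          rw [Real.mul_rpow (by positivity) hε.le]; ring
      _ ≤ _ := by
          gcongr
          have : 0 ≤ Real.exp (α * Λ) * C₃ := by positivity
          have : 0 ≤ 1 / q₀ := by positivity
          linarith
  · intro v hv hv' hg
    have hv0 : 0 < v := hr.trans_le hv
    have hgv := hgpos v hg
    have hv1 : v ≤ 1 := hv'.le.trans (by rw [div_le_one hM0]; exact hM)
    have h1 : q₀ ≤ (g v * Real.exp (Ξ v)) ^ α := by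
      refine Real.rpow_le_rpow (by positivity) ?_ hα₀.le
      refine mul_le_mul ?_ ?_ (Real.exp_pos _).le hgv.le
      · refine le_trans ?_ (hgc v hv0 hv')
        gcongr
      · refine Real.exp_le_exp.2 ?_
        have h2 : v ^ s ≤ 1 := Real.rpow_le_one hv0.le hv1 hs0.le
        have h3 : 0 ≤ 2 * Λ * (ε / g v) := by positivity
        have h4 : E * v ^ s ≤ E * 1 := by gcongr
        simp only [hΞ]
        linarith
    calc (1 : ℝ) = 1 / q₀ * q₀ := by field_simp
      _ ≤ (Real.exp (α * Λ) * C₃ + (5 * M) ^ α * Real.exp (α * Λ) + 1 / q₀) *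
          (g v * Real.exp (Ξ v)) ^ α := by
        gcongr
        have : 0 ≤ Real.exp (α * Λ) * C₃ + (5 * M) ^ α * Real.exp (α * Λ) := by positivity
        linarith

end

/-! ### Backward sums along a passage near a neutral fixed point -/

section

/-- The sums `∑_{j<n} ∏_{j≤i<n} dᵢ^{-α}`, defined by recursion. -/
def backwardSum (α : ℝ) (d : ℕ → ℝ) : ℕ → ℝ
  | 0 => 0
  | n + 1 => (backwardSum α d n + 1) * d n ^ (-α)

theorem backwardSum_nonneg {α : ℝ} {d : ℕ → ℝ} {n : ℕ} (hd : ∀ i < n, 1 ≤ d i) :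
    0 ≤ backwardSum α d n := by
  induction n with
  | zero => exact le_rfl
  | succ n ih =>
    have h1 := ih fun i hi => hd i (hi.trans (Nat.lt_succ_self n))
    have h2 := hd n (Nat.lt_succ_self n)
    rw [backwardSum]
    positivity

theorem rpow_neg_le_one {α d : ℝ} (hα : 0 ≤ α) (hd : 1 ≤ d) : d ^ (-α) ≤ 1 :=
  Real.rpow_le_one_of_one_le_of_nonpos hd (by linarith)

theorem backwardSum_le {α : ℝ} (hα : 0 ≤ α) {d : ℕ → ℝ} {n : ℕ} (hd : ∀ i < n, 1 ≤ d i) :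
    backwardSum α d n ≤ n := by
  induction n with
  | zero => simp [backwardSum]
  | succ n ih =>
    have h1 := ih fun i hi => hd i (hi.trans (Nat.lt_succ_self n))
    have h0 := backwardSum_nonneg (α := α) fun i hi => hd i (hi.trans (Nat.lt_succ_self n))
    have h2 := rpow_neg_le_one hα (hd n (Nat.lt_succ_self n))
    rw [backwardSum]
    push_cast
    nlinarith

/-- Fixed points of increasing maps `G` that are expanding on both sides. -/
structure NeutralPoint (α M : ℝ) (G D : ℝ → ℝ) : Prop where
  right : ExpandingSide α M (fun u => G u - u) D
  left : ExpandingSide α M (fun u => -G (-u) - u) fun u => D (-u)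

namespace NeutralPoint

variable {α M : ℝ} {G D : ℝ → ℝ}

theorem reflect (h : NeutralPoint α M G D) :
    NeutralPoint α M (fun u => -G (-u)) fun u => D (-u) :=
  ⟨h.left, by simpa using h.right⟩

theorem map_zero (h : NeutralPoint α M G D) : G 0 = 0 := by
  simpa using h.right.zero

theorem map_le_of_nonpos (h : NeutralPoint α M G D) (hM : 0 < M) {u : ℝ} (hu : u ≤ 0)
    (hu' : -(1 / M) < u) : G u ≤ u := by
  have := h.left.mono hM le_rfl (neg_nonneg.2 hu) (by linarith)
  rw [h.left.zero, neg_neg] at this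
  linarith

end NeutralPoint

/-- The backward sum along an orbit that escapes from a neutral fixed point to the right. -/
theorem exists_escape_right_bound {α M r : ℝ} (hα₀ : 0 < α) (hα₁ : α < 1) (hM : 1 ≤ M)
    (hr : 0 < r) (hrM : r ≤ 1 / (4 * M ^ 2)) :
    ∃ A : ℝ, 0 < A ∧ ∃ ε₀ : ℝ, 0 < ε₀ ∧ ∀ G D : ℝ → ℝ, NeutralPoint α M G D →
      ∀ ε : ℝ, 0 < ε → ε ≤ ε₀ → ∀ (u t : ℕ → ℝ) (n : ℕ), (∀ i < n, |u i| < r) → r ≤ u n →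
        (∀ i < n, u (i + 1) = G (u i) + t i) → (∀ i < n, |t i| ≤ ε) → (∀ i < n, 1 ≤ D (u i)) →
        0 < n → backwardSum α (fun i => D (u i)) n ≤ A * (1 + n * ε ^ α) := by
  have hM0 : 0 < M := by linarith
  obtain ⟨A, hA, hpot⟩ := ExpandingSide.exists_potential (M := M) hα₀ hα₁ hM hr
  -- The first bound on `ε` keeps the exit point below `1 / M`, where the local estimates hold; the
  -- second makes the drift at distance `r` at least `2 ε`. One factor `A` comes from the induction
  -- below, the other from the lower bound for the potential at the exit.
  refine ⟨A * A, by positivity, min (1 / (4 * M)) ((r / 2) ^ (1 + α) / (2 * M)), by positivity, ?_⟩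
  intro G D h ε hε hε₀ u t n hu hun hstep ht hD hn
  have hε1 : ε ≤ 1 / (4 * M) := hε₀.trans (min_le_left _ _)
  have hε2 : 2 * ε ≤ (r / 2) ^ (1 + α) / M := by
    have := hε₀.trans (min_le_right _ _)
    calc 2 * ε ≤ 2 * ((r / 2) ^ (1 + α) / (2 * M)) := by gcongr
      _ = _ := by field_simp
  obtain ⟨Q, hQ0, hQ1, hQ2, hQ3⟩ := hpot _ D h.right ε hε
  have hMr : M * r ≤ 1 / (4 * M) := by
    calc M * r ≤ M * (1 / (4 * M ^ 2)) := by gcongr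
      _ = 1 / (4 * M) := by field_simp
  have hr1 : r ≤ 1 / (4 * M) := le_trans (le_mul_of_one_le_left hr.le hM) hMr
  have hM4 : 1 / (4 * M) + 1 / (4 * M) < 1 / M := by
    have : 1 / (4 * M) = 1 / M / 4 := by field_simp
    have : 0 < 1 / M := by positivity
    linarith
  have h4 : 0 < 1 / (4 * M) := by positivity
  set s : ℝ := α ^ 2 with hs
  have hs0 : 0 < s := by positivity
  set w := backwardSum α fun i => D (u i) with hw
  have hw0 : ∀ i ≤ n, 0 ≤ w i := fun i hi =>
    backwardSum_nonneg fun j hj => hD j (hj.trans_le hi)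
  have hwi : ∀ i ≤ n, w i ≤ i := fun i hi =>
    backwardSum_le hα₀.le fun j hj => hD j (hj.trans_le hi)
  -- all points of the orbit are in the range of the local estimates
  have hlt : ∀ i < n, u (i + 1) < 1 / M := by
    intro i hi
    obtain ⟨h1, h2⟩ := abs_lt.1 (hu i hi)
    have h3 := (abs_le.1 (ht i hi)).2
    rw [hstep i hi]
    rcases le_total 0 (u i) with h0 | h0
    · have h5 := h.right.drift_le h0 (by linarith)
      have : M * u i ≤ M * r := by gcongr
      linarith
    · have := h.map_le_of_nonpos hM0 h0 (by linarith)
      linarith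
  -- Within the region of drift at least `2 ε`, a step gives `w (i+1) * Q (u (i+1)) ≤ w i * Q (u i)
  -- + Q (u i)`, and the last term is bounded by the increment of `A * u ^ s`. On each entry to the
  -- region the induction hypothesis is dropped and replaced by `w ≤ i + 1` and `Q ≤ A ε^α`.
  have key : ∀ i ≤ n, 0 < u i → 2 * ε ≤ G (u i) - u i →
      w i * Q (u i) ≤ A * (i * ε ^ α) + A * u i ^ s := by
    intro i
    induction i with
    | zero =>
      intro _ h0 _
      have : w 0 = 0 := rfl
      rw [this]
      simp only [zero_mul, Nat.cast_zero, mul_zero, zero_add]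
      positivity
    | succ i ih =>
      intro hi h0 hbig
      have hi' : i < n := hi
      have hui := abs_lt.1 (hu i hi')
      have hti := abs_le.1 (ht i hi')
      have hv := hlt i hi'
      have hQv := hQ0 _ h0 hv hbig
      have hD1 := hD i hi'
      have hwi0 := hw0 i hi'.le
      by_cases hb : 0 < u i ∧ 2 * ε ≤ G (u i) - u i
      · have h1 := ih hi'.le hb.1 hb.2
        have hv' : u i + (G (u i) - u i) + t i = u (i + 1) := by rw [hstep i hi']; ring
        obtain ⟨-, h3, h4⟩ := hQ1 (u i) (t i) hb.1 hb.2 (ht i hi') (by rw [hv']; exact hv)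
        rw [hv'] at h3 h4
        have h5 : D (u i) ^ (-α) * Q (u (i + 1)) ≤ Q (u i) := by
          calc D (u i) ^ (-α) * Q (u (i + 1)) ≤ D (u i) ^ (-α) * (D (u i) ^ α * Q (u i)) := by
                gcongr
            _ = Q (u i) := by
                rw [← mul_assoc, ← Real.rpow_add (by linarith)]
                simp
        have h6 : w (i + 1) * Q (u (i + 1)) = (w i + 1) * (D (u i) ^ (-α) * Q (u (i + 1))) := by
          rw [hw, backwardSum]; ring
        have h7 : (w i + 1) * (D (u i) ^ (-α) * Q (u (i + 1))) ≤ (w i + 1) * Q (u i) := by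
          gcongr
        have h8 : A * (i * ε ^ α) ≤ A * (((i + 1 : ℕ) : ℝ) * ε ^ α) := by
          gcongr
          exact Nat.le_succ i
        rw [h6]
        linarith
      -- An orbit enters the region either from `u i ≤ 0`, landing below `ε`, or from a point of
      -- drift below `2 ε`, advancing by at most `3 ε`. As `g` has slope at most `M - 1`, its drift
      -- on entry is `O(ε)`.
      · have hsmall : G (u (i + 1)) - u (i + 1) ≤ 5 * M * ε := by
          have hMε : ε ≤ M * ε := le_mul_of_one_le_left hε.le hM
          rcases le_or_gt (u i) 0 with h1 | h1
          · have h2 := h.map_le_of_nonpos hM0 h1 (by linarith)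
            have h3 := h.right.drift_le h0.le hv
            have h5 : u (i + 1) ≤ ε := by rw [hstep i hi']; linarith
            have h6 : (M - 1) * u (i + 1) ≤ (M - 1) * ε :=
              mul_le_mul_of_nonneg_left h5 (by linarith)
            linarith
          · have h2 : G (u i) - u i < 2 * ε := by
              by_contra h3
              exact hb ⟨h1, not_lt.1 h3⟩
            rcases le_total (u (i + 1)) (u i) with h3 | h3
            · have := h.right.mono hM0 h0.le h3 (by linarith)
              linarith
            · have h5 := h.right.increment_upper h1.le h3 hv
              have h6 : u (i + 1) - u i ≤ 3 * ε := by rw [hstep i hi']; linarith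
              have h7 : (M - 1) * (u (i + 1) - u i) ≤ (M - 1) * (3 * ε) :=
                mul_le_mul_of_nonneg_left h6 (by linarith)
              linarith
        have h1 := hQ2 _ h0 hv hbig hsmall
        calc w (i + 1) * Q (u (i + 1)) ≤ ((i + 1 : ℕ) : ℝ) * (A * ε ^ α) := by
              refine mul_le_mul (hwi _ hi) h1 hQv (by positivity)
          _ = A * (((i + 1 : ℕ) : ℝ) * ε ^ α) := by ring
          _ ≤ _ := by
              have : 0 ≤ A * u (i + 1) ^ s := by positivity
              linarith
  obtain ⟨k, rfl⟩ : ∃ k, n = k + 1 := Nat.exists_eq_succ_of_ne_zero hn.ne'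
  have hv := hlt k (Nat.lt_succ_self k)
  have hv0 : 0 < u (k + 1) := hr.trans_le hun
  have hbig : 2 * ε ≤ G (u (k + 1)) - u (k + 1) := by
    refine hε2.trans (le_trans ?_ (h.right.le_drift hα₀.le hM0 hv0 hv))
    gcongr
  have h1 := key (k + 1) le_rfl hv0 hbig
  have h2 := hQ3 _ hun hv hbig
  have h3 : u (k + 1) ^ s ≤ 1 :=
    Real.rpow_le_one hv0.le (hv.le.trans (by rw [div_le_one hM0]; exact hM)) hs0.le
  have h5 := hw0 (k + 1) le_rfl
  calc w (k + 1) ≤ w (k + 1) * (A * Q (u (k + 1))) := le_mul_of_one_le_right h5 h2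
    _ = A * (w (k + 1) * Q (u (k + 1))) := by ring
    _ ≤ A * (A * (((k + 1 : ℕ) : ℝ) * ε ^ α) + A * 1) := by
        refine mul_le_mul_of_nonneg_left (h1.trans ?_) hA.le
        gcongr
    _ = _ := by ring

/-- The backward sum along an orbit that escapes from a neutral fixed point. -/
theorem exists_escape_bound {α M r : ℝ} (hα₀ : 0 < α) (hα₁ : α < 1) (hM : 1 ≤ M)
    (hr : 0 < r) (hrM : r ≤ 1 / (4 * M ^ 2)) :
    ∃ A : ℝ, 0 < A ∧ ∃ ε₀ : ℝ, 0 < ε₀ ∧ ∀ G D : ℝ → ℝ, NeutralPoint α M G D →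
      ∀ ε : ℝ, 0 < ε → ε ≤ ε₀ → ∀ (u t : ℕ → ℝ) (n : ℕ), (∀ i < n, |u i| < r) → r ≤ |u n| →
        (∀ i < n, u (i + 1) = G (u i) + t i) → (∀ i < n, |t i| ≤ ε) → (∀ i < n, 1 ≤ D (u i)) →
        0 < n → backwardSum α (fun i => D (u i)) n ≤ A * (1 + n * ε ^ α) := by
  obtain ⟨A, hA, ε₀, hε₀, H⟩ := exists_escape_right_bound hα₀ hα₁ hM hr hrM
  refine ⟨A, hA, ε₀, hε₀, fun G D h ε hε hεε u t n hu hun hstep ht hD hn => ?_⟩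
  rcases le_abs.1 hun with h1 | h1
  · exact H G D h ε hε hεε u t n hu h1 hstep ht hD hn
  · have := H _ _ h.reflect ε hε hεε (fun i => -u i) (fun i => -t i) n
      (fun i hi => by simpa using hu i hi) h1
      (fun i hi => by simp only [hstep i hi, neg_neg]; ring) (fun i hi => by simpa using ht i hi)
      (fun i hi => by simpa using hD i hi) hn
    simpa using this

/-! ### Separation of two orbits under the same noise -/

theorem NeutralPoint.sub_le_map_sub {α M : ℝ} {G D : ℝ → ℝ} (h : NeutralPoint α M G D)
    (hM : 0 < M) {a b : ℝ} (ha : -(1 / M) < a) (hab : a ≤ b) (hb : b < 1 / M) :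
    b - a ≤ G b - G a := by
  have hpos : ∀ u v, 0 ≤ u → u ≤ v → v < 1 / M → v - u ≤ G v - G u := by
    intro u v hu huv hv
    have := h.right.mono hM hu huv hv
    linarith
  have hneg : ∀ u v, -(1 / M) < u → u ≤ v → v ≤ 0 → v - u ≤ G v - G u := by
    intro u v hu huv hv
    have := h.left.mono hM (neg_nonneg.2 hv) (neg_le_neg huv) (by linarith)
    rw [neg_neg, neg_neg] at this
    linarith
  rcases le_total 0 a with h0 | h0
  · exact hpos a b h0 hab hb
  · rcases le_total b 0 with h1 | h1
    · exact hneg a b ha hab h1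
    · have := hpos 0 b le_rfl h1 hb
      have := hneg a 0 ha h0 le_rfl
      linarith

/-- Wherever `[a, b]` lies, its first or its last quarter is at distance at least `(b - a) / 4` from
the neutral point, and there the slope exceeds `1` by at least `((b - a) / 4)^α / M`. -/
theorem NeutralPoint.add_rpow_le_map_sub {α M : ℝ} {G D : ℝ → ℝ} (h : NeutralPoint α M G D)
    (hα : 0 < α) (hM : 0 < M) {a b : ℝ} (ha : -(1 / M) < a) (hab : a < b) (hb : b < 1 / M) :
    (b - a) + (1 / 4) ^ (1 + α) / M * (b - a) ^ (1 + α) ≤ G b - G a := by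
  have hl : 0 < b - a := sub_pos.2 hab
  have hconst : (1 / 4 : ℝ) ^ (1 + α) / M * (b - a) ^ (1 + α) =
      ((b - a) / 4) ^ α / M * ((b - a) / 4) := by
    rw [div_eq_mul_one_div (b - a) 4, Real.mul_rpow hl.le (by norm_num), Real.rpow_add hl,
      Real.rpow_add (by norm_num : (0 : ℝ) < 1 / 4), Real.rpow_one, Real.rpow_one]
    ring
  rw [hconst]
  have h4 : 0 < (b - a) / 4 := by positivity
  rcases le_total ((b - a) / 2) b with h1 | h1
  · have h2 := h.right.increment_lower hα.le hM (u := b - (b - a) / 4) (v := b)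
      (by linarith) (by linarith) hb
    have h3 := h.sub_le_map_sub hM ha (b := b - (b - a) / 4) (by linarith) (by linarith)
    have h5 : ((b - a) / 4) ^ α ≤ (b - (b - a) / 4) ^ α :=
      Real.rpow_le_rpow h4.le (by linarith) hα.le
    have h6 : ((b - a) / 4) ^ α / M * ((b - a) / 4) ≤
        (b - (b - a) / 4) ^ α / M * (b - (b - (b - a) / 4)) := by
      rw [sub_sub_cancel]
      gcongr
    linarith
  · have h2 := h.left.increment_lower hα.le hM (u := -(a + (b - a) / 4)) (v := -a)
      (by linarith) (by linarith) (by linarith)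
    have h3 := h.sub_le_map_sub hM (a := a + (b - a) / 4) (by linarith) (by linarith) hb
    have h5 : ((b - a) / 4) ^ α ≤ (-(a + (b - a) / 4)) ^ α :=
      Real.rpow_le_rpow h4.le (by linarith) hα.le
    have h6 : ((b - a) / 4) ^ α / M * ((b - a) / 4) ≤
        (-(a + (b - a) / 4)) ^ α / M * (-a - -(a + (b - a) / 4)) := by
      rw [show -a - -(a + (b - a) / 4) = (b - a) / 4 by ring]
      gcongr
    simp only [neg_neg] at h2
    linarith

/-- A bounded sequence with `ℓᵢ₊₁ ≥ ℓᵢ + c ℓᵢ^{1+α}` starts at a point of order `k^{-1/α}`. -/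
theorem le_rpow_of_growth {α c : ℝ} (hα₀ : 0 < α) (hα₁ : α < 1) (hc : 0 < c) (hc1 : c ≤ 1)
    {l : ℕ → ℝ} {k : ℕ} (hk : 1 ≤ k) (hl : ∀ i ≤ k, 0 < l i ∧ l i ≤ 1)
    (hstep : ∀ i < k, l i + c * l i ^ (1 + α) ≤ l (i + 1)) :
    l 0 ≤ (4 / (α * c)) ^ (1 / α) * (k : ℝ) ^ (-(1 / α)) := by
  have hk0 : (0 : ℝ) < k := by exact_mod_cast hk
  -- The discrete form of `ℓ' = c ℓ^{1+α}`, for which `(ℓ^{-α})' = -α c`: each step lowers `ℓ^{-α}`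
  -- by at least `α c / 4`.
  have key : ∀ i ≤ k, (i : ℝ) * (α * c / 4) ≤ (l 0 ^ α)⁻¹ - (l i ^ α)⁻¹ := by
    intro i
    induction i with
    | zero => simp
    | succ i ih =>
      intro hi
      have h0 := ih (by omega)
      obtain ⟨hu, hu1⟩ := hl i (by omega)
      set u := l i with hu'
      set v := u + c * u ^ (1 + α) with hv
      have huα : 0 < u ^ α := by positivity
      have huα1 : u ^ α ≤ 1 := Real.rpow_le_one hu.le hu1 hα₀.le
      have h1α : u ^ (1 + α) = u * u ^ α := by rw [Real.rpow_add hu, Real.rpow_one]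
      have hcu : c * u ^ (1 + α) ≤ u := by
        rw [h1α]
        calc c * (u * u ^ α) ≤ 1 * (u * 1) := by gcongr
          _ = u := by ring
      have hcu0 : 0 < c * u ^ (1 + α) := by positivity
      have huv : u ≤ v := by linarith
      have hv2 : v ≤ 2 * u := by linarith
      have h1 := rpow_sub_rpow_ge hα₀ hα₁.le hu huv
      have h2 : (2 * u) ^ (α - 1) ≤ v ^ (α - 1) :=
        Real.rpow_le_rpow_of_nonpos (by linarith) hv2 (by linarith)
      have h3 : 1 / 2 * u ^ (α - 1) ≤ (2 * u) ^ (α - 1) := by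
        rw [Real.mul_rpow (by norm_num) hu.le]
        gcongr
        calc (1 / 2 : ℝ) = 2 ^ (-1 : ℝ) := by rw [Real.rpow_neg_one]; norm_num
          _ ≤ 2 ^ (α - 1) := Real.rpow_le_rpow_of_exponent_le (by norm_num) (by linarith)
      have h4 : α * c / 2 * (u ^ α * u ^ α) ≤ v ^ α - u ^ α := by
        refine le_trans ?_ h1
        have h5 : v - u = c * u ^ (1 + α) := by rw [hv]; ring
        calc α * c / 2 * (u ^ α * u ^ α) = α * (1 / 2 * u ^ (α - 1)) * (c * u ^ (1 + α)) := by
              rw [h1α, Real.rpow_sub_one hu.ne']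
              field_simp
          _ ≤ α * v ^ (α - 1) * (v - u) := by
              rw [h5]
              have := h3.trans h2
              gcongr
      have hvα : 0 < v ^ α := by positivity
      have hvα2 : v ^ α ≤ 2 * u ^ α := by
        calc v ^ α ≤ (2 * u) ^ α := Real.rpow_le_rpow (by linarith) hv2 hα₀.le
          _ = 2 ^ α * u ^ α := Real.mul_rpow (by norm_num) hu.le
          _ ≤ 2 * u ^ α := by
            gcongr
            calc (2 : ℝ) ^ α ≤ 2 ^ (1 : ℝ) :=
                  Real.rpow_le_rpow_of_exponent_le (by norm_num) hα₁.le
              _ = 2 := Real.rpow_one 2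
      have h5 : α * c / 4 ≤ (u ^ α)⁻¹ - (v ^ α)⁻¹ := by
        rw [inv_sub_inv huα.ne' hvα.ne', le_div_iff₀ (by positivity)]
        calc α * c / 4 * (u ^ α * v ^ α) ≤ α * c / 4 * (u ^ α * (2 * u ^ α)) := by gcongr
          _ = α * c / 2 * (u ^ α * u ^ α) := by ring
          _ ≤ _ := h4
      have h6 : (l (i + 1) ^ α)⁻¹ ≤ (v ^ α)⁻¹ := by
        have := hstep i (by omega)
        gcongr
      push_cast
      linarith
  have h1 := key k le_rfl
  obtain ⟨h0, -⟩ := hl 0 (Nat.zero_le k)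
  obtain ⟨hk', -⟩ := hl k le_rfl
  have h2 : 0 < (l k ^ α)⁻¹ := by positivity
  have h3 : l 0 ^ α ≤ 4 / (α * c) * (k : ℝ)⁻¹ := by
    have h4 : (k : ℝ) * (α * c / 4) ≤ (l 0 ^ α)⁻¹ := by linarith
    have h5 := inv_anti₀ (by positivity) h4
    rw [inv_inv] at h5
    refine h5.trans (le_of_eq ?_)
    field_simp
  calc l 0 = (l 0 ^ α) ^ (1 / α) := by
        rw [← Real.rpow_mul h0.le, mul_one_div_cancel hα₀.ne', Real.rpow_one]
    _ ≤ (4 / (α * c) * (k : ℝ)⁻¹) ^ (1 / α) :=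
        Real.rpow_le_rpow (by positivity) h3 (by positivity)
    _ = _ := by
        rw [Real.mul_rpow (by positivity) (by positivity), Real.inv_rpow hk0.le,
          Real.rpow_neg hk0.le]

/-- Two orbits under the same noise that stay near a neutral fixed point for a time `k` start at
a distance of order `k^{-1/α}`. -/
theorem NeutralPoint.sub_le_rpow {α M : ℝ} {G D : ℝ → ℝ} (h : NeutralPoint α M G D)
    (hα₀ : 0 < α) (hα₁ : α < 1) (hM : 2 ≤ M) {a b t : ℕ → ℝ} {k : ℕ} (hk : 1 ≤ k)
    (ha : ∀ i ≤ k, |a i| < 1 / M) (hb : ∀ i ≤ k, |b i| < 1 / M)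
    (ha' : ∀ i < k, a (i + 1) = G (a i) + t i) (hb' : ∀ i < k, b (i + 1) = G (b i) + t i) :
    b 0 - a 0 ≤ (4 / (α * ((1 / 4) ^ (1 + α) / M))) ^ (1 / α) * (k : ℝ) ^ (-(1 / α)) := by
  have hM0 : 0 < M := by linarith
  rcases le_or_gt (b 0) (a 0) with h0 | h0
  · exact (sub_nonpos.2 h0).trans (by positivity)
  have hM1 : 1 / M ≤ 1 / 2 := one_div_le_one_div_of_le (by norm_num) hM
  have hlt : ∀ i ≤ k, a i < b i := by
    intro i
    induction i with
    | zero => exact fun _ => h0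
    | succ i ih =>
      intro hi
      have := h.sub_le_map_sub hM0 (abs_lt.1 (ha i (by omega))).1 (ih (by omega)).le
        (abs_lt.1 (hb i (by omega))).2
      have := ih (by omega)
      rw [ha' i hi, hb' i hi]
      linarith
  refine le_rpow_of_growth hα₀ hα₁ (by positivity) ?_ (l := fun i => b i - a i) hk ?_ ?_
  · rw [div_le_one hM0]
    exact (Real.rpow_le_one (by norm_num) (by norm_num) (by linarith)).trans (by linarith)
  · intro i hi
    have h1 := abs_lt.1 (ha i hi)
    have h2 := abs_lt.1 (hb i hi)
    exact ⟨sub_pos.2 (hlt i hi), show b i - a i ≤ 1 by linarith⟩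
  · intro i hi
    have := h.add_rpow_le_map_sub hα₀ hM0 (abs_lt.1 (ha i hi.le)).1 (hlt i hi.le)
      (abs_lt.1 (hb i hi.le)).2
    simp only [ha' i hi, hb' i hi]
    linarith

end

/-! ### Local constants at the fixed points and uniform expansion elsewhere -/

section

/-- The expression of the lift `F` near `x`. -/
def localMap (F : ℝ → ℝ) (x u : ℝ) : ℝ := F (x + u) - F x

/-- The right derivative of `f` near `x`. -/
def localDeriv (f : Circ → Circ) (x u : ℝ) : ℝ := derivRight f ((x + u : ℝ) : Circ)

/-- This treats neutral and repelling sides alike: for `d = 1` the bound is the assumed asymptotics,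
and for `d > 1` the gap `d - 1` dominates `h^α` because `h < 1`. -/
theorem eventually_neutral_bounds {α d : ℝ} (hα : 0 < α) {D : ℝ → ℝ} (hd : 1 ≤ d)
    (hD : Tendsto D (𝓝[>] 0) (𝓝 d))
    (hD1 : d = 1 → ∃ A : ℝ, 0 < A ∧ Tendsto (fun h => (D h - 1) / |h| ^ α) (𝓝[>] 0) (𝓝 A)) :
    ∃ a : ℝ, 0 < a ∧ ∀ᶠ h in 𝓝[>] 0, a * h ^ α ≤ D h - 1 ∧ D h ≤ d + 1 := by
  have hup : ∀ᶠ h in 𝓝[>] 0, D h ≤ d + 1 :=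
    (hD.eventually (gt_mem_nhds (lt_add_one d))).mono fun _ h => h.le
  rcases hd.eq_or_lt with h1 | h1
  · obtain ⟨A, hA, hlim⟩ := hD1 h1.symm
    refine ⟨A / 2, by positivity, ?_⟩
    filter_upwards [hup, hlim.eventually (lt_mem_nhds (half_lt_self hA)), self_mem_nhdsWithin]
      with h h2 h3 h4
    have h5 : (0 : ℝ) < h := h4
    rw [abs_of_pos h5, lt_div_iff₀ (by positivity)] at h3
    exact ⟨h3.le, h2⟩
  · refine ⟨(d - 1) / 2, by linarith, ?_⟩
    filter_upwards [hup, hD.eventually (lt_mem_nhds (show (d + 1) / 2 < d by linarith)),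
      Ioo_mem_nhdsGT (zero_lt_one' ℝ)] with h h2 h3 h4
    have h5 : h ^ α ≤ 1 := Real.rpow_le_one h4.1.le h4.2.le hα.le
    refine ⟨?_, h2⟩
    have : (d - 1) / 2 * h ^ α ≤ (d - 1) / 2 * 1 := by
      have : 0 < (d - 1) / 2 := by linarith
      gcongr
    linarith

/-- The local estimates at a fixed point hold for all large constants. -/
theorem eventually_expandingSide {α a b c r : ℝ} {g D : ℝ → ℝ} (ha : 0 < a) (hr : 0 < r)
    (hzero : g 0 = 0) (hcont : Continuous g)
    (hderiv : ∀ u ∈ Ioo 0 r, HasDerivAt g (D u - 1) u)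
    (hbd : ∀ u ∈ Ioo 0 r, a * u ^ α ≤ D u - 1 ∧ D u ≤ b)
    (hhol : ∀ u ∈ Ioo 0 r, ∀ v ∈ Ioo 0 r, |D u - D v| ≤ c * |u - v| ^ α) :
    ∃ M₀ : ℝ, ∀ M, M₀ ≤ M → ExpandingSide α M g D := by
  refine ⟨max (max (1 / r) (1 / a)) (max b c), fun M hM => ?_⟩
  obtain ⟨h1, h2⟩ := max_le_iff.1 hM
  obtain ⟨hMr, hMa⟩ := max_le_iff.1 h1
  obtain ⟨hMb, hMc⟩ := max_le_iff.1 h2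
  have hM0 : 0 < M := lt_of_lt_of_le (by positivity) hMr
  have hMr' : 1 / M ≤ r := by
    rw [div_le_iff₀ hM0]
    rw [div_le_iff₀ hr] at hMr
    linarith
  have hMa' : 1 / M ≤ a := by
    rw [div_le_iff₀ hM0]
    rw [div_le_iff₀ ha] at hMa
    linarith
  have hsub : Ioo 0 (1 / M) ⊆ Ioo 0 r := Ioo_subset_Ioo_right hMr'
  refine ⟨hzero, hcont.continuousOn, fun u hu => hderiv u (hsub hu), fun u hu => ?_,
    fun u hu => (hbd u (hsub hu)).2.trans hMb, fun u hu v hv => ?_⟩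
  · refine le_trans ?_ (hbd u (hsub hu)).1
    rw [div_eq_mul_one_div, mul_comm]
    have := Real.rpow_nonneg hu.1.le α
    gcongr
  · refine (hhol u (hsub hu) v (hsub hv)).trans ?_
    gcongr

variable {α : ℝ} {f : Circ → Circ} {P : Finset Circ} {N : ℕ} {F : ℝ → ℝ}

theorem abs_derivRight_sub_le (hf : IsNeutralExpanding α f P N) (hF : IsCircLift F f) {C : ℝ}
    (hC : ∀ (x : Circ) (l : ℝ), 0 ≤ l → (∀ s ∈ Icc (0 : ℝ) l, x + (s : Circ) ∉ P) →
      |circDeriv f (x + (l : Circ)) - circDeriv f x| ≤ C * l ^ α)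
    {a b : ℝ} (hab : ∀ x ∈ Ioo a b, (x : Circ) ∉ P) {x y : ℝ} (hx : x ∈ Ioo a b)
    (hy : y ∈ Ioo a b) :
    |derivRight f (x : Circ) - derivRight f (y : Circ)| ≤ C * |x - y| ^ α := by
  wlog hxy : y ≤ x generalizing x y
  · rw [abs_sub_comm, abs_sub_comm x]
    exact this hy hx (not_le.1 hxy).le
  have h := hC (y : Circ) (x - y) (sub_nonneg.2 hxy) fun s hs => by
    rw [← AddCircle.coe_add]
    exact hab _ ⟨by linarith [hy.1, hs.1], by linarith [hx.2, hs.2]⟩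
  rw [← AddCircle.coe_add, add_sub_cancel, circDeriv_eq_derivRight hf hF (hab x hx),
    circDeriv_eq_derivRight hf hF (hab y hy)] at h
  rwa [abs_of_nonneg (sub_nonneg.2 hxy)]

theorem tendsto_neg_nhdsGT_zero : Tendsto (fun h : ℝ => -h) (𝓝[>] 0) (𝓝[<] 0) := by
  refine tendsto_nhdsWithin_iff.2 ⟨?_, ?_⟩
  · refine tendsto_nhdsWithin_of_tendsto_nhds ?_
    simpa using (continuous_neg (G := ℝ)).tendsto 0
  · filter_upwards [self_mem_nhdsWithin] with y hy
    simpa using hy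

theorem eventually_neutralPoint (hα : 0 < α) (hf : IsNeutralExpanding α f P N)
    (hF : IsCircLift F f) {x : ℝ} (hx : (x : Circ) ∈ fixedSet f P N) :
    ∃ M₀ : ℝ, ∀ M, M₀ ≤ M → NeutralPoint α M (localMap F x) (localDeriv f x) := by
  obtain ⟨C, hC⟩ := hf.holder
  -- the points near `x` do not belong to `P`
  obtain ⟨r, hr, hrP⟩ : ∃ r > 0, ∀ y, |y - x| < r → y ≠ x → (y : Circ) ∉ P := by
    have := eventually_coe_notMem P x
    rw [eventually_nhdsWithin_iff, Metric.eventually_nhds_iff] at this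
    obtain ⟨r, hr, h⟩ := this
    exact ⟨r, hr, fun y hy hyx => h hy hyx⟩
  have hevP : ∀ᶠ h : ℝ in 𝓝[>] 0, h < r :=
    (Ioo_mem_nhdsGT hr : Ioo 0 r ∈ 𝓝[>] (0 : ℝ)) |> fun h => mem_of_superset h fun y hy => hy.2
  have hPr : ∀ y ∈ Ioo x (x + r), (y : Circ) ∉ P := fun y hy =>
    hrP y (by rw [abs_lt]; constructor <;> linarith [hy.1, hy.2]) (ne_of_gt hy.1)
  have hPl : ∀ y ∈ Ioo (x - r) x, (y : Circ) ∉ P := fun y hy =>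
    hrP y (by rw [abs_lt]; constructor <;> linarith [hy.1, hy.2]) (ne_of_lt hy.2)
  -- the right side
  have hright : ∃ M₀ : ℝ, ∀ M, M₀ ≤ M →
      ExpandingSide α M (fun u => localMap F x u - u) (localDeriv f x) := by
    have heq : (fun h : ℝ => circDeriv f ((x : Circ) + (h : Circ))) =ᶠ[𝓝[>] 0] localDeriv f x := by
      filter_upwards [hevP, self_mem_nhdsWithin] with h h1 h2
      have h2' : (0 : ℝ) < h := h2
      rw [localDeriv, ← AddCircle.coe_add,
        circDeriv_eq_derivRight hf hF (hPr _ ⟨by linarith, by linarith⟩)]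
    obtain ⟨a, ha, hev⟩ := eventually_neutral_bounds (D := localDeriv f x) hα
      (hf.one_le_deriv x hx) ((hf.right_lim x).congr' heq) (fun h1 => by
        obtain ⟨A, hA, hlim⟩ := hf.neutral_right x hx h1
        refine ⟨A, hA, hlim.congr' ?_⟩
        filter_upwards [heq] with h hh
        rw [hh])
    obtain ⟨r', hr', hbd⟩ := mem_nhdsGT_iff_exists_Ioo_subset.1 hev
    have hr'0 : (0 : ℝ) < r' := hr'
    refine eventually_expandingSide (c := C) (r := min r r') ha (lt_min hr hr'0) (by simp [localMap]) ?_ ?_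
      (fun u hu => hbd ⟨hu.1, hu.2.trans_le (min_le_right _ _)⟩) ?_
    · have := hF.continuous
      unfold localMap
      fun_prop
    · intro u hu
      have hu2 := hu.2.trans_le (min_le_left _ _)
      have h1 := hasDerivAt_lift hf hF (hPr (x + u) ⟨by linarith [hu.1], by linarith⟩)
      exact ((h1.comp_const_add x u).sub_const (F x)).sub (hasDerivAt_id u)
    · intro u hu v hv
      have hu2 := hu.2.trans_le (min_le_left _ _)
      have hv2 := hv.2.trans_le (min_le_left _ _)
      have := abs_derivRight_sub_le hf hF hC hPr (x := x + u) (y := x + v)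
        ⟨by linarith [hu.1], by linarith⟩ ⟨by linarith [hv.1], by linarith⟩
      rwa [add_sub_add_left_eq_sub] at this
  have hleft : ∃ M₀ : ℝ, ∀ M, M₀ ≤ M →
      ExpandingSide α M (fun u => -localMap F x (-u) - u) (fun u => localDeriv f x (-u)) := by
    have heq : (fun h : ℝ => circDeriv f ((x : Circ) + ((-h : ℝ) : Circ))) =ᶠ[𝓝[>] 0]
        fun u => localDeriv f x (-u) := by
      filter_upwards [hevP, self_mem_nhdsWithin] with h h1 h2
      have h2' : (0 : ℝ) < h := h2
      rw [localDeriv, ← AddCircle.coe_add,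
        circDeriv_eq_derivRight hf hF (hPl _ ⟨by linarith, by linarith⟩)]
    have hd1 : 1 ≤ derivLeft f (x : Circ) := (hf.one_le_deriv x hx).trans (hf.deriv_jump x)
    obtain ⟨a, ha, hev⟩ := eventually_neutral_bounds (D := fun u => localDeriv f x (-u)) hα hd1
      (((hf.left_lim x).comp tendsto_neg_nhdsGT_zero).congr' heq) (fun h1 => by
        obtain ⟨A, hA, hlim⟩ := hf.neutral_left x hx h1
        refine ⟨A, hA, (hlim.comp tendsto_neg_nhdsGT_zero).congr' ?_⟩
        filter_upwards [heq] with h hh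
        simp only [Function.comp_apply, abs_neg, hh])
    obtain ⟨r', hr', hbd⟩ := mem_nhdsGT_iff_exists_Ioo_subset.1 hev
    have hr'0 : (0 : ℝ) < r' := hr'
    refine eventually_expandingSide (c := C) (r := min r r') ha (lt_min hr hr'0) (by simp [localMap]) ?_ ?_
      (fun u hu => hbd ⟨hu.1, hu.2.trans_le (min_le_right _ _)⟩) ?_
    · have := hF.continuous
      unfold localMap
      fun_prop
    · intro u hu
      have hu2 := hu.2.trans_le (min_le_left _ _)
      have h1 := hasDerivAt_lift hf hF (hPl (x + -u) ⟨by linarith, by linarith [hu.1]⟩)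
      have h2 := ((h1.comp_const_add x (-u)).sub_const (F x)).scomp u (hasDerivAt_neg u)
      have h3 := (h2.neg).sub (hasDerivAt_id u)
      refine h3.congr_deriv ?_
      simp [localDeriv]
    · intro u hu v hv
      have hu2 := hu.2.trans_le (min_le_left _ _)
      have hv2 := hv.2.trans_le (min_le_left _ _)
      have := abs_derivRight_sub_le hf hF hC hPl (x := x + -u) (y := x + -v)
        ⟨by linarith, by linarith [hu.1]⟩ ⟨by linarith, by linarith [hv.1]⟩
      rwa [add_sub_add_left_eq_sub, neg_sub_neg, abs_sub_comm v u] at this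
  obtain ⟨M₁, h1⟩ := hright
  obtain ⟨M₂, h2⟩ := hleft
  exact ⟨max M₁ M₂, fun M hM => ⟨h1 M ((le_max_left _ _).trans hM),
    h2 M ((le_max_right _ _).trans hM)⟩⟩

theorem finite_fixedSet (f : Circ → Circ) (P : Finset Circ) (N : ℕ) : (fixedSet f P N).Finite :=
  P.finite_toSet.image _

/-- A representative in `ℝ` of a point of the circle. -/
def rep (p : Circ) : ℝ := (AddCircle.equivIoc (1 : ℝ) (-(1 / 2)) p : ℝ)

theorem coe_rep (p : Circ) : (rep p : Circ) = p := AddCircle.coe_equivIoc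

theorem eventually_forall_neutralPoint (hα : 0 < α) (hf : IsNeutralExpanding α f P N)
    (hF : IsCircLift F f) : ∀ᶠ M in atTop, ∀ p ∈ fixedSet f P N,
      NeutralPoint α M (localMap F (rep p)) (localDeriv f (rep p)) := by
  refine (finite_fixedSet f P N).eventually_all.2 fun p hp => ?_
  obtain ⟨M₀, h⟩ := eventually_neutralPoint hα hf hF (x := rep p) (by rwa [coe_rep])
  filter_upwards [eventually_ge_atTop M₀] with M hM using h M hM

/-- The distance between distinct points of a finite set is bounded below. -/
theorem eventually_separated {S : Set Circ} (hS : S.Finite) :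
    ∀ᶠ M : ℝ in atTop, ∀ p ∈ S, ∀ q ∈ S, dist p q < 1 / M → p = q := by
  refine hS.eventually_all.2 fun p _ => hS.eventually_all.2 fun q _ => ?_
  by_cases hpq : p = q
  · exact Eventually.of_forall fun _ _ => hpq
  · have h := dist_pos.2 hpq
    filter_upwards [eventually_ge_atTop (1 / dist p q)] with M hM hlt
    have hM0 : 0 < M := lt_of_lt_of_le (by positivity) hM
    rw [div_le_iff₀ h] at hM
    rw [lt_div_iff₀ hM0] at hlt
    linarith

/-- Small balls about the points of a finite set are contained in a given neighbourhood of it. -/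
theorem eventually_ball_subset {S U : Set Circ} (hS : S.Finite) (hU : ∀ p ∈ S, U ∈ 𝓝 p) :
    ∀ᶠ M : ℝ in atTop, ∀ p ∈ S, Metric.ball p (1 / M) ⊆ U := by
  refine hS.eventually_all.2 fun p hp => ?_
  obtain ⟨r, hr, h⟩ := Metric.mem_nhds_iff.1 (hU p hp)
  filter_upwards [eventually_ge_atTop (1 / r)] with M hM
  have hM0 : 0 < M := lt_of_lt_of_le (by positivity) hM
  refine (Metric.ball_subset_ball ?_).trans h
  rw [div_le_iff₀ hM0]
  rw [div_le_iff₀ hr] at hM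
  linarith

/-- Away from the neutral fixed points, the map is uniformly expanding. -/
theorem exists_uniform_expansion (hf : IsNeutralExpanding α f P N) {r : ℝ} (hr : 0 < r) :
    ∃ lam : ℝ, 1 < lam ∧ ∀ x, (∀ p ∈ fixedSet f P N, r ≤ dist x p) → lam ≤ derivRight f x := by
  obtain ⟨F, hF⟩ := hf.exists_lift
  have hK : IsCompact {x : Circ | ∀ p ∈ fixedSet f P N, r ≤ dist x p} := by
    refine IsClosed.isCompact ?_
    have : {x : Circ | ∀ p ∈ fixedSet f P N, r ≤ dist x p} =
        ⋂ p ∈ fixedSet f P N, {x | r ≤ dist x p} := by ext; simp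
    rw [this]
    exact isClosed_biInter fun p _ => isClosed_le continuous_const (by fun_prop)
  -- `derivRight f` need not be continuous. A local lower bound comes from the value and both
  -- one-sided limits at the point, and compactness patches these bounds together.
  refine hK.induction_on (p := fun S => ∃ lam : ℝ, 1 < lam ∧ ∀ x ∈ S, lam ≤ derivRight f x)
    ⟨2, by norm_num, fun x hx => hx.elim⟩ ?_ ?_ ?_
  · rintro S T hST ⟨l, hl, h⟩
    exact ⟨l, hl, fun x hx => h x (hST hx)⟩
  · rintro S T ⟨l, hl, h⟩ ⟨l', hl', h'⟩
    refine ⟨min l l', lt_min hl hl', fun x hx => ?_⟩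
    rcases hx with hx | hx
    · exact (min_le_left _ _).trans (h x hx)
    · exact (min_le_right _ _).trans (h' x hx)
  · intro x hx
    obtain ⟨x, rfl⟩ : ∃ y : ℝ, (y : Circ) = x := ⟨rep x, coe_rep x⟩
    have hxP : (x : Circ) ∉ fixedSet f P N := fun h => by
      have := hx _ h
      rw [dist_self] at this
      linarith
    have h1 := hf.one_lt_deriv _ hxP
    have h2 := h1.trans_le (hf.deriv_jump x)
    set l : ℝ := (1 + derivRight f (x : Circ)) / 2 with hl
    have hl1 : 1 < l := by rw [hl]; linarith
    have hlR : l < derivRight f (x : Circ) := by rw [hl]; linarith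
    have hlL : l < derivLeft f (x : Circ) := hlR.trans_le (hf.deriv_jump x)
    have hne : ∀ᶠ y in 𝓝[≠] x, deriv F y = derivRight f (y : Circ) := by
      filter_upwards [eventually_coe_notMem P x] with y hy
      exact (hasDerivAt_lift hf hF hy).deriv
    have hev : ∀ᶠ y : ℝ in 𝓝 x, l ≤ derivRight f (y : Circ) := by
      rw [← nhdsNE_sup_pure, eventually_sup, ← nhdsLT_sup_nhdsGT, eventually_sup, eventually_pure]
      refine ⟨⟨?_, ?_⟩, hlR.le⟩
      · filter_upwards [(tendsto_deriv_left hf hF x).eventually (lt_mem_nhds hlL),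
          hne.filter_mono (nhdsWithin_mono x fun y (hy : y < x) => (ne_of_lt hy : y ≠ x))]
          with y h3 h4
        rw [← h4]; exact h3.le
      · filter_upwards [(tendsto_deriv_right hf hF x).eventually (lt_mem_nhds hlR),
          hne.filter_mono (nhdsWithin_mono x fun y (hy : x < y) => (ne_of_gt hy : y ≠ x))]
          with y h3 h4
        rw [← h4]; exact h3.le
    refine ⟨(fun y : ℝ => (y : Circ)) '' {y | l ≤ derivRight f (y : Circ)}, ?_, l, hl1, ?_⟩
    · exact nhdsWithin_le_nhds ((QuotientAddGroup.isOpenMap_coe).image_mem_nhds hev)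
    · rintro _ ⟨y, hy, rfl⟩
      exact hy

/-- At a fixed point `F (rep p)` differs from `rep p` by an integer, so in the coordinate `u` the
perturbed map is `u ↦ localMap F (rep p) u + s` for all real `u`, not only for small ones. -/
theorem localMap_coe (hf : IsNeutralExpanding α f P N) (hF : IsCircLift F f) {p : Circ}
    (hp : p ∈ fixedSet f P N) (u s : ℝ) :
    f ((rep p + u : ℝ) : Circ) + (s : Circ) = ((rep p + (localMap F (rep p) u + s) : ℝ) : Circ) := by
  have h1 : ((F (rep p) : ℝ) : Circ) = (rep p : Circ) := by
    rw [← hF.coe, coe_rep, hf.fixed p hp]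
  obtain ⟨n, hn⟩ := coe_eq_coe_iff.1 h1
  rw [hF.coe, ← AddCircle.coe_add, localMap]
  refine coe_eq_coe_iff.2 ⟨n, ?_⟩
  linarith

theorem NeutralPoint.abs_map_le {α M : ℝ} {G D : ℝ → ℝ} (h : NeutralPoint α M G D) (hM : 0 < M)
    {u : ℝ} (hu : |u| < 1 / M) : |G u| ≤ M * |u| := by
  have key : ∀ {G D : ℝ → ℝ}, NeutralPoint α M G D → ∀ u, 0 ≤ u → u < 1 / M →
      |G u| ≤ M * |u| := by
    intro G D h u h0 h1
    have h2 := h.right.drift_le h0 h1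
    have h3 := h.right.mono hM le_rfl h0 h1
    rw [h.right.zero] at h3
    rw [abs_of_nonneg h0, abs_of_nonneg (by linarith)]
    linarith
  obtain ⟨h1, h2⟩ := abs_lt.1 hu
  rcases le_total 0 u with h0 | h0
  · exact key h u h0 h2
  · have := key h.reflect (-u) (by linarith) (by linarith)
    simpa using this

end

/-! ### Distortion along random orbits -/

section

variable {α : ℝ} {f : Circ → Circ} {P : Finset Circ} {N : ℕ} {F : ℝ → ℝ}

/-- `M` is a constant for which the local estimates hold at all neutral fixed points. -/
structure GoodConstant (α : ℝ) (f : Circ → Circ) (P : Finset Circ) (N : ℕ) (F : ℝ → ℝ) (M : ℝ) :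
    Prop where
  two_le : 2 ≤ M
  neutral : ∀ p ∈ fixedSet f P N, NeutralPoint α M (localMap F (rep p)) (localDeriv f (rep p))
  separated : ∀ p ∈ fixedSet f P N, ∀ q ∈ fixedSet f P N, dist p q < 1 / M → p = q

theorem eventually_goodConstant (hα : 0 < α) (hf : IsNeutralExpanding α f P N)
    (hF : IsCircLift F f) : ∀ᶠ M in atTop, GoodConstant α f P N F M := by
  filter_upwards [eventually_ge_atTop 2, eventually_forall_neutralPoint hα hf hF,
    eventually_separated (finite_fixedSet f P N)] with M h1 h2 h3 using ⟨h1, h2, h3⟩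

/-- The radius of the neighbourhoods of the neutral fixed points. -/
def nearRadius (M : ℝ) : ℝ := 1 / (4 * M ^ 2)

/-- The union of small balls about the neutral fixed points. -/
def nearSet (f : Circ → Circ) (P : Finset Circ) (N : ℕ) (M : ℝ) : Set Circ :=
  {x | ∃ p ∈ fixedSet f P N, dist x p < nearRadius M}

theorem nearRadius_pos {M : ℝ} (hM : 2 ≤ M) : 0 < nearRadius M := by
  have : 0 < M := by linarith
  unfold nearRadius; positivity

theorem mul_nearRadius {M : ℝ} (hM : 2 ≤ M) : M * nearRadius M = 1 / (4 * M) := by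
  have : 0 < M := by linarith
  unfold nearRadius; field_simp

theorem dist_coe_rep_add (p : Circ) {u : ℝ} (hu : |u| ≤ 1 / 2) :
    dist ((rep p + u : ℝ) : Circ) p = |u| := by
  conv_lhs => rw [← coe_rep p]
  rw [coe_rep, ← norm_coe_of_abs_le hu, ← dist_coe_add (rep p) u, coe_rep]

theorem chain_localMap_coe (hf : IsNeutralExpanding α f P N) (hF : IsCircLift F f) {p : Circ}
    (hp : p ∈ fixedSet f P N) (t : ℕ → ℝ) (u : ℝ) (i : ℕ) :
    randIter f t i ((rep p + u : ℝ) : Circ) =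
      ((rep p + chain (fun v s => localMap F (rep p) v + s) u t i : ℝ) : Circ) := by
  induction i with
  | zero => rfl
  | succ i ih =>
    change f (randIter f t i _) + (t i : Circ) = _
    rw [ih, localMap_coe hf hF hp]
    rfl

/-- An orbit that stays near the neutral fixed points stays near one of them. -/
theorem GoodConstant.exists_coordinates {M : ℝ} (hM : GoodConstant α f P N F M)
    (hf : IsNeutralExpanding α f P N) (hF : IsCircLift F f) {ε : ℝ} (hε : ε ≤ 1 / (4 * M))
    {t : ℕ → ℝ} {x : Circ} {n : ℕ} (ht : ∀ i < n, |t i| ≤ ε) (hn : 0 < n)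
    (hx : ∀ i < n, randIter f t i x ∈ nearSet f P N M) :
    ∃ p ∈ fixedSet f P N, ∃ u : ℝ, x = ((rep p + u : ℝ) : Circ) ∧
      (∀ i < n, |chain (fun v s => localMap F (rep p) v + s) u t i| < nearRadius M) ∧
      dist (randIter f t n x) p = |chain (fun v s => localMap F (rep p) v + s) u t n| := by
  have hM2 := hM.two_le
  have hM0 : 0 < M := by linarith
  obtain ⟨p, hp, hxp⟩ := hx 0 hn
  change dist x p < _ at hxp
  obtain ⟨u, hu, rfl⟩ := exists_lift_near (rep p) x
  rw [coe_rep] at hu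
  refine ⟨p, hp, u, rfl, ?_⟩
  set v := chain (fun v s => localMap F (rep p) v + s) u t with hv
  have hr := nearRadius_pos hM2
  have hMr := mul_nearRadius hM2
  have h4M : 1 / (4 * M) = 1 / M / 4 := by field_simp
  have hM1 : 0 < 1 / M := by positivity
  have hM12 : 1 / M ≤ 1 / 2 := one_div_le_one_div_of_le (by norm_num) hM2
  have hr1 : nearRadius M ≤ 1 / (4 * M) := by
    rw [← hMr]; exact le_mul_of_one_le_left hr.le (by linarith)
  -- The expansion takes the radius `1 / (4 M²)` to at most `1 / (4 M)` and the noise adds at most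
  -- `1 / (4 M)`. The next point is then too close to `p` to lie in the small ball about another
  -- fixed point.
  have hnext : ∀ i < n, |v i| < nearRadius M → |v (i + 1)| ≤ 1 / M / 2 := by
    intro i hi h1
    have h2 := (hM.neutral p hp).abs_map_le hM0 (u := v i) (by linarith)
    have h3 : M * |v i| ≤ M * nearRadius M := by gcongr
    calc |v (i + 1)| = |localMap F (rep p) (v i) + t i| := rfl
      _ ≤ |localMap F (rep p) (v i)| + |t i| := abs_add_le _ _
      _ ≤ _ := by linarith [ht i hi]
  have hsmall : ∀ i < n, |v i| < nearRadius M := by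
    intro i
    induction i with
    | zero => intro _; change |u| < _; rwa [hu]
    | succ i ih =>
      intro hi
      have h1 := hnext i (by omega) (ih (by omega))
      obtain ⟨q, hq, hxq⟩ := hx (i + 1) hi
      rw [chain_localMap_coe hf hF hp] at hxq
      change dist ((rep p + v (i + 1) : ℝ) : Circ) q < _ at hxq
      have h2 := dist_coe_rep_add p (u := v (i + 1)) (by linarith)
      have h3 : dist p q < 1 / M := by
        have := dist_triangle_left p q ((rep p + v (i + 1) : ℝ) : Circ)
        linarith
      obtain rfl := hM.separated p hp q hq h3
      rwa [h2] at hxq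
  refine ⟨hsmall, ?_⟩
  obtain ⟨k, rfl⟩ : ∃ k, n = k + 1 := Nat.exists_eq_succ_of_ne_zero hn.ne'
  have h1 := hnext k (Nat.lt_succ_self k) (hsmall k (Nat.lt_succ_self k))
  rw [chain_localMap_coe hf hF hp]
  exact dist_coe_rep_add p (by linarith)

/-- The backward sum along a passage near the neutral fixed points. -/
theorem GoodConstant.exists_passage_bound {M : ℝ} (hM : GoodConstant α f P N F M) (hα₀ : 0 < α)
    (hα₁ : α < 1) (hf : IsNeutralExpanding α f P N) (hF : IsCircLift F f) :
    ∃ A : ℝ, 0 < A ∧ ∃ ε₀ : ℝ, 0 < ε₀ ∧ ∀ ε : ℝ, 0 < ε → ε ≤ ε₀ → ∀ t : ℕ → ℝ,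
      (∀ i, |t i| ≤ ε) → ∀ (x : Circ) (n : ℕ), 0 < n →
        (∀ i < n, randIter f t i x ∈ nearSet f P N M) → randIter f t n x ∉ nearSet f P N M →
        backwardSum α (fun i => derivRight f (randIter f t i x)) n ≤ A * (1 + n * ε ^ α) := by
  have hM2 := hM.two_le
  have hM0 : 0 < M := by linarith
  obtain ⟨A, hA, ε₀, hε₀, H⟩ := exists_escape_bound (M := M) hα₀ hα₁ (by linarith)
    (nearRadius_pos hM2) le_rfl
  refine ⟨A, hA, min ε₀ (1 / (4 * M)), by positivity, ?_⟩
  intro ε hε hεε t ht x n hn hx hxn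
  obtain ⟨p, hp, u, rfl, hu, hun⟩ := hM.exists_coordinates hf hF (hεε.trans (min_le_right _ _))
    (fun i _ => ht i) hn hx
  have h1 := H _ _ (hM.neutral p hp) ε hε (hεε.trans (min_le_left _ _))
    (chain (fun v s => localMap F (rep p) v + s) u t) t n hu
    (by
      rw [← hun]
      exact not_lt.1 fun h => hxn ⟨p, hp, h⟩)
    (fun i _ => rfl) (fun i _ => ht i) (fun i _ => one_le_derivRight hf _) hn
  simp only [chain_localMap_coe hf hF hp]
  exact h1

/-- The terms collected up to time `b` are only multiplied by factors at most `1` afterwards. -/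
theorem backwardSum_add_le {α : ℝ} (hα : 0 ≤ α) {d : ℕ → ℝ} (hd : ∀ i, 1 ≤ d i) (b n : ℕ) :
    backwardSum α d (b + n) ≤ backwardSum α d b + backwardSum α (fun i => d (b + i)) n := by
  induction n with
  | zero => simp [backwardSum]
  | succ n ih =>
    have h1 := rpow_neg_le_one hα (hd (b + n))
    have h2 : 0 ≤ d (b + n) ^ (-α) := Real.rpow_nonneg (zero_le_one.trans (hd _)) _
    have h3 := backwardSum_nonneg (α := α) (d := d) (n := b) fun i _ => hd i
    rw [← Nat.add_assoc, backwardSum, backwardSum]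
    have h4 : (backwardSum α d (b + n) + 1) * d (b + n) ^ (-α) ≤
        (backwardSum α d b + (backwardSum α (fun i => d (b + i)) n + 1)) * d (b + n) ^ (-α) :=
      mul_le_mul_of_nonneg_right (by linarith) h2
    have h5 : backwardSum α d b * d (b + n) ^ (-α) ≤ backwardSum α d b * 1 := by gcongr
    rw [add_mul] at h4
    linarith

/-- The backward sums of an orbit which is uniformly expanded outside `V` and which passes
through `V` with controlled backward sums are controlled by the weights. -/
theorem backwardSum_le_weight {α A μ δ : ℝ} (hα : 0 < α) (hA : 0 < A) (hμ : 1 < μ)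
    (hδ : 0 ≤ δ) {d z : ℕ → ℝ} {inV inI : ℕ → Prop} (hd : ∀ i, 1 ≤ d i)
    (hdV : ∀ i, ¬ inV i → d i ^ (-α) ≤ 1 / μ)
    (hrun : ∀ b n, 0 < n → (∀ i < n, inV (b + i)) → ¬ inV (b + n) →
      backwardSum α (fun i => d (b + i)) n ≤ A * (1 + n * δ))
    (hz0 : 0 ≤ z 0) (hzI : ∀ i, inI i → z (i + 1) = z i + δ)
    (hzI' : ∀ i, ¬ inI i → z (i + 1) = z i / μ) (n : ℕ) (hVI : ∀ i < n, inV i → inI i)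
    (hn : ¬ inV n) :
    backwardSum α d n ≤ (A * μ + 1) / (μ - 1) + A * z n := by
  -- `C` is the fixed point of `C ↦ (C + 1) / μ + A`: one expanding step followed by the constant
  -- part of one passage.
  set C : ℝ := (A * μ + 1) / (μ - 1) with hC
  have hμ0 : 0 < μ := by linarith
  have hμ1 : 0 < μ - 1 := by linarith
  have hC0 : 0 < C := by positivity
  have hCμ : (C + 1) / μ + A = C := by rw [hC]; field_simp; ring
  have hzpos : ∀ i, 0 ≤ z i := by
    intro i
    induction i with
    | zero => exact hz0
    | succ i ih =>
      by_cases h : inI i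
      · rw [hzI i h]; linarith
      · rw [hzI' i h]; positivity
  have hstep : ∀ m, ¬ inV m → backwardSum α d m ≤ C + A * z m →
      backwardSum α d (m + 1) ≤ (C + 1) / μ + A * z (m + 1) := by
    intro m hm h
    have h0 := backwardSum_nonneg (α := α) (d := d) (n := m) fun i _ => hd i
    have h1 : A * z m / μ ≤ A * z (m + 1) := by
      by_cases hI : inI m
      · rw [hzI m hI]
        have h2 : A * z m / μ ≤ A * z m := div_le_self (mul_nonneg hA.le (hzpos m)) hμ.le
        nlinarith
      · rw [hzI' m hI, mul_div_assoc]
    calc backwardSum α d (m + 1) = (backwardSum α d m + 1) * d m ^ (-α) := rfl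
      _ ≤ (C + A * z m + 1) * (1 / μ) := by
          have := Real.rpow_nonneg (zero_le_one.trans (hd m)) (-α)
          have := hdV m hm
          have := hzpos m
          gcongr
      _ = (C + 1) / μ + A * z m / μ := by ring
      _ ≤ _ := by linarith
  induction n using Nat.strong_induction_on with
  | _ n ih =>
    rcases Nat.eq_zero_or_pos n with rfl | hn0
    · have := mul_nonneg hA.le (hzpos 0)
      simp only [backwardSum]
      linarith
    obtain ⟨m, rfl⟩ : ∃ m, n = m + 1 := Nat.exists_eq_succ_of_ne_zero hn0.ne'
    -- the start of the passage that ends at time `m + 1`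
    obtain ⟨b, l, hbl, hl, hb⟩ : ∃ b l, b + l = m + 1 ∧ (∀ i < l, inV (b + i)) ∧
        (b = 0 ∨ ∃ k, b = k + 1 ∧ ¬ inV k) := by
      have : ∀ j, ∃ b l, b + l = j ∧ (∀ i < l, inV (b + i)) ∧
          (b = 0 ∨ ∃ k, b = k + 1 ∧ ¬ inV k) := by
        intro j
        induction j with
        | zero => exact ⟨0, 0, rfl, fun i hi => absurd hi (Nat.not_lt_zero i), Or.inl rfl⟩
        | succ j ih =>
          by_cases hj : inV j
          · obtain ⟨b, l, h1, h2, h3⟩ := ih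
            refine ⟨b, l + 1, by omega, fun i hi => ?_, h3⟩
            rcases Nat.lt_succ_iff_lt_or_eq.1 hi with h | rfl
            · exact h2 i h
            · rwa [h1]
          · exact ⟨j + 1, 0, rfl, fun i hi => absurd hi (Nat.not_lt_zero i), Or.inr ⟨j, rfl, hj⟩⟩
      exact this _
    have hzl : ∀ i ≤ l, z (b + i) = z b + i * δ := by
      intro i
      induction i with
      | zero => simp
      | succ i ih' =>
        intro hi
        rw [← Nat.add_assoc, hzI _ (hVI _ (by omega) (hl i hi)), ih' (by omega)]
        push_cast
        ring
    have hb' : backwardSum α d b ≤ (C + 1) / μ + A * z b := by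
      rcases hb with rfl | ⟨k, rfl, hk⟩
      · simp only [backwardSum]
        have := mul_nonneg hA.le hz0
        positivity
      · exact hstep k hk (ih k (by omega) (fun i hi => hVI i (by omega)) hk)
    rcases Nat.eq_zero_or_pos l with rfl | hl0
    · rw [Nat.add_zero] at hbl
      subst hbl
      linarith
    · have h1 := backwardSum_add_le hα.le hd b l
      have h2 := hrun b l hl0 hl (by rwa [hbl])
      have h3 := hzl l le_rfl
      rw [hbl] at h1 h3
      rw [h3]
      linarith

theorem orbitSum_eq_backwardSum (hf : IsNeutralExpanding α f P N) (t : ℕ → ℝ) (n : ℕ) (y : Circ) :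
    orbitSum α f t n y = backwardSum α (fun i => derivRight f (randIter f t i y)) n := by
  induction n with
  | zero => rw [orbitSum_zero]; rfl
  | succ n ih => rw [orbitSum_succ hf, ih]; rfl

/-- A connected set that misses the ends of an arc and meets the arc is contained in it. -/
theorem subset_arc {S : Set Circ} (hS : IsPreconnected S) {a b x : ℝ} (hax : a < x) (hxb : x < b)
    (hab : b ≤ a + 1) (ha : (a : Circ) ∉ S) (hb : (b : Circ) ∉ S) (hx : (x : Circ) ∈ S) :
    S ⊆ (fun y : ℝ => (y : Circ)) '' Ioo a b := by
  have hopen : IsOpenMap (fun y : ℝ => (y : Circ)) := QuotientAddGroup.isOpenMap_coe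
  refine hS.subset_left_of_subset_union (hopen _ isOpen_Ioo)
    (hopen (Ioo b (a + 1)) isOpen_Ioo) ?_ ?_ ⟨x, hx, x, ⟨hax, hxb⟩, rfl⟩
  · rw [Set.disjoint_left]
    rintro _ ⟨y, hy, rfl⟩ ⟨z, hz, hzy⟩
    have := eq_of_coe_eq_of_abs_lt (x := z) (y := y) hzy
      (by rw [abs_lt]; constructor <;> linarith [hy.1, hy.2, hz.1, hz.2])
    linarith [hy.2, hz.1]
  · intro y hy
    obtain ⟨v, hv, rfl⟩ : ∃ v ∈ Ico a (a + 1), (v : Circ) = y := by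
      have : y ∈ ((↑) : ℝ → AddCircle (1 : ℝ)) '' Ico a (a + 1) := by
        rw [AddCircle.coe_image_Ico_eq]; trivial
      exact this
    have h1 : v ≠ a := fun h => ha (h ▸ hy)
    have h2 : v ≠ b := fun h => hb (h ▸ hy)
    rcases lt_or_gt_of_ne h2 with h3 | h3
    · exact Or.inl ⟨v, ⟨lt_of_le_of_ne hv.1 h1.symm, h3⟩, rfl⟩
    · exact Or.inr ⟨v, ⟨h3, hv.2⟩, rfl⟩

/-- The orbits of the points of a pullback stay close to each other. -/
theorem dist_lt_of_mem_pullback (hf : IsNeutralExpanding α f P N) {τ : ℝ} (hτ0 : 0 < τ)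
    (hτ : τ < 1 / 2) {n : ℕ} {x y : Circ} {t : ℕ → ℝ} (hy : y ∈ pullback f τ n x t) {j : ℕ}
    (hj : j ≤ n) : dist (randIter f t j y) (randIter f t j x) < τ := by
  obtain ⟨F, hF⟩ := hf.exists_lift
  obtain ⟨x, rfl⟩ : ∃ v : ℝ, (v : Circ) = x := ⟨rep x, coe_rep x⟩
  set G := liftIter F t n with hG
  have hGc : Continuous G := continuous_liftIter hF t n
  have hGm : StrictMono G := strictMono_liftIter hF t n
  have hexp : ∀ a b, a ≤ b → b - a ≤ G b - G a := fun a b hab =>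
    (sub_liftIter_mono hf hF t hab) (Nat.zero_le n)
  -- Since `G` is expanding, the points mapped to `G x - τ` and `G x + τ` lie within `τ` of `x`.
  -- They project outside the pullback, which is therefore confined to the arc between them, of
  -- length at most `2 τ < 1`.
  obtain ⟨a, ha, hGa⟩ : ∃ a ∈ Icc (x - τ) x, G a = G x - τ := by
    have h1 := hexp (x - τ) x (by linarith)
    exact intermediate_value_Icc (by linarith) hGc.continuousOn ⟨by linarith, by linarith⟩
  obtain ⟨b, hb, hGb⟩ : ∃ b ∈ Icc x (x + τ), G b = G x + τ := by
    have h1 := hexp x (x + τ) (by linarith)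
    exact intermediate_value_Icc (by linarith) hGc.continuousOn ⟨by linarith, by linarith⟩
  have hax : a < x := hGm.lt_iff_lt.1 (by linarith)
  have hxb : x < b := hGm.lt_iff_lt.1 (by linarith)
  have hsub : pullback f τ n x t ⊆ randIter f t n ⁻¹' Metric.ball (randIter f t n (x : Circ)) τ :=
    connectedComponentIn_subset _ _
  have hxmem : (x : Circ) ∈ pullback f τ n x t :=
    mem_connectedComponentIn (by simpa using hτ0)
  have hend : ∀ c : ℝ, |G c - G x| = τ → (c : Circ) ∉ pullback f τ n x t := by
    intro c hc hmem
    have h1 := hsub hmem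
    rw [mem_preimage, Metric.mem_ball, randIter_coe hF, randIter_coe hF, dist_eq_norm,
      ← AddCircle.coe_sub, norm_coe_of_abs_le (by change |G c - G x| ≤ _; linarith)] at h1
    exact absurd hc h1.ne
  obtain ⟨v, hv, rfl⟩ := subset_arc isPreconnected_connectedComponentIn hax hxb
    (by linarith [ha.1, hb.2]) (hend a (by rw [hGa]; simp [abs_of_pos hτ0]))
    (hend b (by rw [hGb]; simp [abs_of_pos hτ0])) hxmem hy
  have hGv1 : G x - τ < G v := hGa ▸ hGm hv.1
  have hGv2 : G v < G x + τ := hGb ▸ hGm hv.2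
  change dist (randIter f t j (v : Circ)) _ < τ
  rw [randIter_coe hF, randIter_coe hF, dist_eq_norm, ← AddCircle.coe_sub]
  refine (norm_coe_le_abs _).trans_lt ?_
  rcases le_total x v with h | h
  · have h1 := sub_liftIter_mono hf hF t h hj
    have h2 := (strictMono_liftIter hF t j).monotone h
    rw [abs_of_nonneg (by linarith)]
    change _ ≤ G v - G x at h1
    linarith
  · have h1 := sub_liftIter_mono hf hF t h hj
    have h2 := (strictMono_liftIter hF t j).monotone h
    rw [abs_of_nonpos (by linarith)]
    change _ ≤ G x - G v at h1
    linarith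

end

/-! ### Escape from the component of a fixed point -/

section

/-- The lift `H` of a circle map that fixes `0`, and the lift `S` of a connected subset of the
circle on which the map is injective. Points at distance at least `ρ` from `0` drift away from `0`
with speed at least `η`. -/
structure DriftLift (H : ℝ → ℝ) (S : Set ℝ) (ρ η : ℝ) : Prop where
  continuous : Continuous H
  sub_le : ∀ a b, a ≤ b → b - a ≤ H b - H a
  map_zero : H 0 = 0
  drift_right : ∀ u, ρ ≤ u → u + η ≤ H u
  drift_left : ∀ u, u ≤ -ρ → H u ≤ u - η
  near : Icc (-ρ) ρ ⊆ S
  inj : ∀ z ∈ S, ∀ u ∈ S, H u = H z + 1 → ∃ n : ℤ, u = z + n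
  sub_one : ∀ u ∈ S, u - 1 ∈ S
  add_one : ∀ u ∈ S, u + 1 ∈ S
  arc : ∀ w s, w < 0 → 0 < s → s ≤ w + 1 → w ∉ S → s ∉ S → ∀ v ∈ S, ∃ n : ℤ, v + n ∈ Ioo w s

namespace DriftLift

variable {H : ℝ → ℝ} {S : Set ℝ} {ρ η : ℝ}

theorem reflect (h : DriftLift H S ρ η) : DriftLift (fun u => -H (-u)) (Neg.neg ⁻¹' S) ρ η where
  continuous := (h.continuous.comp continuous_neg).neg
  sub_le a b hab := by
    have := h.sub_le (-b) (-a) (by linarith)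
    linarith
  map_zero := by simp [h.map_zero]
  drift_right u hu := by
    have := h.drift_left (-u) (by linarith)
    linarith
  drift_left u hu := by
    have := h.drift_right (-u) (by linarith)
    linarith
  near u hu := h.near ⟨by linarith [hu.2], by linarith [hu.1]⟩
  inj z hz u hu hzu := by
    obtain ⟨n, hn⟩ := h.inj _ hu _ hz (by linarith)
    exact ⟨n, by linarith⟩
  sub_one u hu := by
    have := h.add_one _ hu
    rw [mem_preimage]
    rwa [show -(u - 1) = -u + 1 by ring]
  add_one u hu := by
    have := h.sub_one _ hu
    rw [mem_preimage]
    rwa [show -(u + 1) = -u - 1 by ring]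
  arc w s hw hs hws hwS hsS v hv := by
    obtain ⟨n, hn⟩ := h.arc (-s) (-w) (by linarith) (by linarith) (by linarith) hsS hwS _ hv
    exact ⟨-n, by push_cast; constructor <;> linarith [hn.1, hn.2]⟩

/-- One of the two arcs from `0` to a point of the connected set is contained in it. -/
theorem Icc_subset_or (h : DriftLift H S ρ η) (hρ : 0 < ρ) {u : ℝ} (hu : u ∈ S) (hu0 : 0 < u)
    (hu1 : u < 1) : Icc 0 u ⊆ S ∨ Icc (u - 1) 0 ⊆ S := by
  by_contra hcon
  rw [not_or, not_subset, not_subset] at hcon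
  obtain ⟨⟨s, hs, hsS⟩, w, hw, hwS⟩ := hcon
  have h0 : (0 : ℝ) ∈ S := h.near ⟨by linarith, hρ.le⟩
  have hs0 : s ≠ 0 := by rintro rfl; exact hsS h0
  have hsu : s ≠ u := by rintro rfl; exact hsS hu
  have hw0 : w ≠ 0 := by rintro rfl; exact hwS h0
  have hs1 := lt_of_le_of_ne hs.1 hs0.symm
  have hs2 := lt_of_le_of_ne hs.2 hsu
  have hw1 := lt_of_le_of_ne hw.2 hw0
  have hw2 : u - 1 < w := lt_of_le_of_ne hw.1 (by rintro rfl; exact hwS (h.sub_one u hu))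
  obtain ⟨n, hn⟩ := h.arc w s hw1 hs1 (by linarith) hwS hsS u hu
  have h1 : (n : ℝ) < 0 := by linarith [hn.2]
  have h2 : (n : ℝ) ≤ -1 := by
    have : n < 0 := by exact_mod_cast h1
    exact_mod_cast (by omega : n ≤ -1)
  linarith [hn.1]

/-- Injectivity prevents the arc `[0, u]` from being mapped around the circle. -/
theorem false_of_map_eq (h : DriftLift H S ρ η) (hη : 0 < η) {u z t : ℝ} (hρ : 0 < ρ) (hu : ρ ≤ u)
    (hu1 : u < 1) (hus : u ∈ S) (hz : z ∈ S) (hzu : z ≤ u) (h1 : H z + t = H u + t - 1) :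
    False := by
  obtain ⟨n, hn⟩ := h.inj z hz u hus (by linarith)
  have h2 := h.sub_le z u hzu
  have h3 : (0 : ℝ) ≤ n := by linarith
  have h4 : (n : ℝ) ≤ 1 := by linarith
  have h5 : n ≤ 1 := by exact_mod_cast h4
  have h6 : 0 ≤ n := by exact_mod_cast h3
  have h7 : n ≠ 0 := by
    rintro rfl
    rw [Int.cast_zero, add_zero] at hn
    subst hn
    linarith
  obtain rfl : n = 1 := by omega
  rw [Int.cast_one] at hn
  have h8 := h.drift_right u hu
  have h9 := h.sub_le z 0 (by linarith)
  rw [h.map_zero] at h9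
  linarith

/-- If the new end passed `1 - ρ`, some point of `[-ρ, u]` would have the same image on the circle
as `u`. If the new point were joined to `0` inside `S` only through the opposite arc, some point of
that arc would. Both contradict injectivity, by `false_of_map_eq`. -/
theorem step (h : DriftLift H S ρ η) (hη : 0 < η) (hηρ : η ≤ ρ) {u t : ℝ} (hρ : 0 < ρ)
    (hu : ρ ≤ u) (hu1 : u < 1) (hus : Icc 0 u ⊆ S) (ht : |t| ≤ η / 2) (hS : H u + t ∈ S) :
    H u + t < 1 ∧ Icc 0 (H u + t) ⊆ S := by
  have hu0 : 0 ≤ u := hρ.le.trans hu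
  have huS : u ∈ S := hus ⟨hu0, le_rfl⟩
  have hd := h.drift_right u hu
  obtain ⟨ht1, ht2⟩ := abs_le.1 ht
  have hc : Continuous fun z => H z + t := h.continuous.add continuous_const
  have hlt : H u + t < 1 - ρ := by
    by_contra hcon
    have h1 := h.drift_left (-ρ) le_rfl
    by_cases hbig : H u + t - 1 ≤ H u + t
    · obtain ⟨z, hz, hz'⟩ := intermediate_value_Icc (a := -ρ) (b := u) (by linarith)
        hc.continuousOn (show H u + t - 1 ∈ Icc (H (-ρ) + t) (H u + t) from
          ⟨by linarith, by linarith⟩)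
      refine h.false_of_map_eq hη hρ hu hu1 huS ?_ hz.2 hz'
      rcases le_total z 0 with hz0 | hz0
      · exact h.near ⟨hz.1, by linarith⟩
      · exact hus ⟨hz0, hz.2⟩
    · linarith
  refine ⟨by linarith, ?_⟩
  rcases h.Icc_subset_or hρ hS (by linarith) (by linarith) with h1 | h1
  · exact h1
  · exfalso
    have h2 := h.drift_left (H u + t - 1) (by linarith)
    obtain ⟨z, hz, hz'⟩ := intermediate_value_Icc (a := H u + t - 1) (b := 0) (by linarith)
      hc.continuousOn (show H u + t - 1 ∈ Icc (H (H u + t - 1) + t) (H 0 + t) from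
        ⟨by linarith, by rw [h.map_zero]; linarith⟩)
    exact h.false_of_map_eq hη hρ hu hu1 huS (h1 hz) (by linarith [hz.2]) hz'

/-- An orbit that starts at the end of an arc `[0, u]` leaves the connected set. -/
theorem exists_notMem_right (h : DriftLift H S ρ η) (hη : 0 < η) (hηρ : η ≤ ρ) (hρ : 0 < ρ)
    {u : ℝ} {t : ℕ → ℝ} {k : ℕ} (hk : 1 ≤ k * (η / 2)) (hu : ρ ≤ u) (hu1 : u < 1)
    (hus : Icc 0 u ⊆ S) (ht : ∀ i, |t i| ≤ η / 2) :
    ∃ j ≤ k, chain (fun v s => H v + s) u t j ∉ S := by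
  by_contra! hcon
  have key : ∀ j ≤ k, u + j * (η / 2) ≤ chain (fun v s => H v + s) u t j ∧
      chain (fun v s => H v + s) u t j < 1 ∧ Icc 0 (chain (fun v s => H v + s) u t j) ⊆ S := by
    intro j
    induction j with
    | zero => exact fun _ => ⟨by simp [chain], hu1, hus⟩
    | succ j ih =>
      intro hj
      obtain ⟨h1, h2, h3⟩ := ih (by omega)
      have h4 : 0 ≤ (j : ℝ) * (η / 2) := by positivity
      have h5 : ρ ≤ chain (fun v s => H v + s) u t j := by linarith
      refine ⟨?_, h.step hη hηρ hρ h5 h2 h3 (ht j) (hcon (j + 1) hj)⟩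
      have h6 := h.drift_right _ h5
      have h7 := (abs_le.1 (ht j)).1
      change _ ≤ H (chain (fun v s => H v + s) u t j) + t j
      push_cast
      linarith
  obtain ⟨h1, h2, -⟩ := key k le_rfl
  linarith

theorem exists_notMem_left (h : DriftLift H S ρ η) (hη : 0 < η) (hηρ : η ≤ ρ) (hρ : 0 < ρ)
    {u : ℝ} {t : ℕ → ℝ} {k : ℕ} (hk : 1 ≤ k * (η / 2)) (hu : u ≤ -ρ) (hu1 : -1 < u)
    (hus : Icc u 0 ⊆ S) (ht : ∀ i, |t i| ≤ η / 2) :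
    ∃ j ≤ k, chain (fun v s => H v + s) u t j ∉ S := by
  obtain ⟨j, hj, h1⟩ := h.reflect.exists_notMem_right hη hηρ hρ (u := -u) (t := fun i => -t i) hk
    (by linarith) (by linarith)
    (fun v hv => hus ⟨by linarith [hv.2], by linarith [hv.1]⟩) (fun i => by simpa using ht i)
  refine ⟨j, hj, ?_⟩
  have : ∀ i, chain (fun v s => -H (-v) + s) (-u) (fun i => -t i) i =
      -chain (fun v s => H v + s) u t i := by
    intro i
    induction i with
    | zero => rfl
    | succ i ih =>
      change -H (-chain (fun v s => -H (-v) + s) (-u) (fun i => -t i) i) + -t i =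
        -(H (chain (fun v s => H v + s) u t i) + t i)
      rw [ih, neg_neg]; ring
  rw [this, mem_preimage, neg_neg] at h1
  exact h1

end DriftLift

variable {α : ℝ} {f : Circ → Circ} {P : Finset Circ} {N : ℕ} {F : ℝ → ℝ}

/-- The lower bound for the drift at the distance `nearRadius M` from a neutral fixed point. -/
def driftRate (α M : ℝ) : ℝ := (nearRadius M / 2) ^ (1 + α) / M

theorem driftRate_pos {M : ℝ} (hM : 2 ≤ M) : 0 < driftRate α M := by
  have := nearRadius_pos hM
  unfold driftRate
  positivity

theorem nearRadius_le {M : ℝ} (hM : 2 ≤ M) : nearRadius M ≤ 1 / M / 4 := by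
  have h1 := mul_nearRadius hM
  have h2 : 1 / (4 * M) = 1 / M / 4 := by
    have : 0 < M := by linarith
    field_simp
  rw [← h2, ← h1]
  exact le_mul_of_one_le_left (nearRadius_pos hM).le (by linarith)

theorem driftRate_le {M : ℝ} (hα : 0 < α) (hM : 2 ≤ M) : driftRate α M ≤ nearRadius M := by
  have h0 := nearRadius_pos hM
  have h1 := nearRadius_le hM
  have h2 : 1 / M ≤ 1 / 2 := one_div_le_one_div_of_le (by norm_num) hM
  have h3 : (nearRadius M / 2) ^ (1 + α) ≤ (nearRadius M / 2) ^ (1 : ℝ) :=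
    Real.rpow_le_rpow_of_exponent_ge (by linarith) (by linarith) (by linarith)
  rw [Real.rpow_one] at h3
  unfold driftRate
  rw [div_le_iff₀ (by linarith)]
  nlinarith

theorem ball_subset_image (p : Circ) (r : ℝ) :
    (fun s : ℝ => ((rep p + s : ℝ) : Circ)) '' Ioo (-r) r ⊆ Metric.ball p r := by
  rintro _ ⟨s, hs, rfl⟩
  rw [Metric.mem_ball]
  conv_lhs => rw [← coe_rep p]
  simp only [coe_rep]
  have := dist_coe_add (rep p) s
  rw [coe_rep] at this
  rw [this]
  exact (norm_coe_le_abs s).trans_lt (abs_lt.2 hs)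

/-- The local estimate gives the drift at distance `nearRadius M` only. Since `f` expands
everywhere, the drift does not decrease further out, however large the component is. -/
theorem GoodConstant.driftLift {M : ℝ} (hM : GoodConstant α f P N F M) (hα : 0 < α)
    (hf : IsNeutralExpanding α f P N) (hF : IsCircLift F f) {I : Set Circ} {p : Circ}
    (hp : p ∈ fixedSet f P N) (hpI : Metric.ball p (1 / M) ⊆ I) (hinj : InjOn f I) :
    DriftLift (localMap F (rep p)) {s | ((rep p + s : ℝ) : Circ) ∈ connectedComponentIn I p}
      (nearRadius M) (driftRate α M) := by
  have hM2 := hM.two_le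
  have hM0 : 0 < M := by linarith
  have hr := nearRadius_pos hM2
  have hr1 := nearRadius_le hM2
  have h1M : 0 < 1 / M := by positivity
  have hrM : nearRadius M < 1 / M := by linarith
  have hexp : ∀ a b, a ≤ b → b - a ≤ localMap F (rep p) b - localMap F (rep p) a := by
    intro a b hab
    have := sub_le_lift hf hF (a := rep p + a) (b := rep p + b) (by linarith)
    simp only [localMap]
    linarith
  have hsub : (fun s : ℝ => ((rep p + s : ℝ) : Circ)) '' Ioo (-(1 / M)) (1 / M) ⊆
      connectedComponentIn I p := by
    refine IsPreconnected.subset_connectedComponentIn ?_ ⟨0, ⟨by linarith, h1M⟩, ?_⟩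
      ((ball_subset_image p _).trans hpI)
    · refine isPreconnected_Ioo.image _ (Continuous.continuousOn ?_)
      exact (AddCircle.continuous_mk' 1).comp (continuous_const.add continuous_id)
    · simp [coe_rep]
  refine ⟨?_, hexp, (hM.neutral p hp).map_zero, ?_, ?_, ?_, ?_, ?_, ?_, ?_⟩
  · exact (hF.continuous.comp (by fun_prop)).sub continuous_const
  · intro u hu
    have h1 := hexp _ _ hu
    have h2 := (hM.neutral p hp).right.le_drift hα.le hM0 hr hrM
    simp only [driftRate]
    linarith
  · intro u hu
    have h1 := hexp _ _ hu
    have h2 := (hM.neutral p hp).left.le_drift hα.le hM0 hr hrM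
    simp only [driftRate]
    linarith
  · intro s hs
    exact hsub ⟨s, ⟨by linarith [hs.1], by linarith [hs.2]⟩, rfl⟩
  · intro z hz u hu hzu
    have hI := connectedComponentIn_subset I p
    have h1 : f ((rep p + u : ℝ) : Circ) = f ((rep p + z : ℝ) : Circ) := by
      rw [hF.coe, hF.coe]
      refine coe_eq_coe_iff.2 ⟨-1, ?_⟩
      simp only [localMap] at hzu
      push_cast
      linarith
    obtain ⟨n, hn⟩ := coe_eq_coe_iff.1 (hinj (hI hu) (hI hz) h1)
    exact ⟨-n, by push_cast; linarith⟩
  · intro u hu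
    rw [mem_ofPred_eq, ← add_sub_assoc, coe_sub_one]
    exact hu
  · intro u hu
    rw [mem_ofPred_eq, ← coe_sub_one, ← add_assoc, add_sub_cancel_right]
    exact hu
  · intro w s hw hs hws hwS hsS v hv
    have h0 : ((rep p : ℝ) : Circ) ∈ connectedComponentIn I p := by
      have := hsub ⟨0, ⟨by linarith, h1M⟩, rfl⟩
      simpa using this
    obtain ⟨y, hy, hyv⟩ := subset_arc isPreconnected_connectedComponentIn (a := rep p + w)
      (b := rep p + s) (x := rep p) (by linarith) (by linarith) (by linarith) hwS hsS h0 hv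
    obtain ⟨n, hn⟩ := coe_eq_coe_iff.1 hyv
    exact ⟨-n, by push_cast; constructor <;> linarith [hy.1, hy.2]⟩

/-- Orbits that start outside a neighbourhood of the neutral fixed points leave the escape
neighbourhood within a bounded time. -/
theorem GoodConstant.exists_escape_time {M : ℝ} (hM : GoodConstant α f P N F M) (hα : 0 < α)
    (hf : IsNeutralExpanding α f P N) (hF : IsCircLift F f) {I : Set Circ}
    (hI : IsEscapeNhd f (fixedSet f P N) I)
    (hMI : ∀ p ∈ fixedSet f P N, Metric.ball p (1 / M) ⊆ I) :
    ∃ ε₀ : ℝ, 0 < ε₀ ∧ ∃ k : ℕ, ∀ t : ℕ → ℝ, (∀ i, |t i| ≤ ε₀) → ∀ x ∉ nearSet f P N M,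
      ∃ j ≤ k, randIter f t j x ∉ I := by
  obtain ⟨δ, hδ, hesc⟩ := hI.escape
  have hM2 := hM.two_le
  have hη := driftRate_pos (α := α) hM2
  have hr := nearRadius_pos hM2
  have hηr := driftRate_le hα hM2
  have hinj : InjOn f I := by
    intro x hx y hy hxy
    exact (hesc 0 (by simpa using hδ.le)).injOn hx hy (by simp [perturb, hxy])
  obtain ⟨k, hk⟩ := exists_nat_ge (1 / (driftRate α M / 2))
  rw [div_le_iff₀ (by positivity)] at hk
  refine ⟨min δ (driftRate α M / 2), by positivity, k, fun t ht x hx => ?_⟩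
  by_contra! hcon
  obtain ⟨p, ⟨hp, hpx⟩, -⟩ := hI.unique_fixed x (hcon 0 (Nat.zero_le k))
  have hpI : p ∈ I := connectedComponentIn_subset _ _ hpx
  -- By property (iv) an orbit that remains in `I` remains in one component, so the connected set
  -- about the single fixed point `p` is enough.
  have hcomp : ∀ j ≤ k, randIter f t j x ∈ connectedComponentIn I p := by
    have h1 : ∀ j ≤ k, connectedComponentIn I x = connectedComponentIn I (randIter f t j x) := by
      intro j
      induction j with
      | zero => exact fun _ => rfl
      | succ j ih =>
        intro hj
        rw [ih (by omega)]
        exact (hesc (t j) ((ht j).trans (min_le_left _ _))).same_component _ (hcon j (by omega))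
          (hcon (j + 1) hj)
    intro j hj
    rw [← connectedComponentIn_eq hpx, h1 j hj]
    exact mem_connectedComponentIn (hcon j hj)
  have hD := hM.driftLift hα hf hF hp (hMI p hp) hinj
  have ht' : ∀ i, |t i| ≤ driftRate α M / 2 := fun i => (ht i).trans (min_le_right _ _)
  obtain ⟨u, hu0, hu1, rfl⟩ : ∃ u, 0 ≤ u ∧ u < 1 ∧ x = ((rep p + u : ℝ) : Circ) := by
    have : x - p ∈ ((↑) : ℝ → AddCircle (1 : ℝ)) '' Ico 0 (0 + 1) := by
      rw [AddCircle.coe_image_Ico_eq]; trivial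
    obtain ⟨u, hu, hux⟩ := this
    refine ⟨u, hu.1, by linarith [hu.2], ?_⟩
    rw [AddCircle.coe_add, coe_rep]
    have h : (u : Circ) = x - p := hux
    rw [h, add_sub_cancel]
  have hfar : nearRadius M ≤ ‖(u : Circ)‖ := by
    have h1 := dist_coe_add (rep p) u
    rw [coe_rep] at h1
    rw [← h1]
    exact not_lt.1 fun h => hx ⟨p, hp, h⟩
  have hur : nearRadius M ≤ u := by
    have := hfar.trans (norm_coe_le_abs u)
    rwa [abs_of_nonneg hu0] at this
  have hur' : u - 1 ≤ -nearRadius M := by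
    rw [← coe_sub_one] at hfar
    have := hfar.trans (norm_coe_le_abs _)
    rw [abs_of_neg (by linarith)] at this
    linarith
  rcases hD.Icc_subset_or hr (hcomp 0 (Nat.zero_le k)) (by linarith) hu1 with h | h
  · obtain ⟨j, hj, h1⟩ := hD.exists_notMem_right hη hηr hr hk hur hu1 h ht'
    refine h1 ?_
    have := hcomp j hj
    rwa [chain_localMap_coe hf hF hp] at this
  · obtain ⟨j, hj, h1⟩ := hD.exists_notMem_left hη hηr hr hk hur' (by linarith) h ht'
    refine h1 ?_
    have := hcomp j hj
    rw [← coe_sub_one, add_sub_assoc, chain_localMap_coe hf hF hp] at this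
    exact this

end

/-! ### The probability of long stays in the escape neighbourhood -/

section

/-- Connected subsets of the circle are measurable. -/
theorem measurableSet_of_isPreconnected {S : Set Circ} (hS : IsPreconnected S) :
    MeasurableSet S := by
  by_cases huniv : S = univ
  · rw [huniv]; exact MeasurableSet.univ
  obtain ⟨a, ha⟩ := (ne_univ_iff_exists_notMem S).1 huniv
  obtain ⟨a, rfl⟩ : ∃ v : ℝ, (v : Circ) = a := ⟨rep a, coe_rep a⟩
  have ha1 : ((a + 1 : ℝ) : Circ) ∉ S := by
    rwa [← coe_sub_one, add_sub_cancel_right]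
  set T : Set ℝ := {v | v ∈ Ioo a (a + 1) ∧ (v : Circ) ∈ S} with hT
  have hTo : T.OrdConnected := by
    refine ⟨fun x hx y hy b hb => ?_⟩
    have hbI : b ∈ Ioo a (a + 1) := ⟨hx.1.1.trans_le hb.1, hb.2.trans_lt hy.1.2⟩
    refine ⟨hbI, ?_⟩
    by_contra hbS
    have hxb : x < b := lt_of_le_of_ne hb.1 (by rintro rfl; exact hbS hx.2)
    obtain ⟨v, hv, hvy⟩ := subset_arc hS hx.1.1 hxb hbI.2.le ha hbS hx.2 hy.2
    have := eq_of_coe_eq_of_abs_lt (x := v) (y := y) hvy (by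
      rw [abs_lt]; constructor <;> linarith [hv.1, hv.2, hy.1.1, hy.1.2, hbI.2])
    linarith [hv.2, hb.2]
  have hST : S = (fun z : Circ => ((AddCircle.measurableEquivIoc (1 : ℝ) a z : Ioc a (a + 1)) : ℝ))
      ⁻¹' T := by
    ext z
    have hz : (((AddCircle.measurableEquivIoc (1 : ℝ) a z : Ioc a (a + 1)) : ℝ) : Circ) = z :=
      AddCircle.coe_equivIoc
    have hmem := (AddCircle.measurableEquivIoc (1 : ℝ) a z : Ioc a (a + 1)).2
    constructor
    · intro hzS
      refine ⟨⟨hmem.1, lt_of_le_of_ne hmem.2 fun h => ha1 ?_⟩, by rwa [hz]⟩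
      rw [← h, hz]; exact hzS
    · intro h
      rw [← hz]; exact h.2
  rw [hST]
  exact (measurable_subtype_coe.comp (AddCircle.measurableEquivIoc (1 : ℝ) a).measurable)
    hTo.measurableSet

variable {α : ℝ} {f : Circ → Circ} {P : Finset Circ} {N : ℕ} {F : ℝ → ℝ}

/-- `I` is not assumed measurable, but it is the union of the components of finitely many points,
and connected sets are measurable. -/
theorem IsEscapeNhd.measurableSet {P₀ I : Set Circ} (hI : IsEscapeNhd f P₀ I) (hP : P₀.Finite) :
    MeasurableSet I := by
  have : I = ⋃ p ∈ P₀ ∩ I, connectedComponentIn I p := by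
    refine Subset.antisymm (fun x hx => ?_) (iUnion₂_subset fun p _ =>
      connectedComponentIn_subset _ _)
    obtain ⟨p, ⟨hp, hpx⟩, -⟩ := hI.unique_fixed x hx
    refine mem_iUnion₂.2 ⟨p, ⟨hp, connectedComponentIn_subset _ _ hpx⟩, ?_⟩
    rw [← connectedComponentIn_eq hpx]
    exact mem_connectedComponentIn hx
  rw [this]
  exact (hP.subset inter_subset_left).measurableSet_biUnion fun p _ =>
    measurableSet_of_isPreconnected isPreconnected_connectedComponentIn

/-- The points that stay in the escape neighbourhood for a time `k` are covered by few sets of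
diameter of order `k^{-1/α}`. -/
theorem GoodConstant.exists_stay_cover {M : ℝ} (hM : GoodConstant α f P N F M) (hα₀ : 0 < α)
    (hα₁ : α < 1) (hf : IsNeutralExpanding α f P N) (hF : IsCircLift F f) {I : Set Circ}
    (hI : IsEscapeNhd f (fixedSet f P N) I)
    (hMI : ∀ p ∈ fixedSet f P N, Metric.ball p (1 / M) ⊆ I) :
    ∃ A : ℝ, 0 < A ∧ ∃ ε₀ : ℝ, 0 < ε₀ ∧ ∀ t : ℕ → ℝ, (∀ i, |t i| ≤ ε₀) → ∀ k : ℕ, 1 ≤ k →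
      ∃ S : Circ → Set Circ,
        (∀ x, (∀ j < k, randIter f t j x ∈ I) → ∃ p ∈ fixedSet f P N, x ∈ S p) ∧
        ∀ p, ∀ x ∈ S p, ∀ y ∈ S p, dist x y ≤ A * (k : ℝ) ^ (-(1 / α)) := by
  obtain ⟨ε₁, hε₁, κ, hesc⟩ := hM.exists_escape_time hα₀ hf hF hI hMI
  have hM2 := hM.two_le
  have hM0 : 0 < M := by linarith
  have hrM : nearRadius M ≤ 1 / M := by
    have := nearRadius_le hM2
    have : 0 < 1 / M := by positivity
    linarith
  set B : ℝ := (4 / (α * ((1 / 4) ^ (1 + α) / M))) ^ (1 / α) with hB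
  have hB0 : 0 < B := by positivity
  have hκ : (0 : ℝ) < κ + 2 := by positivity
  set D : ℝ := ((κ : ℝ) + 2) ^ (1 / α) with hD
  have hD0 : 0 < D := by positivity
  -- comparison of the times `k` and `j ≥ k / (κ + 2)`
  have hcomp : ∀ k j : ℕ, 1 ≤ k → 1 ≤ j → k ≤ j * (κ + 2) →
      (j : ℝ) ^ (-(1 / α)) ≤ D * (k : ℝ) ^ (-(1 / α)) := by
    intro k j hk hj hkj
    have hk0 : (0 : ℝ) < k := by exact_mod_cast hk
    have hj0 : (0 : ℝ) < j := by exact_mod_cast hj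
    have h1 : (k : ℝ) / (κ + 2) ≤ j := by
      rw [div_le_iff₀ hκ]; exact_mod_cast hkj
    calc (j : ℝ) ^ (-(1 / α)) ≤ ((k : ℝ) / (κ + 2)) ^ (-(1 / α)) :=
          Real.rpow_le_rpow_of_nonpos (by positivity) h1 (by
            have : 0 < 1 / α := by positivity
            linarith)
      _ = D * (k : ℝ) ^ (-(1 / α)) := by
          rw [Real.div_rpow hk0.le hκ.le, Real.rpow_neg hκ.le, div_inv_eq_mul, mul_comm]
  refine ⟨(B + 1) * D, by positivity, min ε₁ (1 / (4 * M)), by positivity, fun t ht k hk => ?_⟩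
  have ht1 : ∀ i, |t i| ≤ ε₁ := fun i => (ht i).trans (min_le_left _ _)
  have hk0 : (0 : ℝ) < k := by exact_mod_cast hk
  -- For bounded times the diameter `1/2` of the circle already satisfies the claim.
  rcases lt_or_ge k (κ + 2) with hkκ | hkκ
  · refine ⟨fun _ => univ, fun x hx => ?_, fun p x _ y _ => ?_⟩
    · obtain ⟨p, ⟨hp, -⟩, -⟩ := hI.unique_fixed x (hx 0 hk)
      exact ⟨p, hp, mem_univ x⟩
    · have h1 := hcomp k 1 hk le_rfl (by omega)
      rw [Nat.cast_one, Real.one_rpow] at h1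
      have h2 : dist x y ≤ 1 / 2 := by
        rw [dist_eq_norm]
        simpa using AddCircle.norm_le_half_period (p := (1 : ℝ)) (x := x - y) one_ne_zero
      have h3 : 0 ≤ B * (D * (k : ℝ) ^ (-(1 / α))) := by positivity
      linarith
  · refine ⟨fun p => {x | p ∈ fixedSet f P N ∧ ∃ u : ℝ, x = ((rep p + u : ℝ) : Circ) ∧
      ∀ i < k - κ, |chain (fun v s => localMap F (rep p) v + s) u t i| < nearRadius M},
      fun x hx => ?_, ?_⟩
    -- A point outside the small balls at a time `i < k - κ` would leave `I` by the time `i + κ <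
    -- k`. Hence the orbit is near one fixed point during the times before `k - κ`.
    · obtain ⟨p, hp, u, hu, h1, -⟩ := hM.exists_coordinates hf hF (ε := 1 / (4 * M)) le_rfl
        (t := t) (x := x) (n := k - κ) (fun i _ => (ht i).trans (min_le_right _ _)) (by omega) (by
          intro i hi
          by_contra hcon
          obtain ⟨j, hj, h2⟩ := hesc (shift i t) (fun l => ht1 _) _ hcon
          rw [randIter_shift] at h2
          exact h2 (hx _ (by omega)))
      exact ⟨p, hp, hp, u, hu, h1⟩
    · rintro p _ ⟨hp, u, rfl, hu⟩ _ ⟨-, v, rfl, hv⟩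
      have key : ∀ u v : ℝ,
          (∀ i < k - κ, |chain (fun v s => localMap F (rep p) v + s) u t i| < nearRadius M) →
          (∀ i < k - κ, |chain (fun v s => localMap F (rep p) v + s) v t i| < nearRadius M) →
          v - u ≤ B * (D * (k : ℝ) ^ (-(1 / α))) := by
        intro u v hu hv
        have h1 := (hM.neutral p hp).sub_le_rpow hα₀ hα₁ hM2
          (a := chain (fun v s => localMap F (rep p) v + s) u t)
          (b := chain (fun v s => localMap F (rep p) v + s) v t) (t := t) (k := k - κ - 1)
          (by omega) (fun i hi => (hu i (by omega)).trans_le hrM)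
          (fun i hi => (hv i (by omega)).trans_le hrM) (fun i _ => rfl) (fun i _ => rfl)
        refine h1.trans (mul_le_mul_of_nonneg_left (hcomp k _ hk (by omega) ?_) hB0.le)
        obtain ⟨l, rfl⟩ := Nat.exists_eq_add_of_le hkκ
        rw [show κ + 2 + l - κ - 1 = l + 1 by omega]
        nlinarith [Nat.zero_le (l * κ)]
      have h1 := key u v hu hv
      have h2 := key v u hv hu
      have h3 : 0 ≤ D * (k : ℝ) ^ (-(1 / α)) := by positivity
      rw [dist_eq_norm, ← AddCircle.coe_sub]
      refine (norm_coe_le_abs _).trans (abs_le.2 ⟨?_, ?_⟩) <;> linarith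

/-- Truncation to the interval `[-ε, ε]`. -/
def clamp (ε s : ℝ) : ℝ := max (-ε) (min s ε)

theorem abs_clamp_le {ε : ℝ} (hε : 0 ≤ ε) (s : ℝ) : |clamp ε s| ≤ ε :=
  abs_le.2 ⟨le_max_left _ _, max_le (by linarith) (min_le_right _ _)⟩

theorem clamp_of_mem {ε s : ℝ} (hs : s ∈ Icc (-ε) ε) : clamp ε s = s := by
  rw [clamp, min_eq_left hs.2, max_eq_right hs.1]

/-- The perturbed map with the noise truncated to `[-ε, ε]`. -/
def clampedStep (f : Circ → Circ) (ε : ℝ) (x : Circ) (s : ℝ) : Circ := f x + (clamp ε s : Circ)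

/-- Clamping makes the stay estimates valid for every noise sequence, as `measure_weight_lt_le`
demands, and almost surely changes nothing. -/
theorem chain_clampedStep (f : Circ → Circ) (ε : ℝ) (x : Circ) (t : ℕ → ℝ) (n : ℕ) :
    chain (clampedStep f ε) x t n = randIter f (fun i => clamp ε (t i)) n x := by
  induction n with
  | zero => rfl
  | succ n ih => rw [chain, ih]; rfl

theorem measurable_clampedStep (hf : Continuous f) (ε : ℝ) :
    Measurable fun q : Circ × ℝ => clampedStep f ε q.1 q.2 := by
  have h1 : Continuous fun s : ℝ => (clamp ε s : Circ) :=
    (AddCircle.continuous_mk' 1).comp (by unfold clamp; fun_prop)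
  exact ((hf.comp continuous_fst).add (h1.comp continuous_snd)).measurable

theorem volume_le_of_dist_le {S : Set Circ} {d : ℝ} (hS : ∀ x ∈ S, ∀ y ∈ S, dist x y ≤ d) :
    volume S ≤ ENNReal.ofReal (2 * d) := by
  rcases S.eq_empty_or_nonempty with rfl | ⟨x, hx⟩
  · simp
  · calc volume S ≤ volume (Metric.closedBall x d) :=
        measure_mono fun y hy => hS y hy x hx
      _ ≤ _ := by
        rw [AddCircle.volume_closedBall]
        exact ENNReal.ofReal_le_ofReal (min_le_right _ _)

/-- For `ε ≤ 1/4` the map `s ↦ z + s` is isometric on `[-ε, ε]`, so the favourable noises lie in an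
interval of length `2 d`, while the noise has density `1 / (2 ε)`. -/
theorem noise_le_of_dist_le {ε : ℝ} (hε : 0 < ε) (hε1 : ε ≤ 1 / 4) {S : Set Circ} {d : ℝ}
    (hS : ∀ x ∈ S, ∀ y ∈ S, dist x y ≤ d) (z : Circ) :
    noise ε {s | z + (clamp ε s : Circ) ∈ S} ≤ ENNReal.ofReal (d / ε) := by
  rw [noise, ProbabilityTheory.cond_apply measurableSet_Icc]
  have h1 : volume (Icc (-ε) ε ∩ {s | z + (clamp ε s : Circ) ∈ S}) ≤ ENNReal.ofReal (2 * d) := by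
    rcases (Icc (-ε) ε ∩ {s | z + (clamp ε s : Circ) ∈ S}).eq_empty_or_nonempty with h | ⟨s, hs, hsS⟩
    · rw [h]; simp
    · rw [← Real.volume_closedBall s d]
      refine measure_mono ?_
      rintro s' ⟨hs', hsS'⟩
      have h2 := hS _ hsS' _ hsS
      rw [clamp_of_mem hs, clamp_of_mem hs', dist_add_left, dist_eq_norm, ← AddCircle.coe_sub,
        norm_coe_of_abs_le (abs_le.2 ⟨by linarith [hs.2, hs'.1], by linarith [hs.1, hs'.2]⟩)] at h2
      exact h2
  rw [Real.volume_Icc, ← ENNReal.ofReal_inv_of_pos (by linarith)]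
  calc _ ≤ ENNReal.ofReal (ε - -ε)⁻¹ * ENNReal.ofReal (2 * d) := by gcongr
    _ = ENNReal.ofReal (d / ε) := by
      rw [← ENNReal.ofReal_mul (inv_nonneg.2 (by linarith))]
      congr 1
      field_simp
      ring

/-- The probability of a long stay in the escape neighbourhood. -/
theorem GoodConstant.exists_stay_bound {M : ℝ} (hM : GoodConstant α f P N F M) (hα₀ : 0 < α)
    (hα₁ : α < 1) (hf : IsNeutralExpanding α f P N) (hF : IsCircLift F f) {I : Set Circ}
    (hI : IsEscapeNhd f (fixedSet f P N) I)
    (hMI : ∀ p ∈ fixedSet f P N, Metric.ball p (1 / M) ⊆ I) :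
    ∃ A : ℝ, 0 < A ∧ ∃ ε₀ : ℝ, 0 < ε₀ ∧ ∀ ε : ℝ, 0 < ε → ε ≤ ε₀ →
      (∀ y t k, 1 ≤ k → noise ε {s | Stays (clampedStep f ε) I k (clampedStep f ε y s) t} ≤
        ENNReal.ofReal (A * (k : ℝ) ^ (-(1 / α)) / ε)) ∧
      ∀ t k, 1 ≤ k → volume {x | Stays (clampedStep f ε) I k x t} ≤
        ENNReal.ofReal (A * (k : ℝ) ^ (-(1 / α))) := by
  obtain ⟨A, hA, ε₀, hε₀, H⟩ := hM.exists_stay_cover hα₀ hα₁ hf hF hI hMI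
  set s : Finset Circ := (finite_fixedSet f P N).toFinset with hs
  have hmem : ∀ p, p ∈ s ↔ p ∈ fixedSet f P N := fun p => by simp [hs]
  refine ⟨2 * (s.card + 1) * A, by positivity, min ε₀ (1 / 4), by positivity,
    fun ε hε hεε => ?_⟩
  have key : ∀ (t : ℕ → ℝ) (k : ℕ), 1 ≤ k → ∃ S : Circ → Set Circ,
      (∀ x, Stays (clampedStep f ε) I k x t → ∃ p ∈ s, x ∈ S p) ∧
      ∀ p, ∀ x ∈ S p, ∀ y ∈ S p, dist x y ≤ A * (k : ℝ) ^ (-(1 / α)) := by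
    intro t k hk
    obtain ⟨S, h1, h2⟩ := H (fun i => clamp ε (t i))
      (fun i => (abs_clamp_le hε.le _).trans (hεε.trans (min_le_left _ _))) k hk
    refine ⟨S, fun x hx => ?_, h2⟩
    simp only [hmem]
    exact h1 x fun j hj => by rw [← chain_clampedStep]; exact hx j hj
  constructor
  · intro y t k hk
    obtain ⟨S, h1, h2⟩ := key t k hk
    calc noise ε {r | Stays (clampedStep f ε) I k (clampedStep f ε y r) t}
        ≤ noise ε (⋃ p ∈ s, {r | f y + (clamp ε r : Circ) ∈ S p}) := by
          refine measure_mono fun r hr => ?_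
          obtain ⟨p, hp, hx⟩ := h1 _ hr
          exact mem_iUnion₂.2 ⟨p, hp, hx⟩
      _ ≤ ∑ p ∈ s, noise ε {r | f y + (clamp ε r : Circ) ∈ S p} := measure_biUnion_finset_le _ _
      _ ≤ ∑ p ∈ s, ENNReal.ofReal (A * (k : ℝ) ^ (-(1 / α)) / ε) :=
          Finset.sum_le_sum fun p _ =>
            noise_le_of_dist_le hε (hεε.trans (min_le_right _ _)) (h2 p) _
      _ ≤ _ := by
          rw [Finset.sum_const, nsmul_eq_mul, ← ENNReal.ofReal_natCast,
            ← ENNReal.ofReal_mul (Nat.cast_nonneg _)]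
          refine ENNReal.ofReal_le_ofReal ?_
          rw [← mul_div_assoc]
          refine div_le_div_of_nonneg_right ?_ hε.le
          have : 0 ≤ A * (k : ℝ) ^ (-(1 / α)) := by positivity
          have : 0 ≤ (s.card : ℝ) * (A * (k : ℝ) ^ (-(1 / α))) := by positivity
          linarith
  · intro t k hk
    obtain ⟨S, h1, h2⟩ := key t k hk
    calc volume {x | Stays (clampedStep f ε) I k x t}
        ≤ volume (⋃ p ∈ s, S p) := by
          refine measure_mono fun x hx => ?_
          obtain ⟨p, hp, hx⟩ := h1 _ hx
          exact mem_iUnion₂.2 ⟨p, hp, hx⟩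
      _ ≤ ∑ p ∈ s, volume (S p) := measure_biUnion_finset_le _ _
      _ ≤ ∑ p ∈ s, ENNReal.ofReal (2 * (A * (k : ℝ) ^ (-(1 / α)))) :=
          Finset.sum_le_sum fun p _ => volume_le_of_dist_le (h2 p)
      _ ≤ _ := by
          rw [Finset.sum_const, nsmul_eq_mul, ← ENNReal.ofReal_natCast,
            ← ENNReal.ofReal_mul (Nat.cast_nonneg _)]
          refine ENNReal.ofReal_le_ofReal ?_
          have : 0 ≤ A * (k : ℝ) ^ (-(1 / α)) := by positivity
          linarith

end

/-! ### Distortion, weight and the first expansion time -/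

section

theorem weight_ne_top {X : Type*} (φ : X → ℝ → X) (I : Set X) {δ μ z : ℝ≥0∞} (hδ : δ ≠ ∞)
    (hμ : μ ≠ 0) (hz : z ≠ ∞) (x : X) (t : ℕ → ℝ) (n : ℕ) : weight φ I δ μ x z t n ≠ ∞ := by
  induction n with
  | zero => exact hz
  | succ n ih =>
    rw [weight, weightStep]
    split_ifs
    · exact ENNReal.add_ne_top.2 ⟨ih, hδ⟩
    · exact ENNReal.div_ne_top ih hμ

variable {α : ℝ} {f : Circ → Circ} {P : Finset Circ} {N : ℕ} {F : ℝ → ℝ}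

/-- A point close to an orbit point outside `I` is not close to a neutral fixed point. -/
theorem mem_of_dist_lt {I : Set Circ} {τ : ℝ} (hτ : IsScale f I τ) {x y : Circ} (hy : y ∈ I)
    (hfy : f y ∈ I) (hxy : dist y x < τ) : x ∈ I := by
  by_contra hx
  have h1 : ENNReal.ofReal τ < edist y x :=
    hτ.2.2.trans_le (iInf₂_le_of_le y ⟨hfy, hy⟩ (iInf₂_le x hx))
  rw [edist_dist] at h1
  exact absurd (ENNReal.ofReal_le_ofReal hxy.le) (not_le.2 h1)

/-- The distortion at the visits outside the escape neighbourhood is controlled by the weight. -/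
theorem GoodConstant.exists_distortion_bound {M : ℝ} (hM : GoodConstant α f P N F M) (hα₀ : 0 < α)
    (hα₁ : α < 1) (hf : IsNeutralExpanding α f P N) (hF : IsCircLift F f) {I : Set Circ} {τ : ℝ}
    (hτ : IsScale f I τ) (hMI : ∀ p ∈ fixedSet f P N, Metric.ball p (1 / M) ⊆ I ∩ f ⁻¹' I) :
    ∃ μ : ℝ, 1 < μ ∧ ∃ A : ℝ, 0 < A ∧ ∃ ε₀ : ℝ, 0 < ε₀ ∧ ∀ ε : ℝ, 0 < ε → ε ≤ ε₀ →
      ∀ t : ℕ → ℝ, (∀ i, |t i| ≤ ε) → ∀ φ : Circ → ℝ → Circ, ∀ x : Circ,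
        (∀ n, chain φ x t n = randIter f t n x) → ∀ n, randIter f t n x ∉ I →
          distortionSum α f τ n x t ≤ ENNReal.ofReal ((A * μ + 1) / (μ - 1) + A *
            (weight φ I (ENNReal.ofReal (ε ^ α)) (ENNReal.ofReal μ) x 0 t n).toReal) := by
  obtain ⟨A, hA, ε₀, hε₀, hpass⟩ := hM.exists_passage_bound hα₀ hα₁ hf hF
  obtain ⟨lam, hlam, hexp⟩ := exists_uniform_expansion hf (nearRadius_pos hM.two_le)
  have hM2 := hM.two_le
  have hrM : nearRadius M ≤ 1 / M := by
    have := nearRadius_le hM2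
    have : 0 < 1 / M := one_div_pos.2 (by linarith)
    linarith
  have hμ : 1 < lam ^ α := Real.one_lt_rpow hlam hα₀
  refine ⟨lam ^ α, hμ, A, hA, ε₀, hε₀, fun ε hε hεε t ht φ x hφ n hn => ?_⟩
  set δ := ENNReal.ofReal (ε ^ α) with hδ
  set w := weight φ I δ (ENNReal.ofReal (lam ^ α)) x 0 t with hw
  have hwtop : ∀ i, w i ≠ ∞ := weight_ne_top φ I ENNReal.ofReal_ne_top
    (by rw [ne_eq, ENNReal.ofReal_eq_zero]; linarith) ENNReal.zero_ne_top x t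
  refine iSup₂_le fun y hy => ENNReal.ofReal_le_ofReal ?_
  change orbitSum α f t n y ≤ _
  rw [orbitSum_eq_backwardSum hf]
  -- The supremum runs over all `y` in the pullback while the weight knows only `x`. Near `P₀` both
  -- `y_i` and its image under `f` are in `I`, and `x_i` is within `τ` of `y_i`, so the choice of
  -- `τ` puts `x_i` in `I`.
  have hVI : ∀ i ≤ n, randIter f t i y ∈ nearSet f P N M → randIter f t i x ∈ I := by
    rintro i hi ⟨p, hp, hyp⟩
    obtain ⟨h1, h2⟩ := hMI p hp (Metric.mem_ball.2 (hyp.trans_le hrM))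
    exact mem_of_dist_lt hτ h1 h2 (dist_lt_of_mem_pullback hf hτ.1 hτ.2.1 hy hi)
  have hd : ∀ i, 1 ≤ derivRight f (randIter f t i y) := fun i => one_le_derivRight hf _
  refine backwardSum_le_weight hα₀ hA hμ (Real.rpow_nonneg hε.le α)
    (inV := fun i => randIter f t i y ∈ nearSet f P N M) (inI := fun i => randIter f t i x ∈ I)
    (z := fun i => (w i).toReal)
    hd ?_ ?_ ENNReal.toReal_nonneg ?_ ?_ n (fun i hi => hVI i hi.le) (fun h => hn (hVI n le_rfl h))
  · intro i hi
    have h1 := hexp (randIter f t i y) fun p hp => not_lt.1 fun h => hi ⟨p, hp, h⟩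
    rw [one_div, ← Real.rpow_neg (by linarith)]
    exact Real.rpow_le_rpow_of_nonpos (by linarith) h1 (by linarith)
  · intro b l hl h1 h2
    have := hpass ε hε hεε (shift b t) (fun i => ht _) (randIter f t b y) l hl
      (fun i hi => by rw [randIter_shift, add_comm]; exact h1 i hi)
      (by rw [randIter_shift, add_comm]; exact h2)
    simpa only [randIter_shift, add_comm] using this
  · intro i hi
    change (weightStep I δ _ (chain φ x t i) (w i)).toReal = _
    rw [hφ, weightStep, if_pos hi, ENNReal.toReal_add (hwtop i) ENNReal.ofReal_ne_top,
      ENNReal.toReal_ofReal (Real.rpow_nonneg hε.le α)]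
  · intro i hi
    change (weightStep I δ _ (chain φ x t i) (w i)).toReal = _
    rw [hφ, weightStep, if_neg hi, ENNReal.toReal_div, ENNReal.toReal_ofReal (by linarith)]

/-- Points that start outside the escape neighbourhood have the expansion time `1`. -/
theorem isExpansionTime_one (hα : 0 ≤ α) (hf : IsNeutralExpanding α f P N) {I : Set Circ} {τ K : ℝ}
    (hK : 1 ≤ K) {x : Circ} (hx : x ∉ I) (t : ℕ → ℝ) : IsExpansionTime α f I τ K x t 1 := by
  refine ⟨le_rfl, iSup₂_le fun y _ => ENNReal.ofReal_le_ofReal ?_, ?_⟩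
  · change orbitSum α f t 1 y ≤ K
    rw [orbitSum_succ hf, orbitSum_zero, zero_add, one_mul]
    exact (rpow_neg_le_one hα (one_le_derivRight hf _)).trans hK
  · exact (iInf₂_le 0 hx).trans (by simp)

theorem ae_forall_abs_le_noise {ε : ℝ} (hε : 0 < ε) :
    ∀ᵐ q ∂(noiseProd ε hε), ∀ i, |q.2 i| ≤ ε := by
  have := isProbabilityMeasure_noise hε
  have h1 : ∀ᵐ s ∂(noise ε), |s| ≤ ε := by
    have : ∀ᵐ s ∂(noise ε), s ∈ Icc (-ε) ε := ProbabilityTheory.ae_cond_mem measurableSet_Icc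
    filter_upwards [this] with s hs using abs_le.2 hs
  have h2 : ∀ᵐ t ∂(Measure.infinitePi fun _ : ℕ => noise ε), ∀ i, |t i| ≤ ε :=
    ae_all_iff.2 fun i =>
      (measurePreserving_eval_infinitePi (fun _ : ℕ => noise ε) i).quasiMeasurePreserving.ae h1
  exact Measure.quasiMeasurePreserving_snd.ae h2

/-- The theorem with the sharper exponent `1/α`. Before the first expansion time the weight must
exceed `K` at every positive time outside `I`, which is the event of the tail estimate. -/
theorem measure_le_firstExpansionTime_le (hα₀ : 0 < α) (hα₁ : α < 1)
    (hf : IsNeutralExpanding α f P N) {I : Set Circ} (hI : IsEscapeNhd f (fixedSet f P N) I)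
    {τ : ℝ} (hτ : IsScale f I τ) :
    ∃ K₀ : ℝ, 0 < K₀ ∧ ∃ C₀ : ℝ, 0 < C₀ ∧ ∃ ε₀ : ℝ, 0 < ε₀ ∧
      ∀ (ε : ℝ) (hε : 0 < ε), ε < ε₀ → ∀ m : ℕ, 1 ≤ m →
        noiseProd ε hε {q | (m : ℕ∞) ≤ firstExpansionTime α f I τ K₀ q.1 q.2} ≤
          ENNReal.ofReal (C₀ * (m : ℝ) ^ (-(1 / α))) := by
  obtain ⟨F, hF⟩ := hf.exists_lift
  have hnhds : ∀ p ∈ fixedSet f P N, I ∩ f ⁻¹' I ∈ 𝓝 p := by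
    intro p hp
    have h1 : I ∈ 𝓝 p := mem_nhdsSet_iff_forall.1 hI.mem_nhdsSet p hp
    refine inter_mem h1 (hf.continuous.continuousAt.preimage_mem_nhds ?_)
    rwa [hf.fixed p hp]
  obtain ⟨M, hM, hMI⟩ := ((eventually_goodConstant hα₀ hf hF).and
    (eventually_ball_subset (finite_fixedSet f P N) hnhds)).exists
  have hMI' : ∀ p ∈ fixedSet f P N, Metric.ball p (1 / M) ⊆ I := fun p hp =>
    (hMI p hp).trans inter_subset_left
  obtain ⟨μ, hμ, A, hA, ε₁, hε₁, hdist⟩ := hM.exists_distortion_bound hα₀ hα₁ hf hF hτ hMI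
  obtain ⟨B, hB, ε₂, hε₂, hstay⟩ := hM.exists_stay_bound hα₀ hα₁ hf hF hI hMI'
  obtain ⟨K, hK, C, hC, hprob⟩ := measure_weight_lt_le hα₀ hα₁ hμ hB
  have hμ1 : 0 < μ - 1 := by linarith
  -- The distortion bound at weight `K`, increased by `1` so that the time `1` is an expansion time
  -- for points outside `I`.
  set K₀ : ℝ := (A * μ + 1) / (μ - 1) + A * K + 1 with hK₀
  have hq : 0 < (A * μ + 1) / (μ - 1) := by positivity
  have hAK : 0 < A * K := by positivity
  have hK₀1 : 1 ≤ K₀ := by linarith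
  refine ⟨K₀, by linarith, max C 1, by positivity, min (min ε₁ ε₂) 1, by positivity,
    fun ε hε hεε m hm => ?_⟩
  have := isProbabilityMeasure_noise hε
  have : IsProbabilityMeasure (volume : Measure Circ) := ⟨UnitAddCircle.measure_univ⟩
  have hε1 : ε ≤ ε₁ := hεε.le.trans ((min_le_left _ _).trans (min_le_left _ _))
  have hε2 : ε ≤ ε₂ := hεε.le.trans ((min_le_left _ _).trans (min_le_right _ _))
  -- For `m = 1` the event may contain points outside `I`; the trivial bound suffices, as the
  -- constant is at least `1`.
  rcases eq_or_lt_of_le hm with rfl | hm1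
  · rw [Nat.cast_one, Nat.cast_one, Real.one_rpow, mul_one]
    have : IsProbabilityMeasure (noiseProd ε hε) := by
      unfold noiseProd; infer_instance
    calc _ ≤ (1 : ℝ≥0∞) := prob_le_one
      _ = ENNReal.ofReal 1 := ENNReal.ofReal_one.symm
      _ ≤ _ := ENNReal.ofReal_le_ofReal (le_max_right _ _)
  have h1 := hprob ε hε (hεε.le.trans (min_le_right _ _)) (clampedStep f ε) I (noise ε)
    (volume : Measure Circ) (measurable_clampedStep hf.continuous ε)
    (hI.measurableSet (finite_fixedSet f P N)) (hstay ε hε hε2).1 (hstay ε hε hε2).2 m hm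
  refine (measure_mono_ae ?_).trans (h1.trans (ENNReal.ofReal_le_ofReal ?_))
  swap
  · gcongr
    exact le_max_left _ _
  filter_upwards [ae_forall_abs_le_noise hε] with ⟨x, t⟩ ht hxt
  change ∀ i, |t i| ≤ ε at ht
  change (m : ℕ∞) ≤ firstExpansionTime α f I τ K₀ x t at hxt
  have hmin : ∀ n, IsExpansionTime α f I τ K₀ x t n → m ≤ n := fun n hn =>
    by exact_mod_cast hxt.trans (iInf₂_le n hn)
  have hchain : ∀ n, chain (clampedStep f ε) x t n = randIter f t n x := by
    intro n
    rw [chain_clampedStep]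
    congr 1
    funext i
    exact clamp_of_mem (abs_le.1 (ht i))
  refine ⟨?_, fun n hn hnm hnI => ?_⟩
  · by_contra hx
    have := hmin 1 (isExpansionTime_one hα₀.le hf hK₀1 hx t)
    omega
  · by_contra hle
    change chain (clampedStep f ε) x t n ∉ I at hnI
    rw [hchain] at hnI
    refine absurd (hmin n ⟨hn, ?_, iInf₂_le n hnI⟩) (by omega)
    refine (hdist ε hε hε1 t ht _ x hchain n hnI).trans (ENNReal.ofReal_le_ofReal ?_)
    have h2 := ENNReal.toReal_mono ENNReal.ofReal_ne_top (not_lt.1 hle)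
    rw [ENNReal.toReal_ofReal (by linarith)] at h2
    change (weight (clampedStep f ε) I _ _ x 0 t n).toReal ≤ K at h2
    have h3 := mul_le_mul_of_nonneg_left h2 hA.le
    linarith

end

end CircleNoise

end

theorem theorem2p1 (α : ℝ) (hα₀ : 0 < α) (hα₁ : α < 1)
    (f : CircleNoise.Circ → CircleNoise.Circ) (P : Finset CircleNoise.Circ) (N : ℕ)
    (hf : CircleNoise.IsNeutralExpanding α f P N)
    (I : Set CircleNoise.Circ)
    (hI : CircleNoise.IsEscapeNhd f (CircleNoise.fixedSet f P N) I)
    (τ : ℝ) (hτ : CircleNoise.IsScale f I τ) (α' : ℝ) (hα' : α < α') (hα'₁ : α' < 1) :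
    ∃ K₀ : ℝ, 0 < K₀ ∧ ∃ C₀ : ℝ, 0 < C₀ ∧ ∃ ε₀ : ℝ, 0 < ε₀ ∧
      ∀ (ε : ℝ) (hε : 0 < ε), ε < ε₀ → ∀ m : ℕ, 1 ≤ m →
        CircleNoise.noiseProd ε hε
            {p | (m : ℕ∞) ≤ CircleNoise.firstExpansionTime α f I τ K₀ p.1 p.2}
          ≤ ENNReal.ofReal (C₀ * (m : ℝ) ^ (-(1 / α'))) := by
  obtain ⟨K₀, hK₀, C₀, hC₀, ε₀, hε₀, h⟩ :=
    CircleNoise.measure_le_firstExpansionTime_le hα₀ hα₁ hf hI hτ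
  refine ⟨K₀, hK₀, C₀, hC₀, ε₀, hε₀, fun ε hε hεε m hm =>
    (h ε hε hεε m hm).trans (ENNReal.ofReal_le_ofReal ?_)⟩
  -- The exponent is weakened from `1/α` to `1/α'`, which is harmless for `m ≥ 1`.
  have hm1 : (1 : ℝ) ≤ m := by exact_mod_cast hm
  exact mul_le_mul_of_nonneg_left (Real.rpow_le_rpow_of_exponent_le hm1
    (neg_le_neg (one_div_le_one_div_of_le hα₀ hα'.le))) hC₀.le
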